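/- Let $k$ be a field that is complete with respect to a non-trivial non-Archimedean absolute value $|\cdot|$, let $X$ be an integral projective $k$-scheme, $Y\subseteq X$ a non-empty reduced closed subscheme, and $L$ an ample invertible $\mathcal O_X$-module. Write $X^{\mathrm{an}}$ for the Berkovich analytification of $X$ and $\widehat\kappa(x)$ for the completed residue field of $x\in X^{\mathrm{an}}$. Put $V_n(L)=H^0(X,L^{\otimes n})$, $V_\bullet(L)=\bigoplus_{n\ge 0}V_n(L)$, and let $V_\bullet(L_{X|Y})$ be the image of the restriction homomorphism $V_\bullet(L)\to V_\bullet(L|_Y)$. A metric $\phi$ on $L$ is a family of norms $|\cdot|_\phi(x)$ on the one-dimensional $\widehat\kappa(x)$-vector spaces $L(x)$, $x\in X^{\mathrm{an}}$; it induces metrics $n\phi$ on $L^{\otimes n}$ and, by restriction, $\phi|_Y$ on $L|_Y$. For a norm $\|\cdot\|_n$ on $V_n(L)$ with $L^{\otimes n}$ globally generated, the Fubini–Study metric $\mathrm{FS}(\|\cdot\|_n)$ on $L^{\otimes n}$ is given at $x$ by the quotient norm, under the evaluation map $V_n(L)\otimes_k\widehat\kappa(x)\to L^{\otimes n}(x)$,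 of the scalar extension $\|w\|_{n,\widehat\kappa(x)}=\sup_{0\ne\ell\in V_n(L)^\vee}|(\ell\otimes 1)(w)|/\|\ell\|_n^\vee$, where $\|\ell\|_n^\vee=\sup_{v\ne0}|\ell(v)|/\|v\|_n$. Let $\frac1n\mathrm{FS}(\|\cdot\|_n)$ be the metric on $L$ whose $n$-th tensor power is $\mathrm{FS}(\|\cdot\|_n)$. The metric $\phi$ is called asymptotic Fubini–Study if there are norms $\|\cdot\|_n$ on $V_n(L)$, $n\in\mathbb N$, such that $\frac1n\mathrm{FS}(\|\cdot\|_n)$ (which is defined for all large $n$) converges to $\phi$ uniformly on $X^{\mathrm{an}}$, i.e. $\sup_{x\in X^{\mathrm{an}}}\bigl|\log\bigl(|\cdot|_{\frac1n\mathrm{FS}(\|\cdot\|_n)}(x)/|\cdot|_{\phi}(x)\bigr)\bigr|\to 0$. Let $\phi$ be an asymptotic Fubini–Study metric on $L$. For $\underline s=(s_n)_n\in V_\bullet(L)$ put $|||\underline s|||_\phi=\sup_n\sup_{x\in X^{\mathrm{an}}}|s_n|_{n\phi}(x)$, and define on $V_\bullet(L_{X|Y})$ $$|||\underline t|||_{\phi,X|Y}=\inf\{|||\underline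 s|||_\phi:\ \underline s\in V_\bullet(L),\ \underline s|_Y=\underline t\},\qquad |||\underline t|||_{\phi|_Y}=\sup_n\sup_{y\in Y^{\mathrm{an}}}|t_n|_{n\phi|_Y}(y).$$ Then both are (finite) $k$-algebra norms on $V_\bullet(L_{X|Y})$ taking the value $1$ at the unit, and the spectral seminorm of the first is the second: $$\lim_{n\to\infty}|||\underline t^{\,n}|||_{\phi,X|Y}^{1/n}=|||\underline t|||_{\phi|_Y}\qquad\text{for all }\underline t\in V_\bullet(L_{X|Y}).$$ Moreover, if $\widehat V_\bullet(L_{X|Y},\phi_{X|Y})$ and $\widehat V_\bullet(L_{X|Y},\phi|_Y)$ denote the Banach $k$-algebras obtained by completing $V_\bullet(L_{X|Y})$ for these two norms, there is a canonical homeomorphism of Berkovich spectra $$\mathfrak M(\widehat V_\bullet(L_{X|Y},\phi_{X|Y}))\simeq\mathfrak M(\widehat V_\bullet(L_{X|Y},\phi|_Y)),$$ namely one under which corresponding multiplicative seminorms have the same restriction to $V_\bullet(L_{X|Y})$. -/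

import Mathlib

open CategoryTheory AlgebraicGeometry Opposite TopologicalSpace
open scoped DirectSum TensorProduct ENNReal Topology

universe u

noncomputable section

namespace NormedSections

/-! ### Schemes over a field -/

section Structure

variable (k : Type u) [CommRing k] {X : Scheme.{u}} [X.Over (Spec (CommRingCat.of k))]

/-- The ring homomorphism `k → Γ(X, U)` of a scheme over `Spec k`. -/
def structureHom (U : X.Opens) : k →+* Γ(X, U) :=
  ((X ↘ Spec (CommRingCat.of k)).appLE ⊤ U le_top).hom.comp
    (Scheme.ΓSpecIso (CommRingCat.of k)).inv.hom

instance algebraSections (U : X.Opens) : Algebra k Γ(X, U) :=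
  (structureHom k U).toAlgebra

/-- The ring homomorphism from `k` to the residue field of a point of a `k`-scheme. -/
def residueHom (x : X) : k →+* X.residueField x :=
  (X.evaluation ⊤ x trivial).hom.comp (structureHom k ⊤)

theorem map_structureHom {U V : X.Opens} (h : V ≤ U) (a : k) :
    X.presheaf.map (homOfLE h).op (structureHom k U a) = structureHom k V a := by
  have := (X ↘ Spec (CommRingCat.of k)).appLE_map (U := ⊤) (V := U) le_top (homOfLE h).op
  simp only [structureHom, RingHom.comp_apply]
  rw [← this]
  rfl

theorem evaluation_structureHom (U : X.Opens) (x : X) (hx : x ∈ U) (a : k) :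
    X.evaluation U x hx (structureHom k U a) = residueHom k x a := by
  rw [residueHom, RingHom.comp_apply, ← map_structureHom k (le_top : U ≤ ⊤)]
  have := X.presheaf.germ_res_apply (homOfLE (le_top : U ≤ ⊤)) x hx (structureHom k ⊤ a)
  exact congrArg (X.residue x) this

theorem app_structureHom {Y : Scheme.{u}} [Y.Over (Spec (CommRingCat.of k))] (f : Y ⟶ X)
    [f.IsOver (Spec (CommRingCat.of k))] (U : X.Opens) (a : k) :
    f.app U (structureHom k U a) = structureHom k (f ⁻¹ᵁ U) a := by
  have h : f ≫ (X ↘ Spec (CommRingCat.of k)) = Y ↘ Spec (CommRingCat.of k) :=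
    comp_over f (Spec (CommRingCat.of k))
  simp only [structureHom, RingHom.comp_apply, ← h]
  rw [← Scheme.Hom.appLE_comp_appLE f (X ↘ Spec (CommRingCat.of k)) ⊤ U (f ⁻¹ᵁ U) le_top le_rfl,
    Scheme.Hom.app_eq_appLE]
  rfl

end Structure

section Projective

attribute [local instance] MvPolynomial.gradedAlgebra

/-- `X` is projective over `k`: it is isomorphic, over `k`, to a closed subscheme of some
projective space `Proj k[T₀, …, T_N]`. -/
def IsProjectiveOver (k : Type u) [CommRing k] (X : Scheme.{u})
    [X.Over (Spec (CommRingCat.of k))] : Prop :=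
  ∃ (N : ℕ) (j : X ⟶ Proj (MvPolynomial.homogeneousSubmodule (Fin (N + 1)) k)),
    IsClosedImmersion j ∧
      j ≫ Proj.toSpecZero (MvPolynomial.homogeneousSubmodule (Fin (N + 1)) k) ≫
        Spec.map (CommRingCat.ofHom (algebraMap k
          (MvPolynomial.homogeneousSubmodule (Fin (N + 1)) k 0))) =
      X ↘ Spec (CommRingCat.of k)

end Projective

/-! ### Invertible modules -/

/-- A line bundle on `X` given by an open cover `U i` with frames `e i` on `U i` and
transition functions `g i j` on `U i ∩ U j`, the convention being `e j = g i j • e i`. -/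
structure LineBundle (X : Scheme.{u}) where
  ι : Type u
  U : ι → X.Opens
  covers : ∀ x : X, ∃ i, x ∈ U i
  g : ∀ i j, Γ(X, U i ⊓ U j)
  g_self : ∀ i, g i i = 1
  g_trans : ∀ i j l,
    X.presheaf.map (homOfLE (inf_le_left : U i ⊓ U j ⊓ U l ≤ U i ⊓ U j)).op (g i j) *
      X.presheaf.map (homOfLE (le_inf (inf_le_left.trans inf_le_right) inf_le_right :
        U i ⊓ U j ⊓ U l ≤ U j ⊓ U l)).op (g j l) =
      X.presheaf.map (homOfLE (le_inf (inf_le_left.trans inf_le_left) inf_le_right :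
        U i ⊓ U j ⊓ U l ≤ U i ⊓ U l)).op (g i l)

section Modules

variable {X : Scheme.{u}} (M : X.Modules)

/-- The restriction of a section of an `𝒪_X`-module to a smaller open subset. -/
def restr {U V : X.Opens} (h : V ≤ U) (e : Γ(M, U)) : Γ(M, V) :=
  M.presheaf.map (homOfLE h).op e

/-- `e` is a frame of `M` on `U`: multiplication by `e` is an isomorphism `𝒪_U → M|_U`. -/
def IsFrame (U : X.Opens) (e : Γ(M, U)) : Prop :=
  ∀ (V : X.Opens) (h : V ≤ U),
    Function.Bijective (fun f : Γ(X, V) => f • restr M h e)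

/-- `M` is an invertible `𝒪_X`-module: it is locally isomorphic to `𝒪_X`. -/
def IsInvertible : Prop :=
  ∀ x : X, ∃ (U : X.Opens) (e : Γ(M, U)), x ∈ U ∧ IsFrame M U e

/-- The type of all local frames of `M`. -/
structure Frame where
  U : X.Opens
  e : Γ(M, U)
  isFrame : IsFrame M U e

variable {M}

theorem restr_restr {U V W : X.Opens} (h : V ≤ U) (h' : W ≤ V) (e : Γ(M, U)) :
    restr M h' (restr M h e) = restr M (h'.trans h) e := by
  have h := M.presheaf.map_comp (homOfLE h).op (homOfLE h').op
  exact (congrArg (fun φ => φ e) h).symm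

theorem restr_smul {U V : X.Opens} (h : V ≤ U) (f : Γ(X, U)) (e : Γ(M, U)) :
    restr M h (f • e) = X.presheaf.map (homOfLE h).op f • restr M h e :=
  M.map_smul _ _ _

/-- The function `g` with `b.e = g • a.e` on the intersection of the domains of `a` and `b`. -/
def Frame.transition (a b : Frame M) : Γ(X, a.U ⊓ b.U) :=
  ((a.isFrame (a.U ⊓ b.U) inf_le_left).2 (restr M inf_le_right b.e)).choose

theorem Frame.transition_smul (a b : Frame M) :
    a.transition b • restr M inf_le_left a.e =
      restr M (inf_le_right : a.U ⊓ b.U ≤ b.U) b.e :=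
  ((a.isFrame (a.U ⊓ b.U) inf_le_left).2 (restr M inf_le_right b.e)).choose_spec

variable (M)

/-- The line bundle of an invertible module, described by all of its local frames. -/
def lineBundle (hM : IsInvertible M) : LineBundle X where
  ι := Frame M
  U := Frame.U
  covers x := by
    obtain ⟨U, e, hx, he⟩ := hM x
    exact ⟨⟨U, e, he⟩, hx⟩
  g a b := a.transition b
  g_self a := by
    apply (a.isFrame _ inf_le_left).1
    simp only [one_smul]
    exact a.transition_smul a
  g_trans a b c := by
    apply (a.isFrame (a.U ⊓ b.U ⊓ c.U) (inf_le_left.trans inf_le_left)).1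
    have hab := congrArg (restr M (inf_le_left : a.U ⊓ b.U ⊓ c.U ≤ a.U ⊓ b.U))
      (a.transition_smul b)
    have hbc := congrArg (restr M (le_inf (inf_le_left.trans inf_le_right) inf_le_right :
        a.U ⊓ b.U ⊓ c.U ≤ b.U ⊓ c.U)) (b.transition_smul c)
    have hac := congrArg (restr M (le_inf (inf_le_left.trans inf_le_left) inf_le_right :
        a.U ⊓ b.U ⊓ c.U ≤ a.U ⊓ c.U)) (a.transition_smul c)
    simp only [restr_smul, restr_restr] at hab hbc hac
    simp only
    rw [hac, mul_comm, mul_smul, hab, hbc]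

end Modules

namespace LineBundle

variable {X Y : Scheme.{u}}

theorem app_map (f : Y ⟶ X) {U V : X.Opens} (h : V ≤ U) (a : Γ(X, U)) :
    f.app V (X.presheaf.map (homOfLE h).op a) =
      Y.presheaf.map (homOfLE (f.preimage_mono h)).op (f.app U a) :=
  congrArg (fun φ => φ a) (f.naturality (homOfLE h).op)

/-- The pull-back of a line bundle along a morphism of schemes. -/
def pullback (L : LineBundle X) (f : Y ⟶ X) : LineBundle Y where
  ι := L.ι
  U i := f ⁻¹ᵁ L.U i
  covers y := L.covers (f y)
  g i j := f.app (L.U i ⊓ L.U j) (L.g i j)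
  g_self i := by rw [L.g_self]; exact map_one _
  g_trans i j l := by
    have h := congrArg (f.app (L.U i ⊓ L.U j ⊓ L.U l)) (L.g_trans i j l)
    rw [map_mul, app_map, app_map, app_map] at h
    exact h

section Sections

variable (k : Type u) [CommRing k] [X.Over (Spec (CommRingCat.of k))] (L : LineBundle X)

/-- The space `V_n(L) = H⁰(X, L^{⊗ n})`. A section `s` is given by its coordinates `s i` on
`U i` with respect to the frames `e i ^ n`; they satisfy `s i = (g i j) ^ n * s j`. -/
def sections (n : ℕ) : Submodule k (∀ i, Γ(X, L.U i)) where
  carrier := {s | ∀ i j,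
    X.presheaf.map (homOfLE (inf_le_left : L.U i ⊓ L.U j ≤ L.U i)).op (s i) =
      L.g i j ^ n * X.presheaf.map (homOfLE (inf_le_right : L.U i ⊓ L.U j ≤ L.U j)).op (s j)}
  add_mem' {s t} hs ht i j := by
    simp only [Pi.add_apply, map_add, hs i j, ht i j, mul_add]
  zero_mem' i j := by simp
  smul_mem' a s hs i j := by
    simp only [Pi.smul_apply, Algebra.smul_def, map_mul, hs i j]
    have h (U V : X.Opens) (h : V ≤ U) :
      X.presheaf.map (homOfLE h).op (algebraMap k Γ(X, U) a) = algebraMap k Γ(X, V) a :=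
      map_structureHom k h a
    rw [h, h]
    ring

instance gradedMonoid : SetLike.GradedMonoid (L.sections k) where
  one_mem i j := by simp
  mul_mem m n s t hs ht i j := by
    simp only [Pi.mul_apply, map_mul, hs i j, ht i j]
    ring

/-- The graded `k`-algebra `V_•(L) = ⨁ₙ V_n(L)`. -/
def SectionAlgebra : Type u := ⨁ n, L.sections k n

instance : CommRing (L.SectionAlgebra k) :=
  inferInstanceAs (CommRing (⨁ n, L.sections k n))

instance : Algebra k (L.SectionAlgebra k) :=
  inferInstanceAs (Algebra k (⨁ n, L.sections k n))

variable {k L}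

/-- The homogeneous component of degree `n`. -/
def SectionAlgebra.component (s : L.SectionAlgebra k) (n : ℕ) : L.sections k n :=
  DirectSum.component k ℕ (fun n => L.sections k n) n s

/-- The open set `X_s` where a section `s` of `L^{⊗ n}` does not vanish. -/
def nonvanishing {n : ℕ} (s : L.sections k n) : X.Opens :=
  ⨆ i, X.basicOpen (s.1 i)

variable (k L)

/-- `L` is ample: the non-vanishing loci `X_s` that are affine, with `s` a global section of some
`L^{⊗ n}`, `n ≥ 1`, cover `X` (for `X` quasi-compact). -/
def IsAmple : Prop :=
  CompactSpace X ∧ ∀ x : X, ∃ n : ℕ, 0 < n ∧ ∃ s : L.sections k n,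
    x ∈ nonvanishing s ∧ IsAffineOpen (nonvanishing s)

variable [Y.Over (Spec (CommRingCat.of k))] (f : Y ⟶ X) [f.IsOver (Spec (CommRingCat.of k))]

/-- The pull-back `V_n(L) → V_n(f^* L)` of sections. -/
def sectionsPullback (n : ℕ) : L.sections k n →ₗ[k] (L.pullback f).sections k n where
  toFun s := ⟨fun i => f.app (L.U i) (s.1 i), fun i j => by
    have h := congrArg (f.app (L.U i ⊓ L.U j)) (s.2 i j)
    rw [map_mul, map_pow, app_map, app_map] at h
    exact h⟩
  map_add' s t := by
    ext i
    exact map_add (f.app (L.U i)).hom (s.1 i) (t.1 i)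
  map_smul' a s := by
    ext i
    refine (map_mul (f.app (L.U i)).hom (structureHom k (L.U i) a) (s.1 i)).trans ?_
    exact congrArg (· * _) (app_structureHom k f (L.U i) a)

/-- The homomorphism of graded `k`-algebras `V_•(L) → V_•(f^* L)`. -/
def algebraPullback : L.SectionAlgebra k →ₐ[k] (L.pullback f).SectionAlgebra k :=
  DirectSum.toAlgebra k (fun n => L.sections k n)
    (B := ⨁ n, (L.pullback f).sections k n)
    (fun n => DirectSum.lof k ℕ (fun n => (L.pullback f).sections k n) n ∘ₗ
      L.sectionsPullback k f n)
    (by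
      refine congrArg (DirectSum.lof k ℕ (fun n => (L.pullback f).sections k n) 0) ?_
      ext i
      exact map_one (f.app (L.U i)).hom)
    (fun {m n} s t => by
      simp only [LinearMap.comp_apply, DirectSum.lof_eq_of, DirectSum.of_mul_of]
      congr 1
      ext i
      exact map_mul (f.app (L.U i)).hom (s.1 i) (t.1 i))

/-- The restricted section algebra `V_•(L_{X|Y})`, the image of `V_•(L) → V_•(L|_Y)`. -/
abbrev RestrictedAlgebra : Subalgebra k ((L.pullback f).SectionAlgebra k) :=
  (L.algebraPullback k f).range

end Sections

end LineBundle

/-! ### Berkovich analytification -/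

section Analytification

variable (k : Type u) [NormedField k] (X : Scheme.{u}) [X.Over (Spec (CommRingCat.of k))]

/-- A point of the Berkovich analytification of `X`: a point of `X` together with an absolute
value on its residue field that extends the absolute value of `k`. -/
structure Analytification where
  pt : X
  abs : AbsoluteValue (X.residueField pt) ℝ
  abs_residueHom : ∀ a : k, abs (residueHom k pt a) = ‖a‖

namespace Analytification

variable {k X}

/-- The value `|f|(x)` of a regular function at a point of the analytification. -/
def absEval (x : Analytification k X) {U : X.Opens} (hx : x.pt ∈ U) (f : Γ(X, U)) : ℝ :=
  x.abs (X.evaluation U x.pt hx f)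

theorem absEval_mul (x : Analytification k X) {U : X.Opens} (hx : x.pt ∈ U) (f g : Γ(X, U)) :
    x.absEval hx (f * g) = x.absEval hx f * x.absEval hx g := by
  simp [absEval]

theorem absEval_pow (x : Analytification k X) {U : X.Opens} (hx : x.pt ∈ U) (f : Γ(X, U))
    (n : ℕ) : x.absEval hx (f ^ n) = x.absEval hx f ^ n := by
  simp [absEval]

theorem absEval_restrict (x : Analytification k X) {U V : X.Opens} (h : V ≤ U) (hx : x.pt ∈ V)
    (f : Γ(X, U)) :
    x.absEval hx (X.presheaf.map (homOfLE h).op f) = x.absEval (h hx) f :=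
  congrArg (fun a => x.abs (X.residue x.pt a))
    (X.presheaf.germ_res_apply (homOfLE h) x.pt hx f)

/-- The Berkovich topology: the coarsest one for which, for each Zariski open subset `U` and each
regular function `f` on `U`, the set `U^an` is open and `|f|` is continuous on it. -/
instance : TopologicalSpace (Analytification k X) :=
  TopologicalSpace.generateFrom
    {S | ∃ (U : X.Opens) (f : Γ(X, U)) (p q : ℝ),
      S = {x | ∃ hx : x.pt ∈ U, p < x.absEval hx f ∧ x.absEval hx f < q}}

/-- The completed residue field of a point of the analytification. -/
abbrev CompletedResidueField (x : Analytification k X) : Type u := x.abs.Completion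

/-- The homomorphism from the residue field to its completion. -/
def toCompleted (x : Analytification k X) :
    X.residueField x.pt →+* x.CompletedResidueField :=
  (UniformSpace.Completion.coeRingHom (α := WithAbs x.abs)).comp
    (WithAbs.equiv x.abs).symm.toRingHom

instance (x : Analytification k X) : Algebra k x.CompletedResidueField :=
  (x.toCompleted.comp (residueHom k x.pt)).toAlgebra

/-- The map of analytifications induced by a morphism of `k`-schemes. -/
def map {Y : Scheme.{u}} [Y.Over (Spec (CommRingCat.of k))] (f : Y ⟶ X)
    [f.IsOver (Spec (CommRingCat.of k))] (y : Analytification k Y) : Analytification k X where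
  pt := f y.pt
  abs := y.abs.comp (f := (f.residueFieldMap y.pt).hom) (RingHom.injective _)
  abs_residueHom a := by
    have hy : f y.pt ∈ (⊤ : X.Opens) := trivial
    have h := y.abs_residueHom a
    rw [← evaluation_structureHom k (f ⁻¹ᵁ ⊤) y.pt hy, ← app_structureHom k f ⊤ a] at h
    exact (congrArg y.abs (Scheme.evaluation_naturality_apply f y.pt hy _)).trans h

theorem absEval_map {Y : Scheme.{u}} [Y.Over (Spec (CommRingCat.of k))] (f : Y ⟶ X)
    [f.IsOver (Spec (CommRingCat.of k))] (y : Analytification k Y) {U : X.Opens}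
    (hy : f y.pt ∈ U) (a : Γ(X, U)) :
    (y.map f).absEval hy a = y.absEval (U := f ⁻¹ᵁ U) hy (f.app U a) :=
  congrArg y.abs (Scheme.evaluation_naturality_apply f y.pt hy a)

end Analytification

end Analytification

/-! ### Metrics on line bundles -/

namespace LineBundle

variable {k : Type u} [NormedField k] {X : Scheme.{u}} [X.Over (Spec (CommRingCat.of k))]

/-- A metric on `L`: a norm on each line `L(x)`, for `x` in the analytification of `X`. The norm
on the one-dimensional space `L(x)` over the completed residue field is recorded by its values
`|e i|(x) > 0` on the frames, which are subject to `|e j|(x) = |g i j|(x) * |e i|(x)`. -/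
structure Metric (k : Type u) [NormedField k] {X : Scheme.{u}}
    [X.Over (Spec (CommRingCat.of k))] (L : LineBundle X) where
  frameNorm : ∀ (i : L.ι) (x : Analytification k X), x.pt ∈ L.U i → ℝ
  frameNorm_pos : ∀ i x hx, 0 < frameNorm i x hx
  frameNorm_change : ∀ i j x (hi : x.pt ∈ L.U i) (hj : x.pt ∈ L.U j),
    frameNorm j x hj = x.absEval (U := L.U i ⊓ L.U j) ⟨hi, hj⟩ (L.g i j) * frameNorm i x hi

namespace Metric

variable {L : LineBundle X} (φ : Metric k L)

/-- The function `|s|_{nφ}` on the analytification of `X`, for `s` in `V_n(L)`: if `s = f • e ^ n`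
near `x`, with `e` a frame, then `|s|_{nφ}(x) = |f|(x) * |e|_φ(x) ^ n`. -/
def abs {n : ℕ} (s : L.sections k n) (x : Analytification k X) : ℝ :=
  x.absEval (L.covers x.pt).choose_spec (s.1 (L.covers x.pt).choose) *
    φ.frameNorm (L.covers x.pt).choose x (L.covers x.pt).choose_spec ^ n

theorem abs_eq {n : ℕ} (s : L.sections k n) (x : Analytification k X) (i : L.ι)
    (hi : x.pt ∈ L.U i) :
    φ.abs s x = x.absEval hi (s.1 i) * φ.frameNorm i x hi ^ n := by
  have key (j : L.ι) (hj : x.pt ∈ L.U j) :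
      x.absEval hj (s.1 j) * φ.frameNorm j x hj ^ n =
        x.absEval hi (s.1 i) * φ.frameNorm i x hi ^ n := by
    have hx : x.pt ∈ L.U i ⊓ L.U j := ⟨hi, hj⟩
    have h := congrArg (x.absEval hx) (s.2 i j)
    replace h := (x.absEval_restrict inf_le_left hx (s.1 i)).symm.trans h
    rw [x.absEval_mul, x.absEval_pow] at h
    replace h := h.trans (congrArg (_ * ·) (x.absEval_restrict inf_le_right hx (s.1 j)))
    rw [h, φ.frameNorm_change i j x hi hj, mul_pow]
    ring
  exact key _ _

/-- The supremum norm `‖s‖_{nφ}` of `s` in `V_n(L)`. -/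
def supNorm {n : ℕ} (s : L.sections k n) : ℝ≥0∞ :=
  ⨆ x : Analytification k X, ENNReal.ofReal (φ.abs s x)

/-- The supremum algebra norm `|||s|||_φ = supₙ ‖sₙ‖_{nφ}` on `V_•(L)`. -/
def algNorm (s : L.SectionAlgebra k) : ℝ≥0∞ :=
  ⨆ n, φ.supNorm (s.component n)

variable {Y : Scheme.{u}} [Y.Over (Spec (CommRingCat.of k))] (f : Y ⟶ X)
  [f.IsOver (Spec (CommRingCat.of k))]

/-- The pull-back of a metric; for a closed immersion it is the restriction `φ|_Y`. -/
def pullback : Metric k (L.pullback f) where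
  frameNorm i y hy := φ.frameNorm i (y.map f) hy
  frameNorm_pos i y hy := φ.frameNorm_pos i (y.map f) hy
  frameNorm_change i j y hi hj := by
    refine (φ.frameNorm_change i j (y.map f) hi hj).trans ?_
    exact congrArg (· * _) (y.absEval_map f (U := L.U i ⊓ L.U j) ⟨hi, hj⟩ (L.g i j))

/-- The quotient algebra norm `|||·|||_{φ, X|Y}` of `|||·|||_φ` on `V_•(L_{X|Y})`. -/
def quotientAlgNorm (t : L.RestrictedAlgebra k f) : ℝ≥0∞ :=
  ⨅ (s : L.SectionAlgebra k) (_ : L.algebraPullback k f s = t), φ.algNorm s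

end Metric

end LineBundle

/-! ### Fubini–Study metrics -/

section ScalarExtension

variable {k : Type*} [NormedField k] {V : Type*} [AddCommGroup V] [Module k V]

/-- The dual norm on `V^∨` of a norm on a (finite-dimensional) space `V`. -/
def dualNorm (p : Seminorm k V) (l : Module.Dual k V) : ℝ :=
  ⨆ v : V, ‖l v‖ / p v

/-- The scalar extension to `K ⊗ V` of a norm on a (finite-dimensional) space `V`. -/
def scalarExtension (p : Seminorm k V) (K : Type*) [NormedField K] [Algebra k K]
    (w : K ⊗[k] V) : ℝ :=
  ⨆ l : Module.Dual k V,
    ‖((Algebra.linearMap k K).comp l).liftBaseChange K w‖ / dualNorm p l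

end ScalarExtension

namespace LineBundle

variable {k : Type u} [NormedField k] {X : Scheme.{u}} [X.Over (Spec (CommRingCat.of k))]
  (L : LineBundle X)

/-- The coordinate, with respect to the frame `e i ^ n`, of the value at `x` of a section of
`L^{⊗ n}`. -/
def evalAt (n : ℕ) (i : L.ι) (x : Analytification k X) (hx : x.pt ∈ L.U i) :
    L.sections k n →ₗ[k] x.CompletedResidueField where
  toFun s := x.toCompleted (X.evaluation (L.U i) x.pt hx (s.1 i))
  map_add' s t := by simp
  map_smul' a s := by
    have h : X.evaluation (L.U i) x.pt hx ((a • s).1 i) =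
        residueHom k x.pt a * X.evaluation (L.U i) x.pt hx (s.1 i) := by
      rw [← evaluation_structureHom k (L.U i) x.pt hx a]
      exact map_mul (X.evaluation (L.U i) x.pt hx).hom (structureHom k (L.U i) a) (s.1 i)
    rw [h, map_mul]
    rfl

variable {L}

/-- The Fubini–Study metric `FS(‖·‖ₙ)` on `L^{⊗ n}` of a norm on `V_n(L)`, evaluated at the
frame `e i ^ n`: at `x` it is the quotient norm of the scalar extension of `‖·‖ₙ` under the
evaluation map `κ̂(x) ⊗ V_n(L) → L^{⊗ n}(x)`. -/
def fubiniStudy {n : ℕ} (p : Seminorm k (L.sections k n)) (i : L.ι) (x : Analytification k X)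
    (hx : x.pt ∈ L.U i) : ℝ :=
  sInf {r | ∃ w : x.CompletedResidueField ⊗[k] L.sections k n,
    (L.evalAt n i x hx).liftBaseChange x.CompletedResidueField w = 1 ∧
      r = scalarExtension p x.CompletedResidueField w}

/-- `φ` is an asymptotic Fubini–Study metric: there are norms `‖·‖ₙ` on the spaces `V_n(L)` such
that the metrics `(1/n) FS(‖·‖ₙ)` on `L` converge to `φ` uniformly. They are metrics for all
large `n`, when `L^{⊗ n}` is globally generated; this is the condition `0 < FS(‖·‖ₙ)`, because
the infimum over the empty set is `0`. -/
def Metric.IsAsymptoticFubiniStudy (φ : Metric k L) : Prop :=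
  ∃ p : ∀ n, Seminorm k (L.sections k n), (∀ n s, p n s = 0 → s = 0) ∧
    ∀ ε : ℝ, 0 < ε → ∀ᶠ n : ℕ in Filter.atTop, ∀ i x (hx : x.pt ∈ L.U i),
      0 < fubiniStudy (p n) i x hx ∧
      |Real.log (fubiniStudy (p n) i x hx ^ (1 / (n : ℝ)) / φ.frameNorm i x hx)| ≤ ε

end LineBundle

/-! ### Banach algebras -/

section Banach

variable {k : Type*} [NormedField k] {A : Type*} [CommRing A] [Algebra k A]

/-- The algebra `A` equipped with the norm `P`. -/
def WithAlgebraNorm (_ : AlgebraNorm k A) : Type _ := A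

variable (P : AlgebraNorm k A)

instance : NormedCommRing (WithAlgebraNorm P) :=
  { P.toRingNorm.toNormedRing, (inferInstance : CommRing A) with }

instance : NormedAlgebra k (WithAlgebraNorm P) :=
  { (inferInstance : Algebra k A) with
    norm_smul_le := fun a x => (map_smul_eq_mul P a x).le }

/-- The Banach algebra obtained by completing `A` with respect to the algebra norm `P`. -/
abbrev AlgebraCompletion : Type _ := UniformSpace.Completion (WithAlgebraNorm P)

/-- The canonical map of `A` into its completion. -/
def toCompletion (a : A) : AlgebraCompletion P :=
  UniformSpace.Completion.coe' (α := WithAlgebraNorm P) a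

end Banach

/-- The Berkovich spectrum of a Banach `k`-algebra: the bounded multiplicative `k`-algebra
seminorms on it. -/
structure BerkovichSpectrum (k : Type*) [NormedField k] (B : Type*) [NormedCommRing B]
    [NormedAlgebra k B] extends MulRingSeminorm B where
  smul' : ∀ (a : k) (b : B), toFun (a • b) = ‖a‖ * toFun b
  bounded' : ∃ C : ℝ, 0 < C ∧ ∀ b : B, toFun b ≤ C * ‖b‖

namespace BerkovichSpectrum

variable {k : Type*} [NormedField k] {B : Type*} [NormedCommRing B] [NormedAlgebra k B]

/-- The value `|b|_z`. -/
def eval (z : BerkovichSpectrum k B) (b : B) : ℝ := z.toMulRingSeminorm b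

/-- The weakest topology for which all functions `z ↦ |b|_z` are continuous. -/
instance : TopologicalSpace (BerkovichSpectrum k B) :=
  TopologicalSpace.induced eval inferInstance

end BerkovichSpectrum

end NormedSections

end

/-! Write `A` for the restricted section algebra, `P` for the quotient norm, `Q` for the supremum
norm over `Y^an`, and `ρ` for the spectral seminorm of `P`. By Gauss's lemma each point `x` of the
analytification gives a multiplicative seminorm `s ↦ maxₙ |sₙ|_{nφ}(x)` (`pointNorm`), and the
algebra norm of a metric is the supremum of these. So `Q` is power-multiplicative, and `Q ≤ P`
yields `Q ≤ ρ`. The content is `ρ ≤ Q`. Since `ρ` is non-Archimedean and `Q` is a supremum over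
degrees, it suffices to treat homogeneous `t`.

In degree `0` a lift of `t` to `X` is a global function, algebraic over the complete field `k`, so
its absolute value is the same at all points of `X^an`, and `Y^an` is non-empty. In degree `d > 0`,
if `ρ t ≠ 0`, the maximum modulus principle (`exists_mulRingSeminorm_eq_smoothingFun`, by Zorn)
gives a multiplicative `z ≤ P` with `z t = ρ t`. Pull `z` back to the section algebra of `L`. The
valuative criterion and ampleness give a section of positive degree with affine non-vanishing locus
on which `z` is non-zero (`exists_isAffineOpen_nonvanishing`). On that affine open set `z` induces a
valuation, whence a point of `X^an`; as `z` kills what vanishes on `Y`, the point lies in `Y^an`. So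
`z σ = |σᵢ|(y) c ^ m` for every `σ` of degree `m`, with a constant `c > 0`
(`exists_analytification_eq`).

It remains to see that `c` is at most the norm of the frame under `φ` (`Metric.le_frameNorm`). From
`z ≤ P` the fibre norm `c ^ n` is dominated by the supremum norm of `nφ`, hence up to `exp (n ε)` by
the norms `pₙ` defining `φ`. A Fubini–Study metric is a quotient norm, so it is the largest fibre
norm with such a bound, provided the bound survives scalar extension to the completed residue field.
That is `norm_liftBaseChange_le`, proved with almost orthogonal bases. Then `ρ t = z t ≤ |t|_φ(y) ≤
Q t`.

For the spectra: a multiplicative seminorm bounded by `P` is bounded by `ρ = Q`, so both completions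
carry the extensions of the same seminorms on `A`. -/

noncomputable section

namespace NormedSections

/-! ### The maximum modulus principle for the Berkovich spectrum -/

section MaximumPrinciple

variable {R : Type*} [CommRing R]

/-- The power-multiplicative non-Archimedean seminorms below `μ` for which multiplication by `t`
scales by `r`. -/
structure IsPowMulBelow (μ : R → ℝ) (t : R) (r : ℝ) (g : R → ℝ) : Prop where
  map_zero : g 0 = 0
  nonneg : ∀ x, 0 ≤ g x
  map_neg : ∀ x, g (-x) = g x
  add_le : ∀ x y, g (x + y) ≤ max (g x) (g y)
  mul_le : ∀ x y, g (x * y) ≤ g x * g y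
  map_one : g 1 = 1
  powMul : IsPowMul g
  le : ∀ x, g x ≤ μ x
  map_const_mul : ∀ x, g (t * x) = r * g x

namespace IsPowMulBelow

variable {μ : R → ℝ} {t : R} {r : ℝ} {g : R → ℝ}

/-- The bundled ring seminorm. -/
def toRingSeminorm (h : IsPowMulBelow μ t r g) : RingSeminorm R where
  toFun := g
  map_zero' := h.map_zero
  add_le' x y := (h.add_le x y).trans (max_le_add_of_nonneg (h.nonneg x) (h.nonneg y))
  neg' := h.map_neg
  mul_le' := h.mul_le

/-- Along a chain the pointwise infimum is a limit, and each condition is an equality or a weak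
inequality between continuous expressions, so it passes to the limit. This is the lower bound needed
for Zorn's lemma. -/
theorem iInf_of_isChain {c : Set (R → ℝ)} (hc : IsChain (· ≤ ·) c) (hne : c.Nonempty)
    (h : ∀ g ∈ c, IsPowMulBelow μ t r g) : IsPowMulBelow μ t r (fun x => ⨅ g : c, g.1 x) := by
  have : Nonempty c := hne.to_subtype
  have hdir : IsCodirectedOrder c := ⟨fun a b => by
    rcases hc.total a.2 b.2 with hab | hba
    · exact ⟨a, le_rfl, hab⟩
    · exact ⟨b, hba, le_rfl⟩⟩
  have lim (x : R) : Filter.Tendsto (fun g : c => g.1 x) Filter.atBot (𝓝 (⨅ g : c, g.1 x)) :=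
    tendsto_atBot_ciInf (fun a b hab => hab x)
      ⟨0, by rintro _ ⟨a, rfl⟩; exact (h a.1 a.2).nonneg x⟩
  have H (a : c) := h a.1 a.2
  refine ⟨?_, ?_, ?_, ?_, ?_, ?_, ?_, ?_, ?_⟩
  · simp [(H _).map_zero]
  · exact fun x => Real.iInf_nonneg fun a => (H a).nonneg x
  · exact fun x => iInf_congr fun a => (H a).map_neg x
  · exact fun x y => le_of_tendsto_of_tendsto' (lim _) ((lim x).max (lim y))
      fun a => (H a).add_le x y
  · exact fun x y => le_of_tendsto_of_tendsto' (lim _) ((lim x).mul (lim y))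
      fun a => (H a).mul_le x y
  · simp [(H _).map_one]
  · exact fun x n hn => tendsto_nhds_unique_of_eventuallyEq (lim _) ((lim x).pow n)
      (.of_forall fun a => (H a).powMul x hn)
  · exact fun x => le_of_tendsto' (lim x) fun a => (H a).le x
  · exact fun x => tendsto_nhds_unique_of_eventuallyEq (lim _) ((lim x).const_mul r)
      (.of_forall fun a => (H a).map_const_mul x)

/-- The seminorm `x ↦ lim g (x c ^ n) / g c ^ n` is smaller than `g` and makes `c` multiplicative.
Since `t` is already multiplicative for `g`, this modification does not change the factor `r`, so
the value at `t` does not drop. -/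
theorem seminormFromConst (h : IsPowMulBelow μ t r g) {c : R} (hc : g c ≠ 0) :
    IsPowMulBelow μ t r (seminormFromConst' c h.toRingSeminorm) := by
  have hf1 : h.toRingSeminorm 1 ≤ 1 := h.map_one.le
  have hc' : h.toRingSeminorm c ≠ 0 := hc
  have hpm : IsPowMul h.toRingSeminorm := h.powMul
  let N := _root_.seminormFromConst hf1 hc' hpm
  have hmul (y : R) : h.toRingSeminorm (t * y) = h.toRingSeminorm t * h.toRingSeminorm y := by
    have h1 := h.map_const_mul 1
    rw [mul_one, h.map_one, mul_one] at h1
    exact (h.map_const_mul y).trans (congrArg (· * g y) h1.symm)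
  refine ⟨_root_.map_zero N, fun x => apply_nonneg N x, fun x => map_neg_eq_map N x, ?_, map_mul_le_mul N,
    seminormFromConst_one hf1 hc' hpm, seminormFromConst_isPowMul hf1 hc' hpm,
    fun x => (seminormFromConst_le_seminorm hf1 hc' hpm x).trans (h.le x), fun x => ?_⟩
  · exact seminormFromConst_isNonarchimedean hf1 hc' hpm h.add_le
  · rw [seminormFromConst_isMul_of_isMul hf1 hc' hpm hmul,
      seminormFromConst_apply_of_isMul hf1 hc' hpm hmul]
    congr 1
    have h1 := h.map_const_mul 1
    rwa [mul_one, h.map_one, mul_one] at h1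

end IsPowMulBelow

/-- The spectral radius of an element `t` for a non-Archimedean seminorm is attained by a bounded
multiplicative seminorm. -/
theorem exists_mulRingSeminorm_eq_smoothingFun (μ : RingSeminorm R) (h1 : μ 1 ≤ 1)
    (hna : IsNonarchimedean μ) (t : R) (ht : smoothingFun μ t ≠ 0) :
    ∃ z : MulRingSeminorm R, IsNonarchimedean z ∧ (∀ x, z x ≤ μ x) ∧ z t = smoothingFun μ t := by
  let ρ := smoothingSeminorm μ h1 hna
  have hρ1 : ρ 1 ≤ 1 := smoothingFun_one_le μ h1
  have hρpm : IsPowMul ρ := isPowMul_smoothingFun μ h1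
  have hρt : ρ t ≠ 0 := ht
  let N := seminormFromConst hρ1 hρt hρpm
  -- The spectral seminorm `ρ` need not make `t` multiplicative; passing to `N` repairs this and
  -- keeps the value at `t`.
  have start : IsPowMulBelow μ t (ρ t) N :=
    ⟨map_zero N, fun x => apply_nonneg N x, fun x => map_neg_eq_map N x,
      seminormFromConst_isNonarchimedean hρ1 hρt hρpm (isNonarchimedean_smoothingFun μ h1 hna),
      map_mul_le_mul N, seminormFromConst_one hρ1 hρt hρpm,
      seminormFromConst_isPowMul hρ1 hρt hρpm,
      fun x => (seminormFromConst_le_seminorm hρ1 hρt hρpm x).trans (smoothingFun_le_self μ x),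
      fun x => (seminormFromConst_const_mul hρ1 hρt hρpm x).trans
        (congrArg (· * N x) (seminormFromConst_apply_c hρ1 hρt hρpm))⟩
  -- The order dual turns the maximal element of Zorn's lemma into a minimal seminorm.
  obtain ⟨g, -, hg⟩ := zorn_le_nonempty₀ (α := (R → ℝ)ᵒᵈ)
    {g | IsPowMulBelow μ t (ρ t) (OrderDual.ofDual g)} (fun c hcS hc y hy =>
      ⟨OrderDual.toDual fun x => ⨅ g : c, OrderDual.ofDual g.1 x,
        IsPowMulBelow.iInf_of_isChain (c := c) hc.symm ⟨y, hy⟩ hcS,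
        fun a ha x => ciInf_le (f := fun g : c => OrderDual.ofDual g.1 x)
          ⟨0, by rintro _ ⟨b, rfl⟩; exact (hcS b.2).nonneg x⟩ ⟨a, ha⟩⟩) _ start
  have G : IsPowMulBelow μ t (ρ t) (OrderDual.ofDual g) := hg.prop
  set γ : R → ℝ := OrderDual.ofDual g with hγ
  have mul (x y : R) : γ (x * y) = γ x * γ y := by
    by_cases hx : γ x = 0
    · refine le_antisymm (G.mul_le x y) ?_
      rw [hx, zero_mul]
      exact G.nonneg _
    · have hf1 : G.toRingSeminorm 1 ≤ 1 := G.map_one.le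
      -- Minimality: making `x` multiplicative cannot decrease `γ`, so `x` was multiplicative
      -- already.
      have hle : γ ≤ seminormFromConst' x G.toRingSeminorm :=
        hg.le_of_ge (y := OrderDual.toDual (seminormFromConst' x G.toRingSeminorm))
          (G.seminormFromConst hx) fun w => seminormFromConst_le_seminorm hf1 hx G.powMul w
      have heq (w : R) : seminormFromConst' x G.toRingSeminorm w = γ w :=
        le_antisymm (seminormFromConst_le_seminorm hf1 hx G.powMul w) (hle w)
      have := seminormFromConst_const_mul hf1 hx G.powMul y
      rwa [heq, heq, heq] at this
  refine ⟨{ G.toRingSeminorm with map_one' := G.map_one, map_mul' := mul }, G.add_le, G.le, ?_⟩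
  have := G.map_const_mul 1
  rw [mul_one, G.map_one, mul_one] at this
  exact this

end MaximumPrinciple

/-! ### Completions with the same spectrum -/

section Spectrum

variable {k : Type*} [NormedField k] {A : Type*} [CommRing A] [Algebra k A]

theorem norm_toCompletion (Q : AlgebraNorm k A) (a : A) : ‖toCompletion Q a‖ = Q a :=
  UniformSpace.Completion.norm_coe (E := WithAlgebraNorm Q) a

theorem toCompletion_add (Q : AlgebraNorm k A) (a b : A) :
    toCompletion Q (a + b) = toCompletion Q a + toCompletion Q b :=
  UniformSpace.Completion.coe_add (α := WithAlgebraNorm Q) a b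

theorem toCompletion_neg (Q : AlgebraNorm k A) (a : A) :
    toCompletion Q (-a) = -toCompletion Q a :=
  UniformSpace.Completion.coe_neg (α := WithAlgebraNorm Q) a

theorem toCompletion_mul (Q : AlgebraNorm k A) (a b : A) :
    toCompletion Q (a * b) = toCompletion Q a * toCompletion Q b :=
  UniformSpace.Completion.coe_mul (α := WithAlgebraNorm Q) a b

theorem toCompletion_smul (Q : AlgebraNorm k A) (c : k) (a : A) :
    toCompletion Q (c • a) = c • toCompletion Q a :=
  UniformSpace.Completion.coe_smul (X := WithAlgebraNorm Q) c a

theorem denseRange_toCompletion (Q : AlgebraNorm k A) : DenseRange (toCompletion Q) :=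
  UniformSpace.Completion.denseRange_coe (α := WithAlgebraNorm Q)

namespace BerkovichSpectrum

section

variable {B : Type*} [NormedCommRing B] [NormedAlgebra k B] (z : BerkovichSpectrum k B)

theorem ext_eval {z w : BerkovichSpectrum k B} (h : ∀ b, z.eval b = w.eval b) : z = w := by
  obtain ⟨z, _, _⟩ := z
  obtain ⟨w, _, _⟩ := w
  have : z = w := DFunLike.ext _ _ h
  subst this
  rfl

theorem eval_mul (a b : B) : z.eval (a * b) = z.eval a * z.eval b :=
  map_mul z.toMulRingSeminorm a b

theorem eval_pow (a : B) (n : ℕ) : z.eval (a ^ n) = z.eval a ^ n :=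
  map_pow z.toMulRingSeminorm a n

theorem eval_nonneg (a : B) : 0 ≤ z.eval a := apply_nonneg z.toMulRingSeminorm a

/-- A bounded multiplicative seminorm is bounded by any function that dominates the spectral
radius. -/
theorem eval_le_of_tendsto {b : B} {r : ℝ}
    (h : Filter.Tendsto (fun n : ℕ => ‖b ^ n‖ ^ (1 / (n : ℝ))) Filter.atTop (𝓝 r)) :
    z.eval b ≤ r := by
  obtain ⟨C, hC, hz⟩ := z.bounded'
  -- The bounding constant disappears on taking `n`-th roots of the bound for `b ^ n`.
  have hC1 : Filter.Tendsto (fun n : ℕ => C ^ (1 / (n : ℝ))) Filter.atTop (𝓝 1) := by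
    have := (Real.continuousAt_const_rpow hC.ne' (b := 0)).tendsto.comp
      tendsto_one_div_atTop_nhds_zero_nat
    simpa [Function.comp_def] using this
  have h2 := hC1.mul h
  rw [one_mul] at h2
  refine ge_of_tendsto h2 (Filter.eventually_atTop.2 ⟨1, fun n hn => ?_⟩)
  have hn0 : (n : ℝ) ≠ 0 := by positivity
  have h3 : z.eval b ^ n ≤ C * ‖b ^ n‖ := (z.eval_pow b n).symm.trans_le (hz _)
  rw [← Real.mul_rpow hC.le (norm_nonneg _)]
  calc z.eval b = (z.eval b ^ n) ^ (1 / (n : ℝ)) := by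
        rw [one_div, Real.pow_rpow_inv_natCast (z.eval_nonneg b) (by omega)]
    _ ≤ _ := Real.rpow_le_rpow (pow_nonneg (z.eval_nonneg b) _) h3 (by positivity)

/-- The constant of boundedness can be taken to be `1`: if `‖b‖ < |b|_z`, the bound for `b ^ n`
gives `1 ≤ C (‖b‖ / |b|_z) ^ n`, whose right side tends to `0`. -/
theorem eval_le_norm (b : B) : z.eval b ≤ ‖b‖ := by
  obtain ⟨C, hC, hz⟩ := z.bounded'
  by_contra hlt
  push Not at hlt
  have hpos : 0 < z.eval b := (norm_nonneg b).trans_lt hlt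
  have hlim : Filter.Tendsto (fun n : ℕ => C * (‖b‖ / z.eval b) ^ n) Filter.atTop (𝓝 (C * 0)) :=
    (tendsto_pow_atTop_nhds_zero_of_lt_one (by positivity) ((div_lt_one hpos).2 hlt)).const_mul C
  rw [mul_zero] at hlim
  have : (1 : ℝ) ≤ 0 := by
    refine ge_of_tendsto hlim (Filter.eventually_atTop.2 ⟨1, fun n hn => ?_⟩)
    rw [div_pow, ← mul_div_assoc, one_le_div (pow_pos hpos n), ← z.eval_pow]
    exact (hz _).trans (mul_le_mul_of_nonneg_left (norm_pow_le' b hn) hC.le)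
  linarith

theorem abs_eval_sub_le (a b : B) : |z.eval a - z.eval b| ≤ ‖a - b‖ :=
  (abs_sub_map_le_sub z.toMulRingSeminorm a b).trans (z.eval_le_norm _)

end

/-- A multiplicative seminorm on `A` that is bounded by `Q` extends to the completion. -/
theorem exists_eval_toCompletion_eq (Q : AlgebraNorm k A) (g : MulRingSeminorm A)
    (hg : ∀ a, g a ≤ Q a) (hsmul : ∀ (c : k) a, g (c • a) = ‖c‖ * g a) :
    ∃ z : BerkovichSpectrum k (AlgebraCompletion Q), ∀ a, z.eval (toCompletion Q a) = g a := by
  have huc : UniformContinuous (fun a : WithAlgebraNorm Q => g a) := by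
    refine Metric.uniformContinuous_iff.2 fun ε hε => ⟨ε, hε, fun {a b} hab => ?_⟩
    refine lt_of_le_of_lt ?_ hab
    rw [dist_eq_norm (E := WithAlgebraNorm Q)]
    exact (abs_sub_map_le_sub g a b).trans (hg (a - b))
  obtain ⟨G, hcont, hcoe⟩ : ∃ G : AlgebraCompletion Q → ℝ, Continuous G ∧
      ∀ a : A, G (toCompletion Q a) = g a :=
    ⟨UniformSpace.Completion.extension (fun a : WithAlgebraNorm Q => g a),
      UniformSpace.Completion.continuous_extension,
      fun a => UniformSpace.Completion.extension_coe huc a⟩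
  have ind {p : AlgebraCompletion Q → Prop} (hp : IsClosed {b | p b})
      (h : ∀ a : A, p (toCompletion Q a)) (b : AlgebraCompletion Q) : p b :=
    (denseRange_toCompletion Q).induction_on b hp h
  have ind₂ {p : AlgebraCompletion Q → AlgebraCompletion Q → Prop}
      (hp : IsClosed {b : AlgebraCompletion Q × AlgebraCompletion Q | p b.1 b.2})
      (h : ∀ a b : A, p (toCompletion Q a) (toCompletion Q b)) (a b : AlgebraCompletion Q) :
      p a b :=
    (denseRange_toCompletion Q).induction_on₂ hp h a b
  have h0 : G 0 = 0 := (hcoe 0).trans (map_zero g)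
  have h1 : G 1 = 1 := (hcoe 1).trans (map_one g)
  have hadd : ∀ a b, G (a + b) ≤ G a + G b := by
    refine ind₂ (isClosed_le (hcont.comp continuous_add)
      ((hcont.comp continuous_fst).add (hcont.comp continuous_snd))) fun a b => ?_
    rw [← toCompletion_add, hcoe, hcoe, hcoe]
    exact map_add_le_add g a b
  have hneg : ∀ a, G (-a) = G a := by
    refine ind (isClosed_eq (hcont.comp continuous_neg) hcont) fun a => ?_
    rw [← toCompletion_neg, hcoe, hcoe]
    exact map_neg_eq_map g a
  have hmul : ∀ a b, G (a * b) = G a * G b := by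
    refine ind₂ (isClosed_eq (hcont.comp continuous_mul)
      ((hcont.comp continuous_fst).mul (hcont.comp continuous_snd))) fun a b => ?_
    rw [← toCompletion_mul, hcoe, hcoe, hcoe]
    exact map_mul g a b
  have hsm (c : k) : ∀ a, G (c • a) = ‖c‖ * G a := by
    refine ind (isClosed_eq (hcont.comp (continuous_const_smul c))
      (continuous_const.mul hcont)) fun a => ?_
    rw [← toCompletion_smul, hcoe, hcoe, hsmul]
  have hbd : ∀ a, G a ≤ 1 * ‖a‖ := by
    refine ind (isClosed_le hcont (continuous_const.mul continuous_norm)) fun a => ?_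
    rw [norm_toCompletion, hcoe, one_mul]
    exact hg a
  exact ⟨{
    toFun := G
    map_zero' := h0
    map_one' := h1
    add_le' := hadd
    neg' := hneg
    map_mul' := hmul
    smul' := hsm
    bounded' := ⟨1, one_pos, hbd⟩ }, hcoe⟩

variable {P Q : AlgebraNorm k A}

/-- The restriction to `A` of a point of the spectrum of a completion of `A`. -/
def restrict (z : BerkovichSpectrum k (AlgebraCompletion P)) : MulRingSeminorm A where
  toFun a := z.eval (toCompletion P a)
  map_zero' := map_zero z.toMulRingSeminorm
  map_one' := map_one z.toMulRingSeminorm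
  add_le' a b := by
    rw [toCompletion_add]
    exact map_add_le_add z.toMulRingSeminorm _ _
  neg' a := by
    rw [toCompletion_neg]
    exact map_neg_eq_map z.toMulRingSeminorm _
  map_mul' a b := by
    rw [toCompletion_mul]
    exact z.eval_mul _ _

theorem restrict_smul (z : BerkovichSpectrum k (AlgebraCompletion P)) (c : k) (a : A) :
    z.restrict (c • a) = ‖c‖ * z.restrict a := by
  change z.eval _ = ‖c‖ * z.eval _
  rw [toCompletion_smul]
  exact z.smul' c _

theorem continuous_eval {B : Type*} [NormedCommRing B] [NormedAlgebra k B] (b : B) :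
    Continuous fun z : BerkovichSpectrum k B => z.eval b :=
  (continuous_apply b).comp continuous_induced_dom

theorem eq_of_forall_toCompletion {z w : BerkovichSpectrum k (AlgebraCompletion P)}
    (h : ∀ a, z.eval (toCompletion P a) = w.eval (toCompletion P a)) : z = w := by
  have hc (z : BerkovichSpectrum k (AlgebraCompletion P)) : Continuous z.eval :=
    (LipschitzWith.of_dist_le_mul (K := 1) fun a b => by
      rw [NNReal.coe_one, one_mul, dist_eq_norm a b]; exact z.abs_eval_sub_le a b).continuous
  exact ext_eval fun b => congrFun
    ((denseRange_toCompletion P).equalizer (hc z) (hc w) (funext h)) b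

/-- A map into the spectrum of a completion of `A` is continuous as soon as the values at the
elements of `A` vary continuously. -/
theorem continuous_of_forall_toCompletion {Z : Type*} [TopologicalSpace Z]
    (F : Z → BerkovichSpectrum k (AlgebraCompletion P))
    (h : ∀ a, Continuous fun z => (F z).eval (toCompletion P a)) : Continuous F := by
  refine continuous_induced_rng.2 (continuous_pi fun b => ?_)
  -- For `a` near `b` the values at `a` and `b` differ by at most `‖b - a‖`, uniformly over all
  -- points of the spectrum.
  refine continuous_of_uniform_approx_of_continuous fun u hu => ?_
  obtain ⟨ε, hε, hu⟩ := Metric.mem_uniformity_dist.1 hu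
  obtain ⟨a, ha⟩ := (denseRange_toCompletion P).exists_dist_lt b hε
  refine ⟨_, h a, fun z => hu ?_⟩
  rw [dist_eq_norm] at ha
  exact ((F z).abs_eval_sub_le b (toCompletion P a)).trans_lt ha

/-- Two algebra norms on `A`, the smaller being the spectral seminorm of the larger, have
completions with the same Berkovich spectrum. -/
theorem exists_homeomorph (hQP : ∀ a, Q a ≤ P a)
    (hlim : ∀ a, Filter.Tendsto (fun n : ℕ => P (a ^ n) ^ (1 / (n : ℝ))) Filter.atTop
      (𝓝 (Q a))) :
    ∃ h : BerkovichSpectrum k (AlgebraCompletion P) ≃ₜ BerkovichSpectrum k (AlgebraCompletion Q),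
      ∀ z a, (h z).eval (toCompletion Q a) = z.eval (toCompletion P a) := by
  have hpow (a : A) (n : ℕ) : toCompletion P (a ^ n) = toCompletion P a ^ n := by
    induction n with
    | zero => simp only [pow_zero]; rfl
    | succ n ih => rw [pow_succ, pow_succ, toCompletion_mul, ih]
  -- The only place where the spectral formula enters: boundedness by `P` improves to boundedness by
  -- `Q`, so the restriction extends to the smaller completion norm.
  have hP (z : BerkovichSpectrum k (AlgebraCompletion P)) (a : A) : z.restrict a ≤ Q a := by
    refine z.eval_le_of_tendsto ?_
    simp only [← hpow, norm_toCompletion]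
    exact hlim a
  have hQ (z : BerkovichSpectrum k (AlgebraCompletion Q)) (a : A) : z.restrict a ≤ P a :=
    ((z.eval_le_norm _).trans_eq (norm_toCompletion Q a)).trans (hQP a)
  choose F hF using fun z => exists_eval_toCompletion_eq Q (restrict z) (hP z) z.restrict_smul
  choose G hG using fun z => exists_eval_toCompletion_eq P (restrict z) (hQ z) z.restrict_smul
  replace hF (z) (a : A) : (F z).eval (toCompletion Q a) = z.eval (toCompletion P a) := hF z a
  replace hG (z) (a : A) : (G z).eval (toCompletion P a) = z.eval (toCompletion Q a) := hG z a
  refine ⟨⟨⟨F, G, fun z => eq_of_forall_toCompletion fun a => ?_,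
    fun z => eq_of_forall_toCompletion fun a => ?_⟩,
    continuous_of_forall_toCompletion F fun a => ?_,
    continuous_of_forall_toCompletion G fun a => ?_⟩, hF⟩
  · rw [hG, hF]
  · rw [hF, hG]
  · simp only [hF]
    exact continuous_eval _
  · simp only [hG]
    exact continuous_eval _

end BerkovichSpectrum

end Spectrum

/-! ### Almost orthogonal bases -/

section Orthogonal

variable {k : Type*} [NontriviallyNormedField k] [CompleteSpace k]

/-- A vector can be moved by an element of a finite-dimensional subspace `F` so as to become
almost orthogonal to `F`. -/
theorem exists_sub_mem_forall_norm_le {W : Type*} [NormedAddCommGroup W] [NormedSpace k W]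
    (F : Submodule k W) [FiniteDimensional k F] (v : W) {η : ℝ} (hη : 1 < η) :
    ∃ g, v - g ∈ F ∧ ∀ w ∈ F, ‖g‖ ≤ η * ‖g + w‖ := by
  by_cases hv : v ∈ F
  · exact ⟨0, by simpa using hv, fun w _ => by rw [norm_zero]; positivity⟩
  -- Completeness of `k` makes `F` closed, so the distance from `v` is positive. It need not be
  -- attained, hence the factor `η`.
  have hcl : IsClosed (F : Set W) := F.closed_of_finiteDimensional
  have hne : (F : Set W).Nonempty := ⟨0, F.zero_mem⟩
  have hd : 0 < Metric.infDist v F := (hcl.notMem_iff_infDist_pos hne).1 hv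
  obtain ⟨y, hy, hvy⟩ := (Metric.infDist_lt_iff hne).1
    (lt_mul_of_one_lt_left hd hη : Metric.infDist v F < η * Metric.infDist v F)
  refine ⟨v - y, by simpa using hy, fun w hw => ?_⟩
  rw [← dist_eq_norm]
  refine hvy.le.trans (mul_le_mul_of_nonneg_left ?_ (by positivity))
  have := Metric.infDist_le_dist_of_mem (x := v) (F.sub_mem hy hw)
  rwa [dist_eq_norm, sub_sub_eq_add_sub, add_sub_right_comm] at this

/-- A normed space of countable dimension has, for each `D > 1`, a basis that is orthogonal up to
the factor `D`. -/
theorem exists_basis_norm_repr_mul_le {W : Type*} [NormedAddCommGroup W] [NormedSpace k W]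
    [IsUltrametricDist W] (e : ℕ → W) (he : Submodule.span k (Set.range e) = ⊤) {D : ℝ}
    (hD : 1 < D) :
    ∃ (J : Set ℕ) (b : Module.Basis J k W), ∀ x j, ‖b.repr x j‖ * ‖b j‖ ≤ D * ‖x‖ := by
  -- The defect `u (n + 1) / u n > 1` is allowed at the `n`-th step; the defects telescope and stay
  -- below `D` after any number of steps.
  obtain ⟨u, hu, hu1, -⟩ := exists_seq_strictMono_tendsto' hD
  have hu0 (n : ℕ) : 0 < u n := one_pos.trans (hu1 n).1
  let E (n : ℕ) : Submodule k W := Submodule.span k (e '' Set.Iio n)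
  have hfin (n : ℕ) : FiniteDimensional k (E n) :=
    FiniteDimensional.span_of_finite k ((Set.finite_Iio n).image e)
  have hEmono {m n : ℕ} (h : m ≤ n) : E m ≤ E n :=
    Submodule.span_mono (Set.image_mono (Set.Iio_subset_Iio h))
  choose f hf hf' using fun n => exists_sub_mem_forall_norm_le (E n) (e n)
    ((one_lt_div (hu0 n)).2 (hu n.lt_succ_self))
  have hfE (j : ℕ) : f j ∈ E (j + 1) := by
    have h1 : e j ∈ E (j + 1) := Submodule.subset_span ⟨j, Nat.lt_succ_self j, rfl⟩
    simpa using (E (j + 1)).sub_mem h1 (hEmono j.le_succ (hf j))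
  have key (n : ℕ) (c : ℕ → k) : ∀ j < n,
      ‖c j‖ * ‖f j‖ ≤ u n * ‖∑ i ∈ Finset.range n, c i • f i‖ := by
    induction n with
    | zero => simp
    | succ n ih =>
      intro j hj
      rw [Finset.sum_range_succ]
      set w := ∑ i ∈ Finset.range n, c i • f i with hw
      have hwE : w ∈ E n := Submodule.sum_mem _ fun i hi => Submodule.smul_mem _ _
        (hEmono (Finset.mem_range.1 hi) (hfE i))
      have h1 : ‖c n • f n‖ ≤ u (n + 1) / u n * ‖w + c n • f n‖ := by
        by_cases hc : c n = 0
        · rw [hc, zero_smul, norm_zero]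
          have := hu0 (n + 1); have := hu0 n; positivity
        have := mul_le_mul_of_nonneg_left (hf' n ((c n)⁻¹ • w) ((E n).smul_mem _ hwE))
          (norm_nonneg (c n))
        rw [← norm_smul, mul_left_comm, ← norm_smul, smul_add, smul_inv_smul₀ hc] at this
        rwa [add_comm w]
      have hη : 1 ≤ u (n + 1) / u n := ((one_lt_div (hu0 n)).2 (hu n.lt_succ_self)).le
      rcases (Nat.lt_succ_iff_lt_or_eq.1 hj) with hj | rfl
      · have h2 : ‖w‖ ≤ u (n + 1) / u n * ‖w + c n • f n‖ := by
          have h3 : ‖w‖ ≤ max ‖w + c n • f n‖ ‖c n • f n‖ := by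
            simpa using IsUltrametricDist.norm_add_le_max (w + c n • f n) (-(c n • f n))
          exact h3.trans (max_le (le_mul_of_one_le_left (norm_nonneg _) hη) h1)
        refine (ih j hj).trans ((mul_le_mul_of_nonneg_left h2 (hu0 n).le).trans_eq ?_)
        rw [← mul_assoc, mul_div_cancel₀ _ (hu0 n).ne']
      · rw [← norm_smul]
        refine h1.trans (mul_le_mul_of_nonneg_right ?_ (norm_nonneg _))
        exact div_le_self (hu0 _).le (hu1 _).1.le
  have key' (a : ℕ →₀ k) (j : ℕ) :
      ‖a j‖ * ‖f j‖ ≤ D * ‖Finsupp.linearCombination k f a‖ := by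
    obtain ⟨n, hn⟩ := a.support.exists_nat_subset_range
    have hs : Finsupp.linearCombination k f a = ∑ i ∈ Finset.range (max n (j + 1)), a i • f i := by
      rw [Finsupp.linearCombination_apply]
      refine Finsupp.sum_of_support_subset _ (hn.trans ?_) _ (by simp)
      exact Finset.range_subset_range.2 (le_max_left _ _)
    rw [hs]
    exact (key _ a j (le_max_right n (j + 1))).trans
      (mul_le_mul_of_nonneg_right (hu1 _).2.le (norm_nonneg _))
  -- The spanning sequence may be linearly dependent; redundant vectors produce `f j = 0` and are
  -- dropped.
  let J : Set ℕ := {j | f j ≠ 0}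
  have keyJ (a : J →₀ k) (j : J) :
      ‖a j‖ * ‖f j‖ ≤ D * ‖Finsupp.linearCombination k (fun j : J => f j) a‖ := by
    have h := key' (a.mapDomain Subtype.val) j
    rw [Finsupp.mapDomain_apply Subtype.val_injective, Finsupp.linearCombination_mapDomain] at h
    exact h
  have hli : LinearIndependent k (fun j : J => f j) := by
    refine linearIndependent_iff.2 fun a ha => Finsupp.ext fun j => ?_
    have h := keyJ a j
    rw [ha, norm_zero, mul_zero] at h
    by_contra hne
    exact absurd h (not_le.2 (mul_pos (norm_pos_iff.2 hne) (norm_pos_iff.2 j.2)))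
  have hsp : ⊤ ≤ Submodule.span k (Set.range fun j : J => f j) := by
    have hfs (n : ℕ) : f n ∈ Submodule.span k (Set.range fun j : J => f j) := by
      by_cases hn : f n = 0
      · rw [hn]; exact zero_mem _
      · exact Submodule.subset_span ⟨⟨n, hn⟩, rfl⟩
    rw [← he, Submodule.span_le]
    rintro _ ⟨n, rfl⟩
    induction n using Nat.strong_induction_on with
    | _ n ih =>
      have h1 : e n - f n ∈ Submodule.span k (Set.range fun j : J => f j) := by
        refine (Submodule.span_le.2 ?_ : E n ≤ _) (hf n)
        rintro _ ⟨m, hm, rfl⟩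
        exact ih m hm
      simpa using Submodule.add_mem _ h1 (hfs n)
  refine ⟨J, Module.Basis.mk hli hsp, fun x j => ?_⟩
  have h := keyJ ((Module.Basis.mk hli hsp).repr x) j
  have hx := (Module.Basis.mk hli hsp).linearCombination_repr x
  rw [Module.Basis.coe_mk] at hx
  rw [hx] at h
  rwa [Module.Basis.mk_apply]

end Orthogonal

/-! ### Scalar extensions of norms -/

section FubiniStudy

variable {k : Type*} [NormedField k] {V : Type*} [AddCommGroup V] [Module k V]
  (p : Seminorm k V)

theorem dualNorm_nonneg (l : Module.Dual k V) : 0 ≤ dualNorm p l :=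
  Real.iSup_nonneg fun v => div_nonneg (norm_nonneg _) (apply_nonneg p v)

/-- For a functional that is not bounded by a multiple of `p`, the real supremum defining `dualNorm`
is `0`, and division by `0` gives `0`. So such functionals contribute nothing to `scalarExtension`,
and no finite-dimensionality of `V` is needed. -/
theorem norm_div_dualNorm_le (hp : ∀ v, p v = 0 → v = 0) (l : Module.Dual k V) (v : V) :
    ‖l v‖ / dualNorm p l ≤ p v := by
  by_cases hv : p v = 0
  · simp [hp v hv]
  by_cases hb : BddAbove (Set.range fun v : V => ‖l v‖ / p v)
  · rcases (dualNorm_nonneg p l).eq_or_lt with h0 | hpos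
    · rw [← h0, div_zero]; exact apply_nonneg p v
    · rw [div_le_iff₀ hpos, mul_comm]
      exact (div_le_iff₀ ((apply_nonneg p v).lt_of_ne' hv)).1 (le_ciSup hb v)
  · rw [dualNorm, Real.iSup_of_not_bddAbove hb, div_zero]
    exact apply_nonneg p v

theorem dualNorm_le {l : Module.Dual k V} {A : ℝ} (hA : 0 ≤ A) (h : ∀ v, ‖l v‖ ≤ A * p v) :
    dualNorm p l ≤ A :=
  Real.iSup_le (fun v => div_le_of_le_mul₀ (apply_nonneg p v) hA (h v)) hA

variable {p} {K : Type*} [NormedField K] [NormedAlgebra k K]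

/-- Writing `w` as a finite sum of `a ⊗ v` bounds all terms by the sum of the `‖a‖ * p v`. Without
this bound the supremum defining `scalarExtension` could have its default value `0`. -/
theorem bddAbove_scalarExtension (hp : ∀ v, p v = 0 → v = 0) (w : K ⊗[k] V) :
    BddAbove (Set.range fun l : Module.Dual k V =>
      ‖((Algebra.linearMap k K).comp l).liftBaseChange K w‖ / dualNorm p l) := by
  induction w using TensorProduct.induction_on with
  | zero => exact ⟨0, by rintro _ ⟨l, rfl⟩; simp⟩
  | tmul a v =>
    refine ⟨‖a‖ * p v, ?_⟩
    rintro _ ⟨l, rfl⟩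
    simp only [LinearMap.liftBaseChange_tmul, LinearMap.comp_apply, Algebra.linearMap_apply,
      smul_eq_mul, norm_mul, norm_algebraMap', mul_div_assoc]
    exact mul_le_mul_of_nonneg_left (norm_div_dualNorm_le p hp l v) (norm_nonneg a)
  | add x y hx hy =>
    obtain ⟨a, ha⟩ := hx
    obtain ⟨b, hb⟩ := hy
    refine ⟨a + b, ?_⟩
    rintro _ ⟨l, rfl⟩
    simp only [map_add]
    refine (div_le_div_of_nonneg_right (norm_add_le _ _) (dualNorm_nonneg p l)).trans ?_
    rw [add_div]
    exact add_le_add (ha ⟨l, rfl⟩) (hb ⟨l, rfl⟩)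

theorem scalarExtension_nonneg (w : K ⊗[k] V) : 0 ≤ scalarExtension p K w :=
  Real.iSup_nonneg fun l => div_nonneg (norm_nonneg _) (dualNorm_nonneg p l)

theorem scalarExtension_tmul_le (hp : ∀ v, p v = 0 → v = 0) (a : K) (v : V) :
    scalarExtension p K (a ⊗ₜ[k] v) ≤ ‖a‖ * p v := by
  refine Real.iSup_le (fun l => ?_) (mul_nonneg (norm_nonneg _) (apply_nonneg p v))
  simp only [LinearMap.liftBaseChange_tmul, LinearMap.comp_apply, Algebra.linearMap_apply,
    smul_eq_mul, norm_mul, norm_algebraMap', mul_div_assoc]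
  exact mul_le_mul_of_nonneg_left (norm_div_dualNorm_le p hp l v) (norm_nonneg a)

theorem norm_liftBaseChange_dual_le (hp : ∀ v, p v = 0 → v = 0) {l : Module.Dual k V} {A : ℝ}
    (hA : 0 ≤ A) (h : ∀ v, ‖l v‖ ≤ A * p v) (w : K ⊗[k] V) :
    ‖((Algebra.linearMap k K).comp l).liftBaseChange K w‖ ≤ A * scalarExtension p K w := by
  have hb : BddAbove (Set.range fun v : V => ‖l v‖ / p v) :=
    ⟨A, by rintro _ ⟨v, rfl⟩; exact div_le_of_le_mul₀ (apply_nonneg p v) hA (h v)⟩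
  rcases (dualNorm_nonneg p l).eq_or_lt with h0 | hpos
  · have hl : l = 0 := by
      ext v
      by_cases hv : p v = 0
      · simp [hp v hv]
      · have h1 : ‖l v‖ / p v ≤ dualNorm p l := le_ciSup hb v
        rw [← h0, div_le_iff₀ ((apply_nonneg p v).lt_of_ne' hv), zero_mul] at h1
        simpa using h1
    rw [hl, LinearMap.comp_zero]
    have : (0 : V →ₗ[k] K).liftBaseChange K w = 0 := by
      induction w using TensorProduct.induction_on with
      | zero => simp
      | tmul a v => simp
      | add x y hx hy => rw [map_add, hx, hy, add_zero]
    rw [this, norm_zero]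
    exact mul_nonneg hA (scalarExtension_nonneg w)
  · have h1 := le_ciSup (bddAbove_scalarExtension (K := K) hp w) l
    rw [div_le_iff₀ hpos, mul_comm] at h1
    exact h1.trans (mul_le_mul_of_nonneg_right (dualNorm_le p hA h) (scalarExtension_nonneg w))

end FubiniStudy

/-- A linear map to an ultrametric field extension whose range has countable dimension is bounded
on the scalar extension by the same constant as on the space itself. -/
theorem norm_liftBaseChange_le {k : Type*} [NontriviallyNormedField k] [CompleteSpace k]
    {V : Type*} [AddCommGroup V] [Module k V] {p : Seminorm k V} (hp : ∀ v, p v = 0 → v = 0)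
    {K : Type*} [NormedField K] [NormedAlgebra k K] [IsUltrametricDist K] (ev : V →ₗ[k] K)
    (e : ℕ → K) (he : ∀ v, ev v ∈ Submodule.span k (Set.range e)) {C : ℝ} (hC : 0 ≤ C)
    (h : ∀ v, ‖ev v‖ ≤ C * p v) (w : K ⊗[k] V) :
    ‖ev.liftBaseChange K w‖ ≤ C * scalarExtension p K w := by
  have main (D : ℝ) (hD : 1 < D) :
      ‖ev.liftBaseChange K w‖ ≤ D * (C * scalarExtension p K w) := by
    let W := Submodule.span k (Set.range e)
    let e' : ℕ → W := fun n => ⟨e n, Submodule.subset_span ⟨n, rfl⟩⟩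
    have he' : Submodule.span k (Set.range e') = ⊤ := by
      rw [← Submodule.map_injective_of_injective W.injective_subtype |>.eq_iff, Submodule.map_span,
        ← Set.range_comp, Submodule.map_top, Submodule.range_subtype]
      rfl
    have : IsUltrametricDist W := ⟨fun x y z => dist_triangle_max (x : K) y z⟩
    obtain ⟨J, b, hb⟩ := exists_basis_norm_repr_mul_le e' he' hD
    let ev' : V →ₗ[k] W := ev.codRestrict W he
    -- `scalarExtension` only tests against functionals with values in `k`, so `ev` is split into
    -- its coordinates along an almost orthogonal basis of its countable-dimensional target.
    let l (j : J) : Module.Dual k V := b.coord j ∘ₗ ev'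
    have hl (j : J) : ‖((Algebra.linearMap k K).comp (l j)).liftBaseChange K w‖ * ‖(b j : K)‖ ≤
        D * (C * scalarExtension p K w) := by
      have hbj : 0 < ‖(b j : K)‖ := norm_pos_iff.2 fun h0 => b.ne_zero j (Subtype.ext h0)
      have hD0 : 0 ≤ D := by linarith
      have h1 := norm_liftBaseChange_dual_le (K := K) hp (l := l j)
        (A := D * C / ‖(b j : K)‖) (by positivity) (fun v => ?_) w
      · rw [div_mul_eq_mul_div, le_div_iff₀ hbj] at h1
        exact h1.trans_eq (by ring)
      · rw [div_mul_eq_mul_div, le_div_iff₀ hbj, mul_assoc]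
        exact (hb (ev' v) j).trans (mul_le_mul_of_nonneg_left (h v) hD0)
    -- Allowing every larger `T` lets the expansions of two summands be added over a common index
    -- set.
    have hsum : ∃ S : Finset J, ∀ T, S ⊆ T → ev.liftBaseChange K w =
        ∑ j ∈ T, ((Algebra.linearMap k K).comp (l j)).liftBaseChange K w * (b j : K) := by
      clear hl
      induction w using TensorProduct.induction_on with
      | zero => exact ⟨∅, fun T _ => by simp⟩
      | tmul a v =>
        refine ⟨(b.repr (ev' v)).support, fun T hT => ?_⟩
        have h1 : ev' v = ∑ j ∈ T, b.repr (ev' v) j • b j := by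
          conv_lhs => rw [← b.linearCombination_repr (ev' v), Finsupp.linearCombination_apply]
          exact Finsupp.sum_of_support_subset _ hT _ (by simp)
        have h2 : ev v = ∑ j ∈ T, b.repr (ev' v) j • (b j : K) := by
          have := congrArg (W.subtype) h1
          rw [map_sum] at this
          exact this
        rw [LinearMap.liftBaseChange_tmul, h2, Finset.smul_sum]
        refine Finset.sum_congr rfl fun j _ => ?_
        rw [LinearMap.liftBaseChange_tmul, smul_eq_mul, smul_eq_mul, mul_assoc, Algebra.smul_def]
        rfl
      | add x y hx hy =>
        obtain ⟨S, hS⟩ := hx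
        obtain ⟨S', hS'⟩ := hy
        classical
        refine ⟨S ∪ S', fun T hT => ?_⟩
        rw [map_add, hS T (Finset.union_subset_left hT), hS' T (Finset.union_subset_right hT),
          ← Finset.sum_add_distrib]
        simp only [map_add, add_mul]
    obtain ⟨S, hS⟩ := hsum
    rw [hS S subset_rfl]
    refine IsUltrametricDist.norm_sum_le_of_forall_le_of_nonneg ?_ fun j _ => ?_
    · have := scalarExtension_nonneg (p := p) w
      have : 0 ≤ D := by linarith
      positivity
    · rw [norm_mul]
      exact hl j
  have hlim : Filter.Tendsto (fun D : ℝ => D * (C * scalarExtension p K w)) (𝓝[>] 1)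
      (𝓝 (1 * (C * scalarExtension p K w))) :=
    ((continuous_mul_const _).tendsto 1).mono_left nhdsWithin_le_nhds
  rw [one_mul] at hlim
  exact ge_of_tendsto hlim (eventually_nhdsWithin_of_forall main)

/-! ### Points of the analytification are non-Archimedean -/

namespace Analytification

variable {k : Type u} [NormedField k] {X : Scheme.{u}} [X.Over (Spec (CommRingCat.of k))]
  (x : Analytification k X)

theorem norm_toCompleted (a : X.residueField x.pt) : ‖x.toCompleted a‖ = x.abs a :=
  UniformSpace.Completion.norm_coe (E := WithAbs x.abs) (WithAbs.toAbs x.abs a)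

theorem norm_algebraMap_completed (a : k) :
    ‖algebraMap k x.CompletedResidueField a‖ = ‖a‖ :=
  (x.norm_toCompleted _).trans (x.abs_residueHom a)

/-- The completed residue field as a normed algebra. -/
@[reducible]
def normedAlgebraCompleted : NormedAlgebra k x.CompletedResidueField :=
  { (inferInstance : Algebra k x.CompletedResidueField) with
    norm_smul_le := fun a b => by
      rw [Algebra.smul_def, norm_mul, norm_algebraMap_completed] }

/-- A point is given by an arbitrary absolute value extending that of `k`. The ultrametric
inequality comes from `k` through the normed algebra structure. -/
theorem isUltrametricDist_completed [IsUltrametricDist k] :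
    IsUltrametricDist x.CompletedResidueField :=
  letI := x.normedAlgebraCompleted
  IsUltrametricDist.of_normedAlgebra k

theorem isNonarchimedean_abs [IsUltrametricDist k] : IsNonarchimedean x.abs := fun a b => by
  have := x.isUltrametricDist_completed
  rw [← x.norm_toCompleted, ← x.norm_toCompleted, ← x.norm_toCompleted, map_add]
  exact IsUltrametricDist.norm_add_le_max _ _

end Analytification

/-! ### The seminorm of a point on the section algebra -/

namespace LineBundle

section Components

variable {k : Type u} [CommRing k] {X : Scheme.{u}} [X.Over (Spec (CommRingCat.of k))]
  {L : LineBundle X}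

/-- A section as a homogeneous element of the section algebra. -/
def SectionAlgebra.of {n : ℕ} (s : L.sections k n) : L.SectionAlgebra k :=
  DirectSum.lof k ℕ (fun n => L.sections k n) n s

theorem SectionAlgebra.component_of_self {n : ℕ} (s : L.sections k n) :
    (SectionAlgebra.of s).component n = s :=
  DirectSum.component.lof_self k (M := fun n => L.sections k n) n s

theorem SectionAlgebra.component_of_ne {m n : ℕ} (h : m ≠ n) (s : L.sections k m) :
    (SectionAlgebra.of s).component n = 0 := by
  refine (DirectSum.component.of k (M := fun n => L.sections k n) n m s).trans ?_
  rw [dif_neg h]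

theorem SectionAlgebra.of_smul {n : ℕ} (a : k) (s : L.sections k n) :
    SectionAlgebra.of (a • s) = a • SectionAlgebra.of s :=
  map_smul (DirectSum.lof k ℕ (fun n => L.sections k n) n) a s

theorem SectionAlgebra.of_add {n : ℕ} (s t : L.sections k n) :
    SectionAlgebra.of (s + t) = SectionAlgebra.of s + SectionAlgebra.of t :=
  map_add (DirectSum.lof k ℕ (fun n => L.sections k n) n) s t

theorem SectionAlgebra.exists_eq_sum (s : L.SectionAlgebra k) :
    ∃ S : Finset ℕ, s = ∑ n ∈ S, SectionAlgebra.of (s.component n) := by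
  classical
  refine ⟨DFinsupp.support (β := fun n => L.sections k n) s, ?_⟩
  exact (DirectSum.sum_support_of (β := fun n => L.sections k n) s).symm

/-- The product of sections. -/
def mulSection {m n : ℕ} (s : L.sections k m) (t : L.sections k n) : L.sections k (m + n) :=
  ⟨s.1 * t.1, (L.gradedMonoid k).mul_mem s.2 t.2⟩

theorem SectionAlgebra.of_mul {m n : ℕ} (s : L.sections k m) (t : L.sections k n) :
    SectionAlgebra.of s * SectionAlgebra.of t = SectionAlgebra.of (mulSection s t) :=
  DirectSum.of_mul_of (A := fun n => L.sections k n) s t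

theorem SectionAlgebra.of_congr {m n : ℕ} (h : m = n) {s : L.sections k m} {t : L.sections k n}
    (hst : s.1 = t.1) : SectionAlgebra.of s = SectionAlgebra.of t := by
  subst h
  rw [Subtype.ext hst]

theorem pow_mem_sections {n : ℕ} (s : L.sections k n) (m : ℕ) : s.1 ^ m ∈ L.sections k (n * m) := by
  intro i j
  simp only [Pi.pow_apply, map_pow, s.2 i j]
  ring

/-- The power of a section. -/
def powSection {n : ℕ} (s : L.sections k n) (m : ℕ) : L.sections k (n * m) :=
  ⟨s.1 ^ m, pow_mem_sections s m⟩

/-- The unit section. -/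
def oneSection : L.sections k 0 := ⟨1, (L.gradedMonoid k).one_mem⟩

theorem SectionAlgebra.of_oneSection : SectionAlgebra.of (oneSection : L.sections k 0) = 1 := rfl

theorem SectionAlgebra.of_pow {n : ℕ} (s : L.sections k n) (m : ℕ) :
    SectionAlgebra.of s ^ m = SectionAlgebra.of (powSection s m) := by
  induction m with
  | zero =>
    rw [pow_zero, ← of_oneSection]
    exact of_congr (mul_zero n).symm (pow_zero s.1).symm
  | succ m ih =>
    rw [pow_succ, ih, of_mul]
    exact of_congr rfl (pow_succ s.1 m).symm

theorem SectionAlgebra.component_add (s t : L.SectionAlgebra k) (n : ℕ) :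
    (s + t).component n = s.component n + t.component n :=
  map_add (DirectSum.component k ℕ (fun n => L.sections k n) n) s t

/-- The Taylor polynomial at `x` of an element of the section algebra, with respect to the frame
`e i`. -/
def taylor (i : L.ι) (x : X) (hx : x ∈ L.U i) :
    L.SectionAlgebra k →+* Polynomial (X.residueField x) :=
  DirectSum.toSemiring (A := fun n => L.sections k n)
    (fun n => (Polynomial.monomial n).toAddMonoidHom.comp
      ((X.evaluation (L.U i) x hx).hom.toAddMonoidHom.comp
        ((Pi.evalAddMonoidHom _ i).comp (L.sections k n).subtype.toAddMonoidHom)))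
    (by
      change Polynomial.monomial 0 (X.evaluation (L.U i) x hx (1 : Γ(X, L.U i))) = 1
      rw [map_one]
      rfl)
    (fun {m n} s t => by
      change Polynomial.monomial (m + n) (X.evaluation (L.U i) x hx (s.1 i * t.1 i)) =
        Polynomial.monomial m (X.evaluation (L.U i) x hx (s.1 i)) *
          Polynomial.monomial n (X.evaluation (L.U i) x hx (t.1 i))
      rw [map_mul, Polynomial.monomial_mul_monomial])

theorem taylor_of (i : L.ι) (x : X) (hx : x ∈ L.U i) {n : ℕ} (s : L.sections k n) :
    taylor i x hx (SectionAlgebra.of s) =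
      Polynomial.monomial n (X.evaluation (L.U i) x hx (s.1 i)) :=
  DirectSum.toSemiring_of (A := fun n => L.sections k n) _ _ _ n s

theorem coeff_taylor (i : L.ι) (x : X) (hx : x ∈ L.U i) (s : L.SectionAlgebra k) (n : ℕ) :
    (taylor i x hx s).coeff n = X.evaluation (L.U i) x hx ((s.component n).1 i) := by
  obtain ⟨S, hS⟩ := s.exists_eq_sum
  have h : ∀ T : Finset ℕ, ∀ g : ∀ n, L.sections k n,
      (taylor i x hx (∑ n ∈ T, SectionAlgebra.of (g n))).coeff n =
      X.evaluation (L.U i) x hx (((∑ n ∈ T, SectionAlgebra.of (g n)).component n).1 i) := by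
    intro T g
    classical
    induction T using Finset.induction_on with
    | empty =>
      simp only [Finset.sum_empty, map_zero, Polynomial.coeff_zero]
      exact (map_zero (X.evaluation (L.U i) x hx).hom).symm
    | insert m T hm ih =>
      rw [Finset.sum_insert hm, map_add, Polynomial.coeff_add, ih, SectionAlgebra.component_add,
        taylor_of, Polynomial.coeff_monomial]
      refine Eq.trans ?_ (map_add (X.evaluation (L.U i) x hx).hom _ _).symm
      congr 1
      split_ifs with h
      · subst h
        rw [SectionAlgebra.component_of_self]
      · rw [SectionAlgebra.component_of_ne h]
        exact (map_zero (X.evaluation (L.U i) x hx).hom).symm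
  rw [hS]
  exact h S _

end Components

namespace Metric

variable {k : Type u} [NormedField k] {X : Scheme.{u}} [X.Over (Spec (CommRingCat.of k))]
  {L : LineBundle X} (φ : Metric k L)

/-- The seminorm on the section algebra of a point of the analytification. -/
def pointNorm (x : Analytification k X) (s : L.SectionAlgebra k) : ℝ :=
  (taylor (L.covers x.pt).choose x.pt (L.covers x.pt).choose_spec s).gaussNorm x.abs
    (φ.frameNorm (L.covers x.pt).choose x (L.covers x.pt).choose_spec)

theorem pointNorm_nonneg (x : Analytification k X) (s : L.SectionAlgebra k) :
    0 ≤ φ.pointNorm x s :=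
  Polynomial.gaussNorm_nonneg _ _ (φ.frameNorm_pos _ _ _).le

theorem abs_component_le_pointNorm (x : Analytification k X) (s : L.SectionAlgebra k) (n : ℕ) :
    φ.abs (s.component n) x ≤ φ.pointNorm x s := by
  refine le_trans (le_of_eq ?_) (Polynomial.le_gaussNorm _ _ (φ.frameNorm_pos _ _ _).le n)
  rw [coeff_taylor]
  rfl

theorem exists_pointNorm_eq (x : Analytification k X) (s : L.SectionAlgebra k) :
    ∃ n, φ.pointNorm x s = φ.abs (s.component n) x := by
  obtain ⟨n, hn⟩ := Polynomial.exists_eq_gaussNorm x.abs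
    (φ.frameNorm (L.covers x.pt).choose x (L.covers x.pt).choose_spec)
    (taylor (L.covers x.pt).choose x.pt (L.covers x.pt).choose_spec s)
  refine ⟨n, hn.trans ?_⟩
  rw [coeff_taylor]
  rfl

theorem pointNorm_of (x : Analytification k X) {n : ℕ} (s : L.sections k n) :
    φ.pointNorm x (SectionAlgebra.of s) = φ.abs s x := by
  rw [pointNorm, taylor_of, Polynomial.gaussNorm_monomial]
  rfl

theorem pointNorm_one (x : Analytification k X) : φ.pointNorm x (1 : L.SectionAlgebra k) = 1 := by
  rw [pointNorm, map_one, ← Polynomial.C_1, Polynomial.gaussNorm_C, map_one]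

theorem pointNorm_zero (x : Analytification k X) : φ.pointNorm x (0 : L.SectionAlgebra k) = 0 := by
  rw [pointNorm, map_zero, Polynomial.gaussNorm_zero]

/-- Exchanging the suprema over degrees and over points exhibits the algebra norm as a supremum of
seminorms that are multiplicative for ultrametric `k`. Submultiplicativity and
power-multiplicativity are read off from this form. -/
theorem algNorm_eq_iSup_pointNorm (s : L.SectionAlgebra k) :
    φ.algNorm s = ⨆ x : Analytification k X, ENNReal.ofReal (φ.pointNorm x s) := by
  rw [algNorm]
  simp only [supNorm]
  rw [iSup_comm]
  refine iSup_congr fun x => le_antisymm (iSup_le fun n => ?_) ?_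
  · exact ENNReal.ofReal_le_ofReal (φ.abs_component_le_pointNorm x s n)
  · obtain ⟨n, hn⟩ := φ.exists_pointNorm_eq x s
    rw [hn]
    exact le_iSup (fun n => ENNReal.ofReal (φ.abs (s.component n) x)) n

theorem pointNorm_smul (x : Analytification k X) (a : k) (s : L.SectionAlgebra k) :
    φ.pointNorm x (a • s) = ‖a‖ * φ.pointNorm x s := by
  have h (n : ℕ) : φ.abs ((a • s).component n) x = ‖a‖ * φ.abs (s.component n) x := by
    have h1 : (a • s).component n = a • s.component n :=
      map_smul (DirectSum.component k ℕ (fun n => L.sections k n) n) a s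
    have h2 (i : L.ι) (hi : x.pt ∈ L.U i) : x.absEval hi ((a • s.component n).1 i) =
        ‖a‖ * x.absEval hi ((s.component n).1 i) := by
      refine (x.absEval_mul hi (structureHom k (L.U i) a) _).trans (congrArg (· * _) ?_)
      exact (congrArg x.abs (evaluation_structureHom k (L.U i) x.pt hi a)).trans
        (x.abs_residueHom a)
    rw [h1, Metric.abs, h2, mul_assoc]
    rfl
  refine le_antisymm ?_ ?_
  · obtain ⟨n, hn⟩ := φ.exists_pointNorm_eq x (a • s)
    rw [hn, h]
    exact mul_le_mul_of_nonneg_left (φ.abs_component_le_pointNorm x s n) (norm_nonneg a)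
  · obtain ⟨n, hn⟩ := φ.exists_pointNorm_eq x s
    rw [hn, ← h]
    exact φ.abs_component_le_pointNorm x (a • s) n

theorem algNorm_smul (a : k) (s : L.SectionAlgebra k) :
    φ.algNorm (a • s) = ENNReal.ofReal ‖a‖ * φ.algNorm s := by
  simp only [algNorm_eq_iSup_pointNorm, pointNorm_smul, ENNReal.ofReal_mul (norm_nonneg a),
    ENNReal.mul_iSup]

theorem algNorm_zero : φ.algNorm (0 : L.SectionAlgebra k) = 0 := by
  simp [algNorm_eq_iSup_pointNorm, pointNorm_zero]

theorem algNorm_one_le : φ.algNorm (1 : L.SectionAlgebra k) ≤ 1 := by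
  rw [algNorm_eq_iSup_pointNorm]
  exact iSup_le fun x => by rw [pointNorm_one, ENNReal.ofReal_one]

theorem algNorm_one [Nonempty (Analytification k X)] :
    φ.algNorm (1 : L.SectionAlgebra k) = 1 := by
  simp [algNorm_eq_iSup_pointNorm, pointNorm_one]

theorem algNorm_of {n : ℕ} (s : L.sections k n) :
    φ.algNorm (SectionAlgebra.of s) = φ.supNorm s := by
  simp only [algNorm_eq_iSup_pointNorm, pointNorm_of, supNorm]

theorem supNorm_component_le (s : L.SectionAlgebra k) (n : ℕ) :
    φ.supNorm (s.component n) ≤ φ.algNorm s :=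
  le_iSup (fun n => φ.supNorm (s.component n)) n

variable [IsUltrametricDist k]

theorem pointNorm_mul (x : Analytification k X) (s t : L.SectionAlgebra k) :
    φ.pointNorm x (s * t) = φ.pointNorm x s * φ.pointNorm x t := by
  rw [pointNorm, map_mul]
  -- Gauss's lemma, with the frame norm as radius.
  exact Polynomial.gaussNorm_mul x.isNonarchimedean_abs (φ.frameNorm_pos _ _ _) _ _

theorem pointNorm_add_le (x : Analytification k X) (s t : L.SectionAlgebra k) :
    φ.pointNorm x (s + t) ≤ max (φ.pointNorm x s) (φ.pointNorm x t) := by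
  rw [pointNorm, map_add]
  exact Polynomial.isNonarchimedean_gaussNorm _ x.isNonarchimedean_abs
    (φ.frameNorm_pos _ _ _).le _ _

theorem pointNorm_pow (x : Analytification k X) (s : L.SectionAlgebra k) (n : ℕ) :
    φ.pointNorm x (s ^ n) = φ.pointNorm x s ^ n := by
  induction n with
  | zero => rw [pow_zero, pow_zero, pointNorm_one]
  | succ n ih => rw [pow_succ, pow_succ, pointNorm_mul, ih]

theorem algNorm_add_le (s t : L.SectionAlgebra k) :
    φ.algNorm (s + t) ≤ max (φ.algNorm s) (φ.algNorm t) := by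
  simp only [algNorm_eq_iSup_pointNorm]
  refine iSup_le fun x => (ENNReal.ofReal_le_ofReal (φ.pointNorm_add_le x s t)).trans ?_
  rw [ENNReal.ofReal_max]
  exact max_le_max (le_iSup (fun x => ENNReal.ofReal (φ.pointNorm x s)) x)
    (le_iSup (fun x => ENNReal.ofReal (φ.pointNorm x t)) x)

theorem algNorm_mul_le (s t : L.SectionAlgebra k) :
    φ.algNorm (s * t) ≤ φ.algNorm s * φ.algNorm t := by
  simp only [algNorm_eq_iSup_pointNorm]
  refine iSup_le fun x => ?_
  rw [pointNorm_mul, ENNReal.ofReal_mul (φ.pointNorm_nonneg x s)]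
  exact mul_le_mul' (le_iSup (fun x => ENNReal.ofReal (φ.pointNorm x s)) x)
    (le_iSup (fun x => ENNReal.ofReal (φ.pointNorm x t)) x)

/-- Each point seminorm commutes with powers. Roots are taken in `ℝ≥0∞` since the supremum may be
infinite; `n = 0` is excluded because the norm of `1` is `0` on an empty analytification. -/
theorem pow_algNorm_le (s : L.SectionAlgebra k) {n : ℕ} (hn : n ≠ 0) :
    φ.algNorm s ^ n ≤ φ.algNorm (s ^ n) := by
  have hn' : (0 : ℝ) < n := by positivity
  rw [← ENNReal.rpow_natCast, ← ENNReal.le_rpow_inv_iff hn']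
  simp only [algNorm_eq_iSup_pointNorm]
  refine iSup_le fun x => (ENNReal.le_rpow_inv_iff hn').2 ?_
  rw [ENNReal.rpow_natCast]
  rw [← ENNReal.ofReal_pow (φ.pointNorm_nonneg x s), ← pointNorm_pow]
  exact le_iSup (fun x => ENNReal.ofReal (φ.pointNorm x (s ^ n))) x

end Metric

end LineBundle

/-! ### Pull-back and quotient norms -/

namespace LineBundle

section Pullback

variable {k : Type u} [CommRing k] {X Y : Scheme.{u}} [X.Over (Spec (CommRingCat.of k))]
  [Y.Over (Spec (CommRingCat.of k))] {L : LineBundle X} (f : Y ⟶ X)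
  [f.IsOver (Spec (CommRingCat.of k))]

theorem algebraPullback_of {n : ℕ} (s : L.sections k n) :
    L.algebraPullback k f (SectionAlgebra.of s) =
      SectionAlgebra.of (L.sectionsPullback k f n s) :=
  DirectSum.toAddMonoid_of (β := fun n => L.sections k n)
    (fun n => (DirectSum.lof k ℕ (fun n => (L.pullback f).sections k n) n ∘ₗ
      L.sectionsPullback k f n).toAddMonoidHom) n s

theorem component_algebraPullback (s : L.SectionAlgebra k) (n : ℕ) :
    (L.algebraPullback k f s).component n = L.sectionsPullback k f n (s.component n) := by
  classical
  have h : ∀ T : Finset ℕ, ∀ g : ∀ n, L.sections k n,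
      (L.algebraPullback k f (∑ n ∈ T, SectionAlgebra.of (g n))).component n =
      L.sectionsPullback k f n ((∑ n ∈ T, SectionAlgebra.of (g n)).component n) := by
    intro T g
    induction T using Finset.induction_on with
    | empty =>
      simp only [Finset.sum_empty, map_zero]
      exact (map_zero (L.sectionsPullback k f n)).symm
    | insert m T hm ih =>
      rw [Finset.sum_insert hm, map_add, SectionAlgebra.component_add,
        SectionAlgebra.component_add, map_add, ih, algebraPullback_of]
      congr 1
      by_cases h : m = n
      · subst h
        rw [SectionAlgebra.component_of_self, SectionAlgebra.component_of_self]
      · rw [SectionAlgebra.component_of_ne h, SectionAlgebra.component_of_ne h, map_zero]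
  obtain ⟨S, hS⟩ := s.exists_eq_sum
  rw [hS]
  exact h S _

end Pullback

namespace Metric

variable {k : Type u} [NormedField k] {X Y : Scheme.{u}} [X.Over (Spec (CommRingCat.of k))]
  [Y.Over (Spec (CommRingCat.of k))] {L : LineBundle X} (φ : Metric k L) (f : Y ⟶ X)
  [f.IsOver (Spec (CommRingCat.of k))]

theorem pullback_abs {n : ℕ} (s : L.sections k n) (y : Analytification k Y) :
    (φ.pullback f).abs (L.sectionsPullback k f n s) y = φ.abs s (y.map f) := by
  obtain ⟨i, hi⟩ := L.covers (f y.pt)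
  rw [φ.abs_eq s (y.map f) i hi,
    (φ.pullback f).abs_eq (L.sectionsPullback k f n s) y i hi]
  exact congrArg (· * _) (y.absEval_map f hi (s.1 i)).symm

theorem pullback_pointNorm (s : L.SectionAlgebra k) (y : Analytification k Y) :
    (φ.pullback f).pointNorm y (L.algebraPullback k f s) = φ.pointNorm (y.map f) s := by
  have h (n : ℕ) : (φ.pullback f).abs ((L.algebraPullback k f s).component n) y =
      φ.abs (s.component n) (y.map f) := by
    rw [component_algebraPullback, pullback_abs]
  refine le_antisymm ?_ ?_
  · obtain ⟨n, hn⟩ := (φ.pullback f).exists_pointNorm_eq y (L.algebraPullback k f s)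
    rw [hn, h]
    exact φ.abs_component_le_pointNorm _ s n
  · obtain ⟨n, hn⟩ := φ.exists_pointNorm_eq (y.map f) s
    rw [hn, ← h]
    exact (φ.pullback f).abs_component_le_pointNorm _ _ n

theorem pullback_algNorm_le (s : L.SectionAlgebra k) :
    (φ.pullback f).algNorm (L.algebraPullback k f s) ≤ φ.algNorm s := by
  simp only [algNorm_eq_iSup_pointNorm, pullback_pointNorm]
  exact iSup_le fun y => le_iSup (fun x => ENNReal.ofReal (φ.pointNorm x s)) (y.map f)

theorem quotientAlgNorm_le {t : L.RestrictedAlgebra k f} {s : L.SectionAlgebra k}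
    (h : L.algebraPullback k f s = t) : φ.quotientAlgNorm f t ≤ φ.algNorm s :=
  iInf₂_le s h

theorem pullback_algNorm_le_quotientAlgNorm (t : L.RestrictedAlgebra k f) :
    (φ.pullback f).algNorm t ≤ φ.quotientAlgNorm f t :=
  le_iInf₂ fun s hs => hs ▸ φ.pullback_algNorm_le f s

theorem exists_algNorm_lt {t : L.RestrictedAlgebra k f} {c : ℝ≥0∞}
    (h : φ.quotientAlgNorm f t < c) :
    ∃ s : L.SectionAlgebra k, L.algebraPullback k f s = t ∧ φ.algNorm s < c := by
  simpa only [quotientAlgNorm, iInf_lt_iff, exists_prop] using h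

theorem quotientAlgNorm_zero : φ.quotientAlgNorm f 0 = 0 :=
  le_antisymm ((φ.quotientAlgNorm_le f (s := 0) (map_zero _)).trans_eq φ.algNorm_zero) zero_le

theorem quotientAlgNorm_smul_le (a : k) (t : L.RestrictedAlgebra k f) :
    φ.quotientAlgNorm f (a • t) ≤ ENNReal.ofReal ‖a‖ * φ.quotientAlgNorm f t := by
  by_cases ha : a = 0
  · rw [ha, zero_smul, quotientAlgNorm_zero]
    exact zero_le
  have h0 : ENNReal.ofReal ‖a‖ ≠ 0 := by simpa using ha
  simp only [quotientAlgNorm, ENNReal.mul_iInf_of_ne h0 ENNReal.ofReal_ne_top]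
  refine le_iInf₂ fun s hs => ?_
  rw [← φ.algNorm_smul]
  exact iInf₂_le (a • s) (by rw [map_smul, hs]; rfl)

theorem quotientAlgNorm_smul (a : k) (t : L.RestrictedAlgebra k f) :
    φ.quotientAlgNorm f (a • t) = ENNReal.ofReal ‖a‖ * φ.quotientAlgNorm f t := by
  refine le_antisymm (φ.quotientAlgNorm_smul_le f a t) ?_
  by_cases ha : a = 0
  · simp [ha]
  have h := mul_le_mul_right (φ.quotientAlgNorm_smul_le f a⁻¹ (a • t)) (ENNReal.ofReal ‖a‖)
  rwa [inv_smul_smul₀ ha, ← mul_assoc, ← ENNReal.ofReal_mul (norm_nonneg _), ← norm_mul,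
    mul_inv_cancel₀ ha, norm_one, ENNReal.ofReal_one, one_mul] at h

variable [IsUltrametricDist k]

theorem quotientAlgNorm_add_le (t t' : L.RestrictedAlgebra k f) :
    φ.quotientAlgNorm f (t + t') ≤ max (φ.quotientAlgNorm f t) (φ.quotientAlgNorm f t') := by
  refine le_of_forall_gt fun c hc => ?_
  obtain ⟨s, hs, hsc⟩ := φ.exists_algNorm_lt f ((le_max_left _ _).trans_lt hc)
  obtain ⟨s', hs', hsc'⟩ := φ.exists_algNorm_lt f ((le_max_right _ _).trans_lt hc)
  refine (φ.quotientAlgNorm_le f (s := s + s') ?_).trans_lt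
    ((φ.algNorm_add_le s s').trans_lt (max_lt hsc hsc'))
  rw [map_add, hs, hs']
  rfl

/-- Multiply almost optimal lifts. Finiteness excludes a product `0 * ⊤` on the right, which is `0`
in `ℝ≥0∞`. -/
theorem quotientAlgNorm_mul_le (hfin : ∀ t, φ.quotientAlgNorm f t ≠ ⊤)
    (t t' : L.RestrictedAlgebra k f) :
    φ.quotientAlgNorm f (t * t') ≤ φ.quotientAlgNorm f t * φ.quotientAlgNorm f t' := by
  refine ENNReal.le_mul_of_forall_lt (.inr (hfin t')) (.inl (hfin t)) fun a ha b hb => ?_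
  obtain ⟨s, hs, hsc⟩ := φ.exists_algNorm_lt f ha
  obtain ⟨s', hs', hsc'⟩ := φ.exists_algNorm_lt f hb
  refine (φ.quotientAlgNorm_le f (s := s * s') ?_).trans
    ((φ.algNorm_mul_le s s').trans (mul_le_mul' hsc.le hsc'.le))
  rw [map_mul, hs, hs']
  rfl

end Metric

end LineBundle

/-- A finite non-Archimedean algebra norm with values in `ℝ≥0∞` is an algebra norm. -/
theorem exists_algebraNorm {k : Type*} [NormedField k] {A : Type*} [CommRing A] [Algebra k A]
    (ν : A → ℝ≥0∞) (hfin : ∀ a, ν a ≠ ⊤) (hzero : ν 0 = 0)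
    (hadd : ∀ a b, ν (a + b) ≤ max (ν a) (ν b)) (hmul : ∀ a b, ν (a * b) ≤ ν a * ν b)
    (hsmul : ∀ (c : k) a, ν (c • a) = ENNReal.ofReal ‖c‖ * ν a) (heq : ∀ a, ν a = 0 → a = 0) :
    ∃ P : AlgebraNorm k A, IsNonarchimedean P ∧ ∀ a, ENNReal.ofReal (P a) = ν a := by
  have hna (a b : A) : (ν (a + b)).toReal ≤ max (ν a).toReal (ν b).toReal := by
    rw [← ENNReal.toReal_max (hfin a) (hfin b)]
    exact ENNReal.toReal_mono (max_ne_top (hfin a) (hfin b)) (hadd a b)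
  have hneg (a : A) : ν (-a) = ν a := by
    have := hsmul (-1) a
    rwa [neg_one_smul, norm_neg, norm_one, ENNReal.ofReal_one, one_mul] at this
  let P : AlgebraNorm k A :=
    { toFun := fun a => (ν a).toReal
      map_zero' := by rw [hzero, ENNReal.toReal_zero]
      add_le' := fun a b => (hna a b).trans
        (max_le_add_of_nonneg ENNReal.toReal_nonneg ENNReal.toReal_nonneg)
      neg' := fun a => by rw [hneg]
      mul_le' := fun a b => by
        rw [← ENNReal.toReal_mul]
        exact ENNReal.toReal_mono (ENNReal.mul_ne_top (hfin a) (hfin b)) (hmul a b)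
      eq_zero_of_map_eq_zero' := fun a ha =>
        heq a (((ENNReal.toReal_eq_zero_iff _).1 ha).resolve_right (hfin a))
      smul' := fun c a => by
        rw [hsmul, ENNReal.toReal_mul, ENNReal.toReal_ofReal (norm_nonneg c)] }
  exact ⟨P, hna, fun a => ENNReal.ofReal_toReal (hfin a)⟩

/-! ### Comparison with Fubini–Study metrics -/

namespace LineBundle

variable {k : Type u} [NormedField k] {X : Scheme.{u}} [X.Over (Spec (CommRingCat.of k))]
  {L : LineBundle X}

theorem norm_evalAt {n : ℕ} (i : L.ι) (x : Analytification k X) (hx : x.pt ∈ L.U i)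
    (s : L.sections k n) : ‖L.evalAt n i x hx s‖ = x.absEval hx (s.1 i) :=
  x.norm_toCompleted _

/-- Where `s` does not vanish, `(s(x))⁻¹ ⊗ s` is a competitor in the infimum defining the
Fubini–Study metric at the frame, and its extended norm is at most `p s / |s(x)|`. -/
theorem absEval_mul_fubiniStudy_le {n : ℕ} {p : Seminorm k (L.sections k n)}
    (hp : ∀ s, p s = 0 → s = 0) (i : L.ι) (x : Analytification k X) (hx : x.pt ∈ L.U i)
    (s : L.sections k n) : x.absEval hx (s.1 i) * fubiniStudy p i x hx ≤ p s := by
  let := x.normedAlgebraCompleted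
  rw [← norm_evalAt]
  by_cases h0 : L.evalAt n i x hx s = 0
  · rw [h0, norm_zero, zero_mul]
    exact apply_nonneg p s
  have hpos : 0 < ‖L.evalAt n i x hx s‖ := norm_pos_iff.2 h0
  rw [mul_comm, ← le_div_iff₀ hpos]
  have h1 : fubiniStudy p i x hx ≤
      scalarExtension p x.CompletedResidueField ((L.evalAt n i x hx s)⁻¹ ⊗ₜ s) := by
    refine csInf_le ⟨0, ?_⟩ ⟨_, ?_, rfl⟩
    · rintro _ ⟨w, -, rfl⟩
      exact scalarExtension_nonneg w
    · rw [LinearMap.liftBaseChange_tmul, smul_eq_mul, inv_mul_cancel₀ h0]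
  refine h1.trans ((scalarExtension_tmul_le hp _ s).trans_eq ?_)
  rw [norm_inv, inv_mul_eq_div]

theorem le_exp_mul_pow_of_abs_log_le {F c ε : ℝ} (hF : 0 < F) (hc : 0 < c) {n : ℕ} (hn : n ≠ 0)
    (h : |Real.log (F ^ (1 / (n : ℝ)) / c)| ≤ ε) :
    F ≤ Real.exp (n * ε) * c ^ n ∧ c ^ n ≤ Real.exp (n * ε) * F := by
  have hn' : (0 : ℝ) < n := by positivity
  have h1 : 0 < F ^ (1 / (n : ℝ)) := Real.rpow_pos_of_pos hF _
  rw [Real.log_div h1.ne' hc.ne', Real.log_rpow hF, abs_le] at h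
  have h2 : (n : ℝ) * (1 / n * Real.log F - Real.log c) = Real.log F - n * Real.log c := by
    field_simp
  have h3 := mul_le_mul_of_nonneg_left h.1 hn'.le
  have h4 := mul_le_mul_of_nonneg_left h.2 hn'.le
  rw [h2] at h3 h4
  have hF' := Real.exp_log hF
  have hc' : c ^ n = Real.exp (n * Real.log c) := by
    rw [Real.exp_nat_mul, Real.exp_log hc]
  constructor
  · rw [hc', ← Real.exp_add]
    nth_rewrite 1 [← hF']
    exact Real.exp_le_exp.2 (by linarith)
  · rw [hc']
    nth_rewrite 1 [← hF']
    rw [← Real.exp_add]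
    exact Real.exp_le_exp.2 (by linarith)

namespace Metric

variable {φ : Metric k L}

theorem abs_le_exp_mul {ε : ℝ} {n : ℕ} (hn : n ≠ 0) {p : Seminorm k (L.sections k n)}
    (hp : ∀ s, p s = 0 → s = 0)
    (h : ∀ i x (hx : x.pt ∈ L.U i), 0 < fubiniStudy p i x hx ∧
      |Real.log (fubiniStudy p i x hx ^ (1 / (n : ℝ)) / φ.frameNorm i x hx)| ≤ ε)
    (s : L.sections k n) (x : Analytification k X) :
    φ.abs s x ≤ Real.exp (n * ε) * p s := by
  obtain ⟨i, hi⟩ := L.covers x.pt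
  rw [φ.abs_eq s x i hi]
  have h1 := (le_exp_mul_pow_of_abs_log_le (h i x hi).1 (φ.frameNorm_pos i x hi) hn
    (h i x hi).2).2
  refine (mul_le_mul_of_nonneg_left h1 (x.abs.nonneg _)).trans ?_
  rw [mul_left_comm]
  exact mul_le_mul_of_nonneg_left (absEval_mul_fubiniStudy_le hp i x hi s) (Real.exp_pos _).le

theorem supNorm_ne_top_of_pos [IsUltrametricDist k] (hφ : φ.IsAsymptoticFubiniStudy) {n : ℕ}
    (hn : n ≠ 0) (s : L.sections k n) : φ.supNorm s ≠ ⊤ := by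
  obtain ⟨p, hp, h⟩ := hφ
  -- The Fubini–Study approximation controls large degrees only, so `s` is replaced by a power of
  -- degree `n * (m + 1) ≥ m`, from which power-multiplicativity recovers `s`.
  obtain ⟨m, hm⟩ := Filter.eventually_atTop.1 (h 1 one_pos)
  have hnm : n * (m + 1) ≠ 0 := mul_ne_zero hn m.succ_ne_zero
  have h1 := abs_le_exp_mul hnm (hp _) (hm (n * (m + 1))
    (m.le_succ.trans (Nat.le_mul_of_pos_left _ (Nat.pos_of_ne_zero hn)))) (powSection s (m + 1))
  have h2 : φ.algNorm (SectionAlgebra.of s) ^ (m + 1) ≠ ⊤ := by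
    refine ne_top_of_le_ne_top ?_ (φ.pow_algNorm_le _ m.succ_ne_zero)
    rw [SectionAlgebra.of_pow, algNorm_of]
    exact ne_top_of_le_ne_top ENNReal.ofReal_ne_top
      (iSup_le fun x => ENNReal.ofReal_le_ofReal (h1 x))
  rw [← algNorm_of]
  exact fun h => h2 (by rw [h, ENNReal.top_pow m.succ_ne_zero])

end Metric

end LineBundle

/-! ### Projective schemes are proper -/

section Projective

attribute [local instance] MvPolynomial.gradedAlgebra

/-- `Proj` of a finite type graded algebra is proper over the spectrum of its degree `0` part. Here
that part consists of constants, so it is a quotient of `k` and its spectrum is closed in `Spec k`.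
-/
theorem IsProjectiveOver.isProper {k : Type u} [CommRing k] {X : Scheme.{u}}
    [X.Over (Spec (CommRingCat.of k))] (hX : IsProjectiveOver k X) :
    IsProper (X ↘ Spec (CommRingCat.of k)) := by
  obtain ⟨N, j, hj, h⟩ := hX
  rw [← h]
  let 𝒜 := MvPolynomial.homogeneousSubmodule (Fin (N + 1)) k
  have : IsScalarTower k (𝒜 0) (MvPolynomial (Fin (N + 1)) k) :=
    ⟨fun a b c => smul_mul_assoc a b.1 c⟩
  have : Algebra.FiniteType (𝒜 0) (MvPolynomial (Fin (N + 1)) k) :=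
    Algebra.FiniteType.of_restrictScalars_finiteType k (𝒜 0) (MvPolynomial (Fin (N + 1)) k)
  have hsurj : Function.Surjective (algebraMap k (𝒜 0)) := by
    rintro ⟨q, hq⟩
    have hq' : q.IsHomogeneous 0 := hq
    refine ⟨MvPolynomial.coeff 0 q, Subtype.ext ?_⟩
    exact (MvPolynomial.totalDegree_eq_zero_iff_eq_C.1
      (Nat.le_zero.1 hq'.totalDegree_le)).symm
  have : IsClosedImmersion (Spec.map (CommRingCat.ofHom (algebraMap k (𝒜 0)))) :=
    IsClosedImmersion.spec_of_surjective _ hsurj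
  infer_instance

end Projective

/-! ### Existence of points of the analytification -/

theorem fromSpecStalk_over {k : Type u} [CommRing k] {Y : Scheme.{u}}
    [Y.Over (Spec (CommRingCat.of k))] (y : Y) :
    Y.fromSpecStalk y ≫ (Y ↘ Spec (CommRingCat.of k)) =
      Spec.map (CommRingCat.ofHom
        ((Y.presheaf.germ ⊤ y trivial).hom.comp (structureHom k (⊤ : Y.Opens)))) := by
  have h1 : (Y ↘ Spec (CommRingCat.of k)) = Y.toSpecΓ ≫
      Spec.map ((Scheme.ΓSpecIso (CommRingCat.of k)).inv ≫
        (Y ↘ Spec (CommRingCat.of k)).appTop) := by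
    rw [Spec.map_comp, ← Category.assoc, ← Scheme.toSpecΓ_naturality, Category.assoc,
      ← SpecMap_ΓSpecIso_hom, ← Spec.map_comp, Iso.inv_hom_id, Spec.map_id,
      Category.comp_id]
  rw [h1, Scheme.fromSpecStalk_toSpecΓ_assoc, ← Spec.map_comp]
  congr 1
  ext a
  simp only [structureHom, Scheme.Hom.appTop, Scheme.Hom.app_eq_appLE]
  rfl

theorem fromSpecResidueField_over {k : Type u} [CommRing k] {Y : Scheme.{u}}
    [Y.Over (Spec (CommRingCat.of k))] (y : Y) :
    Y.fromSpecResidueField y ≫ (Y ↘ Spec (CommRingCat.of k)) =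
      Spec.map (CommRingCat.ofHom (residueHom k y)) := by
  rw [Scheme.fromSpecResidueField, Category.assoc, fromSpecStalk_over, ← Spec.map_comp]
  rfl

section Points

variable {k : Type u} [NontriviallyNormedField k] [IsUltrametricDist k] [CompleteSpace k]
  {Y : Scheme.{u}} [Y.Over (Spec (CommRingCat.of k))]

/-- A non-empty open subset of a scheme locally of finite type contains the support of a point of
the analytification. -/
theorem exists_analytification_mem [LocallyOfFiniteType (Y ↘ Spec (CommRingCat.of k))]
    (V : Y.Opens) (hV : (V : Set Y).Nonempty) : ∃ y : Analytification k Y, y.pt ∈ V := by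
  have : JacobsonSpace Y := LocallyOfFiniteType.jacobsonSpace (Y ↘ Spec (CommRingCat.of k))
  -- The residue field at a closed point is finite over `k` by the Nullstellensatz, so the spectral
  -- norm extends the absolute value of `k` to it.
  obtain ⟨y, hyV, hy⟩ := nonempty_inter_closedPoints hV V.isOpen.isLocallyClosed
  have hint : (residueHom k y).IsIntegral := by
    have : IsFinite (Y.fromSpecResidueField y ≫ (Y ↘ Spec (CommRingCat.of k))) := by
      rw [mem_closedPoints_iff, isClosed_singleton_iff_isClosedImmersion] at hy
      rw [isFinite_iff_locallyOfFiniteType_of_jacobsonSpace]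
      infer_instance
    rw [fromSpecResidueField_over] at this
    exact (IsIntegralHom.SpecMap_iff (φ := CommRingCat.ofHom (residueHom k y))).1 inferInstance
  let : Algebra k (Y.residueField y) := (residueHom k y).toAlgebra
  have : Algebra.IsAlgebraic k (Y.residueField y) :=
    (⟨hint⟩ : Algebra.IsIntegral k (Y.residueField y)).isAlgebraic
  refine ⟨⟨y, MulRingNorm.mulRingNormEquivAbsoluteValue
    (spectralMulAlgNorm k (Y.residueField y)).toMulRingNorm, fun a => ?_⟩, hyV⟩
  exact spectralNorm_extends (K := k) (L := Y.residueField y) a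

end Points

namespace LineBundle

variable {k : Type u} [NontriviallyNormedField k] [IsUltrametricDist k] [CompleteSpace k]
  {Y : Scheme.{u}} [Y.Over (Spec (CommRingCat.of k))]

/-- On a reduced scheme a non-zero function has a non-empty non-vanishing locus. That locus contains
the support of an analytic point, where the metric sees the function. -/
theorem Metric.eq_zero_of_algNorm_eq_zero [IsReduced Y]
    [LocallyOfFiniteType (Y ↘ Spec (CommRingCat.of k))] {L : LineBundle Y} (φ : Metric k L)
    {t : L.SectionAlgebra k} (ht : φ.algNorm t = 0) : t = 0 := by
  have h (n : ℕ) : t.component n = 0 := by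
    refine Subtype.ext (funext fun i => ?_)
    change (t.component n).1 i = 0
    rw [← basicOpen_eq_bot_iff]
    by_contra hne
    obtain ⟨y, hy⟩ := exists_analytification_mem (k := k) (Y.basicOpen ((t.component n).1 i))
      (Set.nonempty_iff_ne_empty.2 fun h => hne (Opens.ext h))
    have hyi : y.pt ∈ L.U i := Y.basicOpen_le _ hy
    have h1 : φ.abs (t.component n) y ≤ 0 := by
      have := (le_iSup (fun y => ENNReal.ofReal (φ.abs (t.component n) y)) y).trans
        ((φ.supNorm_component_le t n).trans_eq ht)
      simpa using this
    rw [φ.abs_eq _ y i hyi] at h1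
    have h2 : 0 < y.absEval hyi ((t.component n).1 i) :=
      y.abs.pos ((Scheme.evaluation_ne_zero_iff_mem_basicOpen Y y.pt hyi _).2 hy)
    exact absurd h1 (not_le.2 (mul_pos h2 (pow_pos (φ.frameNorm_pos i y hyi) n)))
  obtain ⟨S, hS⟩ := t.exists_eq_sum
  rw [hS]
  refine Finset.sum_eq_zero fun n _ => ?_
  rw [h n]
  exact map_zero (DirectSum.lof k ℕ (fun n => L.sections k n) n)

/-- Sections of the trivial power have a constant absolute value, because the global functions of
an integral proper scheme form an algebraic extension of `k`. -/
theorem exists_forall_abs_eq {X : Scheme.{u}} [X.Over (Spec (CommRingCat.of k))] [IsIntegral X]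
    [UniversallyClosed (X ↘ Spec (CommRingCat.of k))] {L : LineBundle X} (s : L.sections k 0) :
    ∃ r : ℝ, ∀ (φ : Metric k L) (x : Analytification k X), φ.abs s x = r := by
  -- In degree `0` the transition factors are `g ^ 0 = 1`, so the coordinates glue to a global
  -- function.
  obtain ⟨g, hg, -⟩ := X.sheaf.existsUnique_gluing' L.U ⊤ (fun i => homOfLE le_top)
    (fun x _ => Opens.mem_iSup.2 (L.covers x)) s.1 (fun i j => by
      have h := s.2 i j
      rw [pow_zero, one_mul] at h
      exact h)
  have hint : (structureHom k (⊤ : X.Opens)).IsIntegral := by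
    have h1 : ((X ↘ Spec (CommRingCat.of k)).appTop.hom).IsIntegral :=
      isIntegral_appTop_of_universallyClosed _
    have h2 := RingHom.isIntegral_respectsIso.2 _
      (Scheme.ΓSpecIso (CommRingCat.of k)).symm.commRingCatIsoToRingEquiv h1
    rw [Scheme.Hom.appTop, Scheme.Hom.app_eq_appLE] at h2
    exact h2
  let : Field Γ(X, ⊤) := (isField_of_universallyClosed k (X ↘ Spec (CommRingCat.of k))).toField
  have : Algebra.IsAlgebraic k Γ(X, ⊤) :=
    (⟨hint⟩ : Algebra.IsIntegral k Γ(X, ⊤)).isAlgebraic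
  refine ⟨spectralNorm k Γ(X, ⊤) g, fun φ x => ?_⟩
  obtain ⟨i, hi⟩ := L.covers x.pt
  rw [φ.abs_eq s x i hi, pow_zero, mul_one, ← hg i]
  refine (x.absEval_restrict le_top hi g).trans ?_
  let v : AbsoluteValue Γ(X, ⊤) ℝ :=
    x.abs.comp (f := (X.evaluation ⊤ x.pt trivial).hom) (RingHom.injective _)
  -- The absolute value of a complete field extends uniquely to an algebraic extension, so all
  -- points give the same value to `g`.
  exact spectralNorm_unique_field_norm_ext (K := k) (L := Γ(X, ⊤)) (f := v)
    (fun a => x.abs_residueHom a) g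

theorem Metric.supNorm_ne_top {X : Scheme.{u}} [X.Over (Spec (CommRingCat.of k))] [IsIntegral X]
    [UniversallyClosed (X ↘ Spec (CommRingCat.of k))] {L : LineBundle X} {φ : Metric k L}
    (hφ : φ.IsAsymptoticFubiniStudy) {n : ℕ} (s : L.sections k n) : φ.supNorm s ≠ ⊤ := by
  rcases eq_or_ne n 0 with rfl | hn
  · obtain ⟨r, hr⟩ := exists_forall_abs_eq s
    exact ne_top_of_le_ne_top ENNReal.ofReal_ne_top
      (iSup_le fun x => ENNReal.ofReal_le_ofReal (hr φ x).le)
  · exact supNorm_ne_top_of_pos hφ hn s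

theorem Metric.algNorm_ne_top {X : Scheme.{u}} [X.Over (Spec (CommRingCat.of k))] [IsIntegral X]
    [UniversallyClosed (X ↘ Spec (CommRingCat.of k))] {L : LineBundle X} {φ : Metric k L}
    (hφ : φ.IsAsymptoticFubiniStudy) (s : L.SectionAlgebra k) : φ.algNorm s ≠ ⊤ := by
  obtain ⟨S, hS⟩ := s.exists_eq_sum
  have h : ∀ T : Finset ℕ,
      φ.algNorm (∑ n ∈ T, SectionAlgebra.of (s.component n)) ≠ ⊤ := by
    intro T
    classical
    induction T using Finset.induction_on with
    | empty => simp [φ.algNorm_zero]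
    | insert m T hm ih =>
      rw [Finset.sum_insert hm]
      refine ne_top_of_le_ne_top (max_ne_top ?_ ih) (φ.algNorm_add_le _ _)
      rw [algNorm_of]
      exact supNorm_ne_top hφ _
  rw [hS]
  exact h S

end LineBundle

/-! ### Sections as rational functions -/

section Generic

variable {X : Scheme.{u}} [IsIntegral X]

theorem genericPoint_mem {W : X.Opens} {x : X} (hx : x ∈ W) : genericPoint X ∈ W :=
  ((genericPoint_spec X).mem_open_set_iff W.isOpen).2 ⟨x, trivial, hx⟩

/-- The rational function defined by a section of the structure sheaf. -/
def rationalOf (W : X.Opens) (hW : genericPoint X ∈ W) : Γ(X, W) →+* X.functionField :=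
  (X.presheaf.germ W (genericPoint X) hW).hom

theorem rationalOf_restrict {V W : X.Opens} (h : V ≤ W) (hV : genericPoint X ∈ V) (a : Γ(X, W)) :
    rationalOf V hV (X.presheaf.map (homOfLE h).op a) = rationalOf W (h hV) a :=
  X.presheaf.germ_res_apply (homOfLE h) _ hV a

theorem rationalOf_injective (W : X.Opens) (hW : genericPoint X ∈ W) :
    Function.Injective (rationalOf W hW) :=
  germ_injective_of_isIntegral X _ hW

theorem section_ext {W : X.Opens} {a b : Γ(X, W)}
    (h : ∀ hW : genericPoint X ∈ W, rationalOf W hW a = rationalOf W hW b) : a = b := by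
  by_cases hW : genericPoint X ∈ W
  · exact rationalOf_injective W hW (h hW)
  · have : W = ⊥ := by
      ext x
      exact ⟨fun hx => (hW (genericPoint_mem hx)).elim, fun hx => hx.elim⟩
    subst this
    exact Subsingleton.elim _ _

/-- A rational function that is regular near every point of `V` is regular on `V`. -/
theorem exists_rationalOf_eq (V : X.Opens) (h : X.functionField)
    (hloc : ∀ x ∈ V, ∃ (W : X.Opens) (hW : x ∈ W) (a : Γ(X, W)),
      rationalOf W (genericPoint_mem hW) a = h) :
    ∃ a : Γ(X, V), ∀ hV : genericPoint X ∈ V, rationalOf V hV a = h := by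
  choose W hW a ha using fun x : V => hloc x.1 x.2
  obtain ⟨b, hb, -⟩ := X.sheaf.existsUnique_gluing' (fun x => W x ⊓ V) V
    (fun x => homOfLE inf_le_right) (fun x hx => Opens.mem_iSup.2 ⟨⟨x, hx⟩, hW ⟨x, hx⟩, hx⟩)
    (fun x => X.presheaf.map (homOfLE (inf_le_left : W x ⊓ V ≤ W x)).op (a x)) (fun x y => by
      refine section_ext fun hη => ?_
      refine (rationalOf_restrict _ hη _).trans
        (Eq.trans ?_ (rationalOf_restrict _ hη _).symm)
      rw [rationalOf_restrict, rationalOf_restrict, ha, ha])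
  refine ⟨b, fun hV => ?_⟩
  have hη : genericPoint X ∈ W ⟨_, hV⟩ ⊓ V := ⟨hW _, hV⟩
  have h1 := (rationalOf_restrict (inf_le_right : W ⟨_, hV⟩ ⊓ V ≤ V) hη b).symm.trans
    (congrArg (rationalOf _ hη) (hb ⟨_, hV⟩))
  exact h1.trans ((rationalOf_restrict inf_le_left hη _).trans (ha _))

end Generic

namespace LineBundle

theorem mem_nonvanishing {X : Scheme.{u}} {L : LineBundle X} {k : Type u} [CommRing k]
    [X.Over (Spec (CommRingCat.of k))] {n : ℕ} {s : L.sections k n} {x : X} :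
    x ∈ nonvanishing s ↔ ∃ i, x ∈ X.basicOpen (s.1 i) := Opens.mem_iSup

variable {X : Scheme.{u}} [IsIntegral X] (L : LineBundle X)

/-- The rational function `e j / e i`. -/
def ratio (i j : L.ι) (hi : genericPoint X ∈ L.U i) (hj : genericPoint X ∈ L.U j) :
    X.functionField :=
  rationalOf (L.U i ⊓ L.U j) ⟨hi, hj⟩ (L.g i j)

theorem ratio_self (i : L.ι) (hi : genericPoint X ∈ L.U i) : L.ratio i i hi hi = 1 := by
  rw [ratio, L.g_self, map_one]

theorem ratio_mul (i j l : L.ι) (hi : genericPoint X ∈ L.U i) (hj : genericPoint X ∈ L.U j)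
    (hl : genericPoint X ∈ L.U l) : L.ratio i j hi hj * L.ratio j l hj hl = L.ratio i l hi hl := by
  have hx : genericPoint X ∈ L.U i ⊓ L.U j ⊓ L.U l := ⟨⟨hi, hj⟩, hl⟩
  have h := congrArg (rationalOf _ hx) (L.g_trans i j l)
  rw [map_mul, rationalOf_restrict, rationalOf_restrict, rationalOf_restrict] at h
  exact h

theorem ratio_ne_zero (i j : L.ι) (hi : genericPoint X ∈ L.U i) (hj : genericPoint X ∈ L.U j) :
    L.ratio i j hi hj ≠ 0 := by
  intro h
  have := L.ratio_mul i j i hi hj hi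
  rw [h, zero_mul, ratio_self] at this
  exact zero_ne_one this

/-- The index of a frame that is defined at the generic point. -/
def genericIndex : L.ι := (L.covers (genericPoint X)).choose

theorem genericPoint_mem_genericIndex : genericPoint X ∈ L.U L.genericIndex :=
  (L.covers (genericPoint X)).choose_spec

/-- The rational function `e / e i` of the reference frame `e`. -/
def scale (i : L.ι) (hi : genericPoint X ∈ L.U i) : X.functionField :=
  L.ratio i L.genericIndex hi L.genericPoint_mem_genericIndex

theorem scale_ne_zero (i : L.ι) (hi : genericPoint X ∈ L.U i) : L.scale i hi ≠ 0 :=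
  L.ratio_ne_zero _ _ _ _

variable {L} {k : Type u} [CommRing k] [X.Over (Spec (CommRingCat.of k))]

/-- The quotient of a section of `L^{⊗ n}` by the power of the reference frame. -/
def rationalValue {n : ℕ} (s : L.sections k n) : X.functionField :=
  rationalOf _ L.genericPoint_mem_genericIndex (s.1 L.genericIndex)

/-- With `e` the reference frame, a section is `rationalValue s • e ^ n`, and `scale i` converts `e`
to the frame with index `i`. Thus one element of the function field determines a section, and
relations between sections of different powers become identities in a field. -/
theorem rationalOf_section {n : ℕ} (s : L.sections k n) (i : L.ι) (hi : genericPoint X ∈ L.U i) :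
    rationalOf (L.U i) hi (s.1 i) = L.scale i hi ^ n * rationalValue s := by
  have hx : genericPoint X ∈ L.U i ⊓ L.U L.genericIndex := ⟨hi, L.genericPoint_mem_genericIndex⟩
  have h := congrArg (rationalOf _ hx) (s.2 i L.genericIndex)
  rwa [map_mul, map_pow, rationalOf_restrict, rationalOf_restrict] at h

theorem rationalValue_injective {n : ℕ} {s t : L.sections k n}
    (h : rationalValue s = rationalValue t) : s = t := by
  refine Subtype.ext (funext fun i => section_ext fun hi => ?_)
  rw [rationalOf_section, rationalOf_section, h]

theorem rationalValue_add {n : ℕ} (s t : L.sections k n) :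
    rationalValue (s + t) = rationalValue s + rationalValue t :=
  map_add (rationalOf _ L.genericPoint_mem_genericIndex) _ _

theorem rationalValue_zero {n : ℕ} : rationalValue (0 : L.sections k n) = 0 :=
  map_zero (rationalOf _ L.genericPoint_mem_genericIndex)

theorem rationalValue_mulSection {m n : ℕ} (s : L.sections k m) (t : L.sections k n) :
    rationalValue (mulSection s t) = rationalValue s * rationalValue t :=
  map_mul (rationalOf _ L.genericPoint_mem_genericIndex) _ _

theorem rationalValue_powSection {n : ℕ} (s : L.sections k n) (m : ℕ) :
    rationalValue (powSection s m) = rationalValue s ^ m :=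
  map_pow (rationalOf _ L.genericPoint_mem_genericIndex) _ _

/-- A rational function that locally is a section of `L^{⊗ n}` is one globally. -/
theorem exists_rationalValue_eq (n : ℕ) (h : X.functionField)
    (hloc : ∀ x : X, ∃ (i : L.ι) (W : X.Opens) (hi : x ∈ L.U i) (hW : x ∈ W) (a : Γ(X, W)),
      rationalOf W (genericPoint_mem hW) a = L.scale i (genericPoint_mem hi) ^ n * h) :
    ∃ s : L.sections k n, rationalValue s = h := by
  have key (j : L.ι) : ∃ a : Γ(X, L.U j), ∀ hj : genericPoint X ∈ L.U j,
      rationalOf (L.U j) hj a = L.scale j hj ^ n * h := by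
    by_cases hj : genericPoint X ∈ L.U j
    · obtain ⟨a, ha⟩ := exists_rationalOf_eq (L.U j) (L.scale j hj ^ n * h) fun x hx => by
        obtain ⟨i, W, hi, hW, a, ha⟩ := hloc x
        have hV : x ∈ W ⊓ (L.U j ⊓ L.U i) := ⟨hW, hx, hi⟩
        refine ⟨W ⊓ (L.U j ⊓ L.U i), hV,
          X.presheaf.map (homOfLE inf_le_left).op a *
            X.presheaf.map (homOfLE inf_le_right).op (L.g j i) ^ n, ?_⟩
        rw [map_mul, map_pow, rationalOf_restrict, rationalOf_restrict, ha]
        have h1 := L.ratio_mul j i L.genericIndex hj (genericPoint_mem hi)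
          L.genericPoint_mem_genericIndex
        rw [scale, scale, ← h1, mul_pow]
        change _ * L.ratio j i hj (genericPoint_mem hi) ^ n = _
        ring
      exact ⟨a, fun _ => ha hj⟩
    · exact ⟨0, fun hj' => (hj hj').elim⟩
  choose s hs using key
  refine ⟨⟨s, fun i j => section_ext fun hij => ?_⟩, ?_⟩
  · rw [map_mul, map_pow, rationalOf_restrict, rationalOf_restrict, hs, hs, scale,
      ← L.ratio_mul i j L.genericIndex hij.1 hij.2 L.genericPoint_mem_genericIndex, scale, ratio,
      mul_pow, mul_assoc]
  · refine (hs L.genericIndex L.genericPoint_mem_genericIndex).trans ?_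
    rw [scale, ratio_self, one_pow, one_mul]

theorem rationalValue_ne_zero {n : ℕ} {s : L.sections k n} {x : X} (hx : x ∈ nonvanishing s) :
    rationalValue s ≠ 0 := by
  obtain ⟨i, hi⟩ := mem_nonvanishing.1 hx
  intro h0
  have hη := genericPoint_mem (X.basicOpen_le _ hi)
  have h1 : s.1 i = 0 := section_ext fun hi => by
    rw [rationalOf_section, h0, mul_zero, map_zero]
  rw [h1] at hi
  simp at hi

/-- The quotient of two sections of the same power of `L` is regular where the denominator does
not vanish. -/
theorem exists_rationalOf_nonvanishing_eq {m n d e : ℕ} (h : m * d = n * e) (σ : L.sections k m)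
    (s : L.sections k n) :
    ∃ a : Γ(X, nonvanishing s), ∀ hV : genericPoint X ∈ nonvanishing s,
      rationalOf _ hV a = rationalValue σ ^ d / rationalValue s ^ e := by
  refine exists_rationalOf_eq _ _ fun x hx => ?_
  obtain ⟨i, hi⟩ := mem_nonvanishing.1 hx
  have hle : X.basicOpen (s.1 i) ≤ L.U i := X.basicOpen_le _
  have hη := genericPoint_mem hi
  have hu : IsUnit (X.presheaf.map (homOfLE hle).op (s.1 i)) :=
    X.toRingedSpace.isUnit_res_basicOpen (s.1 i)
  obtain ⟨v, hv⟩ := hu.exists_right_inv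
  refine ⟨_, hi, X.presheaf.map (homOfLE hle).op (σ.1 i) ^ d * v ^ e, ?_⟩
  have h1 := congrArg (rationalOf _ hη) hv
  rw [map_mul, map_one, rationalOf_restrict, rationalOf_section] at h1
  rw [map_mul, map_pow, map_pow, rationalOf_restrict, rationalOf_section]
  have hs : rationalValue s ≠ 0 := rationalValue_ne_zero hx
  have hc : L.scale i (hle hη) ≠ 0 := L.scale_ne_zero i _
  rw [eq_div_iff (pow_ne_zero _ hs)]
  have h2 : (L.scale i (hle hη) ^ n * rationalValue s * rationalOf _ hη v) ^ e = 1 := by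
    rw [h1, one_pow]
  calc _ = rationalValue σ ^ d * (L.scale i (hle hη) ^ (m * d) * rationalValue s ^ e *
        rationalOf _ hη v ^ e) := by ring
    _ = rationalValue σ ^ d *
        (L.scale i (hle hη) ^ n * rationalValue s * rationalOf _ hη v) ^ e := by rw [h]; ring
    _ = _ := by rw [h2, mul_one]

/-- A regular function on the non-vanishing locus of `s` becomes a section after multiplication
by a power of `s`. -/
theorem exists_rationalValue_eq_mul_pow [CompactSpace X] {n : ℕ} (s : L.sections k n)
    (hV : genericPoint X ∈ nonvanishing s) (a : Γ(X, nonvanishing s)) :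
    ∃ (M : ℕ) (σ : L.sections k (n * M)),
      rationalValue σ = rationalOf _ hV a * rationalValue s ^ M := by
  have hs : rationalValue s ≠ 0 := rationalValue_ne_zero hV
  -- The denominators are cleared locally by every exponent from some bound on, so that a finite
  -- cover admits a common exponent.
  have key (x : X) : ∃ (W : X.Opens) (i : L.ι) (hW : x ∈ W) (hWi : W ≤ L.U i) (M : ℕ),
      ∀ N ≥ M, ∃ b : Γ(X, W), rationalOf W (genericPoint_mem hW) b =
        L.scale i (hWi (genericPoint_mem hW)) ^ (n * N) *
          (rationalOf _ hV a * rationalValue s ^ N) := by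
    obtain ⟨i, hi⟩ := L.covers x
    obtain ⟨_, ⟨W, hWaff, rfl⟩, hxW, hWi⟩ :=
      X.isBasis_affineOpens.exists_subset_of_mem_open hi (L.U i).isOpen
    replace hWi : W ≤ L.U i := hWi
    have hη : genericPoint X ∈ W := genericPoint_mem hxW
    let τ : Γ(X, W) := X.presheaf.map (homOfLE hWi).op (s.1 i)
    have hτ : rationalOf W hη τ = L.scale i (hWi hη) ^ n * rationalValue s := by
      rw [rationalOf_restrict, rationalOf_section]
    have hτV : X.basicOpen τ ≤ nonvanishing s := by
      rw [X.basicOpen_res]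
      exact inf_le_right.trans (le_iSup (fun i => X.basicOpen (s.1 i)) i)
    have hητ : genericPoint X ∈ X.basicOpen τ := by
      rw [X.mem_basicOpen τ _ hη]
      have h0 : rationalOf W hη τ ≠ 0 := by
        rw [hτ]
        exact mul_ne_zero (pow_ne_zero _ (L.scale_ne_zero i _)) hs
      exact isUnit_iff_ne_zero.2 h0
    obtain ⟨M, b, hb⟩ := exists_eq_pow_mul_of_isAffineOpen X W hWaff τ
      (X.presheaf.map (homOfLE hτV).op a)
    refine ⟨W, i, hxW, hWi, M, fun N hN => ⟨b * τ ^ (N - M), ?_⟩⟩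
    have h1 := congrArg (rationalOf _ hητ) hb
    rw [map_mul, map_pow, rationalOf_restrict] at h1
    have h2 : rationalOf _ hη b = rationalOf _ hη τ ^ M * rationalOf _ hV a :=
      (rationalOf_restrict (X.basicOpen_le τ) hητ b).symm.trans
        (h1.trans (congrArg (fun c => c ^ M * _) (rationalOf_restrict (X.basicOpen_le τ) hητ τ)))
    rw [map_mul, map_pow, h2, hτ, mul_right_comm, ← pow_add, Nat.add_sub_cancel' hN]
    ring
  choose W i hW hWi M hM using key
  obtain ⟨T, hT⟩ := isCompact_univ.elim_finite_subcover (fun x => (W x : Set X))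
    (fun x => (W x).isOpen) (fun x _ => Set.mem_iUnion.2 ⟨x, hW x⟩)
  refine ⟨T.sup M, exists_rationalValue_eq _ _ fun x => ?_⟩
  obtain ⟨y, hy, hxy⟩ := Set.mem_iUnion₂.1 (hT (Set.mem_univ x))
  obtain ⟨b, hb⟩ := hM y (T.sup M) (Finset.le_sup hy)
  exact ⟨i y, W y, hWi y hxy, hxy, b, hb⟩

end LineBundle

/-! ### Centres of valuations -/

/-- A valuation ring of the function field of a proper integral scheme contains the local ring of
some point. -/
theorem exists_forall_rationalOf_mem {k : Type u} [CommRing k] {X : Scheme.{u}} [IsIntegral X]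
    [X.Over (Spec (CommRingCat.of k))] [UniversallyClosed (X ↘ Spec (CommRingCat.of k))]
    (O : ValuationSubring X.functionField)
    (hk : ∀ a : k, rationalOf (⊤ : X.Opens) trivial (structureHom k ⊤ a) ∈ O) :
    ∃ x : X, ∀ (W : X.Opens) (hW : x ∈ W) (a : Γ(X, W)),
      rationalOf W (genericPoint_mem hW) a ∈ O := by
  let ψ : k →+* O := ((rationalOf (⊤ : X.Opens) trivial).comp (structureHom k ⊤)).codRestrict
    O.toSubring hk
  have w : X.fromSpecStalk (genericPoint X) ≫ (X ↘ Spec (CommRingCat.of k)) =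
      Spec.map (CommRingCat.ofHom (algebraMap O X.functionField)) ≫
        Spec.map (CommRingCat.ofHom ψ) := by
    rw [fromSpecStalk_over, ← Spec.map_comp]
    rfl
  have hE : ValuativeCriterion.Existence (X ↘ Spec (CommRingCat.of k)) := by
    have : UniversallyClosed (X ↘ Spec (CommRingCat.of k)) := inferInstance
    rw [UniversallyClosed.eq_valuativeCriterion] at this
    exact this.1
  -- The lift `Spec O ⟶ X` of the generic point exists by the valuative criterion; the centre is the
  -- image of the closed point.
  obtain ⟨l, hl₁, hl₂⟩ := (hE { R := O, K := X.functionField, commSq := ⟨w⟩, .. }).exists_lift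
  dsimp only at hl₁ hl₂
  refine ⟨l (IsLocalRing.closedPoint O), fun W hW a => ?_⟩
  -- All points of `Spec O` specialise to the closed one, so an open set containing its image
  -- contains the whole image, and `a` pulls back to an element of `O`.
  have htop : (⊤ : (Spec (CommRingCat.of O)).Opens) ≤ l ⁻¹ᵁ W := by
    intro p _
    exact (IsLocalRing.specializes_closedPoint p).mem_open (l ⁻¹ᵁ W).isOpen hW
  let b : O := (Scheme.ΓSpecIso (CommRingCat.of O)).hom (l.appLE W ⊤ htop a)
  have hη := genericPoint_mem hW
  have h3 : rationalOf W hη a = algebraMap O X.functionField b := by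
    have hF : (⊤ : (Spec X.functionField).Opens) ≤ X.fromSpecStalk (genericPoint X) ⁻¹ᵁ W := by
      rw [← hl₁]
      exact fun p _ => htop trivial
    have h1 : (X.fromSpecStalk (genericPoint X)).appLE W ⊤ hF ≫ (Scheme.ΓSpecIso _).hom =
        X.presheaf.germ W _ hη := by
      rw [Scheme.Hom.appLE, Scheme.fromSpecStalk_app hη, Category.assoc, Category.assoc,
        Category.assoc, ← Functor.map_comp_assoc]
      have : (homOfLE le_top).op ≫ (homOfLE hF).op = 𝟙 (op (⊤ : (Spec X.functionField).Opens)) :=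
        rfl
      rw [this]
      simp
    have h2 : (X.fromSpecStalk (genericPoint X)).appLE W ⊤ hF =
        l.appLE W ⊤ htop ≫
          (Spec.map (CommRingCat.ofHom (algebraMap O X.functionField))).appTop := by
      simp only [← hl₁]
      rw [← Scheme.Hom.appLE_comp_appLE _ _ W ⊤ ⊤ htop le_top]
      congr 1
    rw [h2, Category.assoc, Scheme.ΓSpecIso_naturality] at h1
    exact (congrArg (fun g => g.hom a) h1).symm
  rw [h3]
  exact b.2

/-! ### Sections that do not vanish at a multiplicative seminorm -/

namespace LineBundle

variable {k : Type u} [CommRing k] {X : Scheme.{u}} [X.Over (Spec (CommRingCat.of k))]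
  {L : LineBundle X}

/-- A section regarded as a section of an equal power. -/
def castSection {m n : ℕ} (h : m = n) (s : L.sections k m) : L.sections k n := ⟨s.1, h ▸ s.2⟩

theorem SectionAlgebra.of_castSection {m n : ℕ} (h : m = n) (s : L.sections k m) :
    SectionAlgebra.of (castSection h s) = SectionAlgebra.of s :=
  SectionAlgebra.of_congr h.symm rfl

variable [IsIntegral X]

theorem rationalValue_castSection {m n : ℕ} (h : m = n) (s : L.sections k m) :
    rationalValue (castSection h s) = rationalValue s := rfl

theorem rationalValue_oneSection : rationalValue (oneSection : L.sections k 0) = 1 :=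
  map_one (rationalOf _ L.genericPoint_mem_genericIndex)

theorem rationalValue_smul {n : ℕ} (a : k) (s : L.sections k n) :
    rationalValue (a • s) =
      rationalOf (⊤ : X.Opens) trivial (structureHom k ⊤ a) * rationalValue s := by
  refine (map_mul (rationalOf _ L.genericPoint_mem_genericIndex) (structureHom k _ a) _).trans ?_
  rw [← map_structureHom k (le_top : L.U L.genericIndex ≤ ⊤), rationalOf_restrict]
  rfl

theorem of_eq_of_rationalValue_eq {m n : ℕ} (h : m = n) {s : L.sections k m} {t : L.sections k n}
    (hst : rationalValue s = rationalValue t) : SectionAlgebra.of s = SectionAlgebra.of t := by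
  subst h
  rw [rationalValue_injective hst]

/-- The rational functions of the form `σ / s ^ M`. -/
def fractions {d : ℕ} (s : L.sections k d) : Subring X.functionField where
  carrier := {ξ | ∃ (M : ℕ) (σ : L.sections k (d * M)), ξ * rationalValue s ^ M = rationalValue σ}
  mul_mem' := by
    rintro ξ η ⟨M, σ, hσ⟩ ⟨N, τ, hτ⟩
    refine ⟨M + N, castSection (mul_add d M N).symm (mulSection σ τ), ?_⟩
    rw [rationalValue_castSection, rationalValue_mulSection, ← hσ, ← hτ]
    ring
  one_mem' := ⟨0, castSection (mul_zero d).symm oneSection, by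
    rw [rationalValue_castSection, rationalValue_oneSection, pow_zero, mul_one]⟩
  add_mem' := by
    rintro ξ η ⟨M, σ, hσ⟩ ⟨N, τ, hτ⟩
    refine ⟨M + N, castSection (mul_add d M N).symm (mulSection σ (powSection s N)) +
      castSection (by ring) (mulSection τ (powSection s M)), ?_⟩
    rw [rationalValue_add, rationalValue_castSection, rationalValue_castSection,
      rationalValue_mulSection, rationalValue_mulSection, rationalValue_powSection,
      rationalValue_powSection, ← hσ, ← hτ]
    ring
  zero_mem' := ⟨0, 0, by rw [zero_mul, rationalValue_zero]⟩
  neg_mem' := by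
    rintro ξ ⟨M, σ, hσ⟩
    refine ⟨M, -σ, ?_⟩
    rw [neg_mul, hσ]
    exact (map_neg (rationalOf _ L.genericPoint_mem_genericIndex) _).symm

/-- The ideal of the fractions `σ / s ^ M` with `z σ = 0`. -/
def fractionsKer (z : MulRingSeminorm (L.SectionAlgebra k)) {d : ℕ} (s : L.sections k d) :
    Ideal (fractions s) where
  carrier := {ξ | ∃ (M : ℕ) (σ : L.sections k (d * M)),
    (ξ : X.functionField) * rationalValue s ^ M = rationalValue σ ∧ z (SectionAlgebra.of σ) = 0}
  add_mem' := by
    rintro ξ η ⟨M, σ, hσ, hσ'⟩ ⟨N, τ, hτ, hτ'⟩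
    refine ⟨M + N, castSection (mul_add d M N).symm (mulSection σ (powSection s N)) +
      castSection (by ring) (mulSection τ (powSection s M)), ?_, ?_⟩
    · rw [rationalValue_add, rationalValue_castSection, rationalValue_castSection,
        rationalValue_mulSection, rationalValue_mulSection, rationalValue_powSection,
        rationalValue_powSection, ← hσ, ← hτ]
      push_cast
      ring
    · refine le_antisymm ?_ (apply_nonneg z _)
      rw [SectionAlgebra.of_add]
      refine (map_add_le_add z _ _).trans ?_
      rw [SectionAlgebra.of_castSection, SectionAlgebra.of_castSection, ← SectionAlgebra.of_mul,
        ← SectionAlgebra.of_mul, map_mul, map_mul, hσ', hτ', zero_mul, zero_mul, add_zero]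
  zero_mem' := ⟨0, 0, by rw [ZeroMemClass.coe_zero, zero_mul, rationalValue_zero], by
    rw [← zero_smul k (0 : L.sections k (d * 0)), SectionAlgebra.of_smul, zero_smul, map_zero]⟩
  smul_mem' := by
    rintro ⟨ξ, M, σ, hσ⟩ η ⟨N, τ, hτ, hτ'⟩
    refine ⟨M + N, castSection (mul_add d M N).symm (mulSection σ τ), ?_, ?_⟩
    · rw [rationalValue_castSection, rationalValue_mulSection, ← hσ, ← hτ]
      change ξ * (η : X.functionField) * _ = _
      ring
    · rw [SectionAlgebra.of_castSection, ← SectionAlgebra.of_mul, map_mul, hτ', mul_zero]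

/-- A numerator representing `1` over `s ^ M` must be `s ^ M` itself, on which `z` is non-zero. -/
theorem fractionsKer_ne_top (z : MulRingSeminorm (L.SectionAlgebra k)) {d : ℕ}
    {s : L.sections k d} (hs : z (SectionAlgebra.of s) ≠ 0) : fractionsKer z s ≠ ⊤ := by
  rw [Ideal.ne_top_iff_one]
  rintro ⟨M, σ, hσ, hσ'⟩
  rw [OneMemClass.coe_one, one_mul, ← rationalValue_powSection] at hσ
  rw [← rationalValue_injective hσ, ← SectionAlgebra.of_pow, map_pow] at hσ'
  exact pow_ne_zero _ hs hσ'

/-- A multiplicative seminorm on the section algebra of an ample line bundle that does not vanish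
on the irrelevant ideal does not vanish on some section with affine non-vanishing locus. -/
theorem exists_isAffineOpen_nonvanishing [UniversallyClosed (X ↘ Spec (CommRingCat.of k))]
    (hL : L.IsAmple k) (z : MulRingSeminorm (L.SectionAlgebra k)) {d : ℕ} (hd : 0 < d)
    {s : L.sections k d} (hs : z (SectionAlgebra.of s) ≠ 0) :
    ∃ n : ℕ, 0 < n ∧ ∃ t : L.sections k n, IsAffineOpen (nonvanishing t) ∧
      genericPoint X ∈ nonvanishing t ∧ z (SectionAlgebra.of t) ≠ 0 := by
  have hs0 : rationalValue s ≠ 0 := by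
    intro h
    rw [← rationalValue_zero (L := L) (k := k) (n := d)] at h
    rw [rationalValue_injective h, ← zero_smul k (0 : L.sections k d), SectionAlgebra.of_smul,
      zero_smul, map_zero] at hs
    exact hs rfl
  -- A valuation ring containing the fractions `σ / s ^ M`, in which those with `z σ = 0` are
  -- non-units. Its centre on `X` shows which affine `X_t` to use.
  obtain ⟨O, hO, hI⟩ := Ideal.image_subset_nonunits_valuationSubring _ (fractionsKer_ne_top z hs)
  obtain ⟨x, hx⟩ := exists_forall_rationalOf_mem (k := k) O fun a => hO
    ⟨0, castSection (mul_zero d).symm (a • oneSection), by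
      rw [rationalValue_castSection, rationalValue_smul, rationalValue_oneSection, pow_zero]⟩
  obtain ⟨n, hn, t, hxt, ht⟩ := hL.2 x
  refine ⟨n, hn, t, ht, genericPoint_mem hxt, fun hzt => ?_⟩
  have ht0 : rationalValue t ≠ 0 := rationalValue_ne_zero hxt
  -- The function `s ^ n / t ^ d` is regular at the centre, hence lies in `O`. If `z t = 0`, its
  -- inverse would be a non-unit of `O`: a contradiction.
  obtain ⟨a, ha⟩ := exists_rationalOf_nonvanishing_eq (mul_comm d n) s t
  have h1 := hx _ hxt a
  rw [ha] at h1
  have h2 : rationalValue t ^ d / rationalValue s ^ n * rationalValue s ^ n =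
      rationalValue (castSection (mul_comm n d) (powSection t d)) := by
    rw [rationalValue_castSection, rationalValue_powSection,
      div_mul_cancel₀ _ (pow_ne_zero _ hs0)]
  have h3 : rationalValue t ^ d / rationalValue s ^ n ∈ O.nonunits :=
    hI ⟨⟨_, n, _, h2⟩, ⟨n, _, h2, by
      rw [SectionAlgebra.of_castSection, ← SectionAlgebra.of_pow, map_pow, hzt,
        zero_pow hd.ne']⟩, rfl⟩
  rw [ValuationSubring.mem_nonunits_iff_or, inv_div] at h3
  exact h3.elim (div_ne_zero (pow_ne_zero _ ht0) (pow_ne_zero _ hs0)) (fun h => h h1)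

end LineBundle

/-! ### Points of the analytification from multiplicative seminorms -/

/-- A rank one valuation of the ring of functions on an affine open subset is an absolute value on
the residue field of a point. -/
theorem exists_absoluteValue_evaluation {X : Scheme.{u}} {U : X.Opens} (hU : IsAffineOpen U)
    (v : Valuation Γ(X, U) NNReal) :
    ∃ (x : X) (hx : x ∈ U) (α : AbsoluteValue (X.residueField x) ℝ),
      ∀ a, α (X.evaluation U x hx a) = v a := by
  -- The point is the support of `v`. Then `v` extends to the local ring there and vanishes on its
  -- maximal ideal, so it descends to the residue field.
  let p : PrimeSpectrum Γ(X, U) := ⟨v.supp, inferInstance⟩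
  have hx : hU.fromSpec p ∈ U := by
    have : hU.fromSpec p ∈ Set.range hU.fromSpec := ⟨p, rfl⟩
    rwa [hU.range_fromSpec] at this
  let : Algebra Γ(X, U) (X.presheaf.stalk (hU.fromSpec p)) :=
    (X.presheaf.germ U _ hx).hom.toAlgebra
  have hloc : IsLocalization.AtPrime (X.presheaf.stalk (hU.fromSpec p)) p.asIdeal :=
    hU.isLocalization_stalk' p hx
  let w : Valuation (X.presheaf.stalk (hU.fromSpec p)) NNReal :=
    v.extendToLocalization (S := p.asIdeal.primeCompl) le_rfl _
  have hw (a : Γ(X, U)) : w (X.presheaf.germ U _ hx a) = v a :=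
    v.extendToLocalization_apply_map_apply le_rfl _ a
  have hmax : IsLocalRing.maximalIdeal (X.presheaf.stalk (hU.fromSpec p)) ≤ w.supp := by
    rw [← IsLocalization.AtPrime.map_eq_maximalIdeal p.asIdeal, Ideal.map_le_iff_le_comap]
    intro a ha
    exact (hw a).trans ha
  let β : Valuation (IsLocalRing.ResidueField (X.presheaf.stalk (hU.fromSpec p))) NNReal :=
    w.onQuot hmax
  let α : AbsoluteValue (X.residueField (hU.fromSpec p)) ℝ :=
    { toFun := fun a => β a
      map_mul' := fun a b => by
        rw [← NNReal.coe_mul]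
        exact congrArg _ (β.map_mul a b)
      nonneg' := fun a => (β a).2
      eq_zero' := fun a => NNReal.coe_eq_zero.trans β.zero_iff
      add_le' := fun a b => by
        have := (β.map_add a b).trans (max_le_add_of_nonneg zero_le zero_le)
        exact_mod_cast this }
  exact ⟨_, hx, α, fun a => congrArg NNReal.toReal (hw a)⟩

/-- A point of the analytification of `X` that lies over a point of a closed subscheme `Y` comes
from the analytification of `Y`. -/
theorem exists_analytification_map_eq {k : Type u} [NormedField k] {X Y : Scheme.{u}}
    [X.Over (Spec (CommRingCat.of k))] [Y.Over (Spec (CommRingCat.of k))] (f : Y ⟶ X)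
    [f.IsOver (Spec (CommRingCat.of k))] [IsClosedImmersion f] (x : Analytification k X)
    (hx : x.pt ∈ Set.range f) : ∃ y : Analytification k Y, y.map f = x := by
  obtain ⟨x, α, hα⟩ := x
  obtain ⟨y, rfl⟩ := hx
  -- A closed immersion is surjective on stalks, so it induces isomorphisms of residue fields, along
  -- which the absolute value is transported.
  have hs : Function.Surjective (f.residueFieldMap y).hom := by
    intro b
    obtain ⟨b, rfl⟩ := Y.residue_surjective y b
    obtain ⟨a, rfl⟩ := f.stalkMap_surjective y b
    exact ⟨X.residue _ a, congrArg (fun g => g.hom a) (Scheme.residue_residueFieldMap f y)⟩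
  let e : X.residueField (f y) ≃+* Y.residueField y :=
    RingEquiv.ofBijective (f.residueFieldMap y).hom ⟨RingHom.injective _, hs⟩
  refine ⟨⟨y, α.comp (f := e.symm.toRingHom) e.symm.injective, fun a => ?_⟩, ?_⟩
  · rw [← hα a]
    refine congrArg α (e.symm_apply_eq.2 ?_)
    have hy : f y ∈ (⊤ : X.Opens) := trivial
    rw [← evaluation_structureHom k (f ⁻¹ᵁ ⊤) y hy, ← app_structureHom k f ⊤ a]
    exact (Scheme.evaluation_naturality_apply f y hy _).symm
  · rw [Analytification.map]
    congr 1
    ext a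
    exact congrArg α (e.symm_apply_apply a)

/-- The function `σ / s ^ M ↦ z σ / z s ^ M` is a valuation on the ring of functions on the
non-vanishing locus of `s`. -/
theorem LineBundle.exists_valuation_nonvanishing {k : Type u} [CommRing k] {X : Scheme.{u}}
    [X.Over (Spec (CommRingCat.of k))] [IsIntegral X] [CompactSpace X] {L : LineBundle X}
    (z : MulRingSeminorm (L.SectionAlgebra k)) (hna : IsNonarchimedean z) {n : ℕ}
    (s : L.sections k n) (hs : z (SectionAlgebra.of s) ≠ 0)
    (hV : genericPoint X ∈ nonvanishing s) :
    ∃ v : Valuation Γ(X, nonvanishing s) NNReal, ∀ a M (σ : L.sections k (n * M)),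
      rationalValue σ = rationalOf _ hV a * rationalValue s ^ M →
        (v a : ℝ) = z (SectionAlgebra.of σ) / z (SectionAlgebra.of s) ^ M := by
  choose M σ hσ using exists_rationalValue_eq_mul_pow s hV
  let w (a : Γ(X, nonvanishing s)) : NNReal :=
    ⟨z (SectionAlgebra.of (σ a)) / z (SectionAlgebra.of s) ^ M a,
      div_nonneg (apply_nonneg z _) (pow_nonneg (apply_nonneg z _) _)⟩
  -- The value does not depend on the chosen representative: cross-multiplied numerators are equal
  -- sections, and `z` is multiplicative.
  have hw (a N) (τ : L.sections k (n * N))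
      (hτ : rationalValue τ = rationalOf _ hV a * rationalValue s ^ N) :
      (w a : ℝ) = z (SectionAlgebra.of τ) / z (SectionAlgebra.of s) ^ N := by
    have h : SectionAlgebra.of (mulSection (σ a) (powSection s N)) =
        SectionAlgebra.of (mulSection τ (powSection s (M a))) := by
      refine of_eq_of_rationalValue_eq (add_comm _ _) ?_
      rw [rationalValue_mulSection, rationalValue_mulSection, rationalValue_powSection,
        rationalValue_powSection, hσ, hτ]
      ring
    replace h := congrArg z h
    rw [← SectionAlgebra.of_mul, ← SectionAlgebra.of_mul, ← SectionAlgebra.of_pow,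
      ← SectionAlgebra.of_pow, map_mul, map_mul, map_pow, map_pow] at h
    exact (div_eq_div_iff (pow_ne_zero _ hs) (pow_ne_zero _ hs)).2 h
  refine ⟨{ toFun := w, map_zero' := ?_, map_one' := ?_, map_mul' := ?_, map_add_le_max' := ?_ },
    hw⟩
  · have h := hw 0 0 0 (by rw [map_zero, zero_mul, rationalValue_zero])
    rw [← zero_smul k (0 : L.sections k (n * 0)), SectionAlgebra.of_smul, zero_smul, map_zero,
      zero_div] at h
    exact_mod_cast h
  · have h := hw 1 0 (castSection (mul_zero n).symm oneSection) (by
      rw [map_one, one_mul, pow_zero, rationalValue_castSection, rationalValue_oneSection])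
    rw [SectionAlgebra.of_castSection, SectionAlgebra.of_oneSection, map_one, pow_zero,
      div_one] at h
    exact_mod_cast h
  · intro a b
    have h := hw (a * b) (M a + M b)
      (castSection (mul_add n _ _).symm (mulSection (σ a) (σ b))) (by
        rw [rationalValue_castSection, rationalValue_mulSection, hσ, hσ, map_mul]
        ring)
    rw [SectionAlgebra.of_castSection, ← SectionAlgebra.of_mul, map_mul, pow_add,
      mul_div_mul_comm] at h
    exact NNReal.coe_injective h
  · intro a b
    have h := hw (a + b) (M a + M b)
      (castSection (mul_add n _ _).symm (mulSection (σ a) (powSection s (M b))) +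
        castSection (by ring) (mulSection (σ b) (powSection s (M a)))) (by
        rw [rationalValue_add, rationalValue_castSection, rationalValue_castSection,
          rationalValue_mulSection, rationalValue_mulSection, rationalValue_powSection,
          rationalValue_powSection, hσ, hσ, map_add]
        ring)
    rw [SectionAlgebra.of_add, SectionAlgebra.of_castSection, SectionAlgebra.of_castSection,
      ← SectionAlgebra.of_mul, ← SectionAlgebra.of_mul, ← SectionAlgebra.of_pow,
      ← SectionAlgebra.of_pow] at h
    rw [← NNReal.coe_le_coe, NNReal.coe_max, h]
    have hpos : 0 < z (SectionAlgebra.of s) := (apply_nonneg z _).lt_of_ne' hs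
    refine (div_le_div_of_nonneg_right (hna _ _) (pow_nonneg hpos.le _)).trans ?_
    rw [← max_div_div_right (pow_nonneg hpos.le _), map_mul, map_mul, map_pow, map_pow, pow_add]
    refine max_le_max (le_of_eq ?_) (le_of_eq ?_)
    · change _ = z (SectionAlgebra.of (σ a)) / z (SectionAlgebra.of s) ^ M a
      field_simp
    · change _ = z (SectionAlgebra.of (σ b)) / z (SectionAlgebra.of s) ^ M b
      field_simp

namespace LineBundle

/-- A relation between rational functions holds on the common open set of definition because `X` is
integral, and can then be evaluated at a point other than the generic one. -/
theorem evaluation_mul_eq {k : Type u} [CommRing k] {X : Scheme.{u}}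
    [X.Over (Spec (CommRingCat.of k))] [IsIntegral X] {L : LineBundle X} {V : X.Opens}
    (a : Γ(X, V)) {m : ℕ} (σ τ : L.sections k m)
    (h : ∀ hV, rationalOf V hV a * rationalValue τ = rationalValue σ) {x : X} (hx : x ∈ V)
    (i : L.ι) (hi : x ∈ L.U i) :
    X.evaluation V x hx a * X.evaluation (L.U i) x hi (τ.1 i) =
      X.evaluation (L.U i) x hi (σ.1 i) := by
  have hxi : x ∈ V ⊓ L.U i := ⟨hx, hi⟩
  have key : X.presheaf.map (homOfLE (inf_le_left : V ⊓ L.U i ≤ V)).op a *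
      X.presheaf.map (homOfLE (inf_le_right : V ⊓ L.U i ≤ L.U i)).op (τ.1 i) =
      X.presheaf.map (homOfLE (inf_le_right : V ⊓ L.U i ≤ L.U i)).op (σ.1 i) := by
    refine section_ext fun hη => ?_
    rw [map_mul, rationalOf_restrict, rationalOf_restrict, rationalOf_restrict,
      rationalOf_section, rationalOf_section, ← h hη.1]
    ring
  have hres {W : X.Opens} (hle : V ⊓ L.U i ≤ W) (b : Γ(X, W)) :
      X.evaluation (V ⊓ L.U i) x hxi (X.presheaf.map (homOfLE hle).op b) =
        X.evaluation W x (hle hxi) b :=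
    congrArg (X.residue x) (X.presheaf.germ_res_apply (homOfLE hle) x hxi b)
  have := congrArg (X.evaluation (V ⊓ L.U i) x hxi) key
  rwa [map_mul, hres, hres, hres] at this

variable {k : Type u} [NormedField k] {X Y : Scheme.{u}}
  [X.Over (Spec (CommRingCat.of k))] [Y.Over (Spec (CommRingCat.of k))] [IsIntegral X]
  [CompactSpace X] (f : Y ⟶ X) [f.IsOver (Spec (CommRingCat.of k))] [IsClosedImmersion f]
  [IsReduced Y] {L : LineBundle X}

/-- A multiplicative seminorm on the section algebra of `L` that factors over the restriction to
`Y` and does not vanish on a section `s` with affine non-vanishing locus is given by a point `y`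
of the analytification of `Y` and a norm on the fibre of `L` at `y`. -/
theorem exists_analytification_eq (z : MulRingSeminorm (L.SectionAlgebra k))
    (hna : IsNonarchimedean z) (hk : ∀ a : k, z (algebraMap k _ a) = ‖a‖)
    (hker : ∀ s, L.algebraPullback k f s = 0 → z s = 0) {n : ℕ} (hn : 0 < n)
    (s : L.sections k n) (hs : z (SectionAlgebra.of s) ≠ 0)
    (hV : genericPoint X ∈ nonvanishing s) (haff : IsAffineOpen (nonvanishing s)) :
    ∃ (y : Analytification k Y) (i : L.ι) (hi : f y.pt ∈ L.U i) (c : ℝ), 0 < c ∧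
      ∀ m (σ : L.sections k m),
        z (SectionAlgebra.of σ) = (y.map f).absEval hi (σ.1 i) * c ^ m := by
  obtain ⟨v, hv⟩ := exists_valuation_nonvanishing z hna s hs hV
  obtain ⟨x, hx, α, hα⟩ := exists_absoluteValue_evaluation haff v
  have hs0 : rationalValue s ≠ 0 := rationalValue_ne_zero hV
  -- Otherwise some basic open set of a function `a = σ / s ^ M` contains `x` and misses `Y`. The
  -- section `σ * s` vanishes on `Y`: inside `X_s` because `a` does, outside because `s` does. Hence
  -- `z σ = 0` and `|a|(x) = 0`, which is absurd.
  have hxr : x ∈ Set.range f := by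
    by_contra hxr
    obtain ⟨a, haV, hxa⟩ := haff.exists_basicOpen_le
      (V := ⟨(Set.range f)ᶜ, f.isClosedEmbedding.isClosed_range.isOpen_compl⟩) ⟨x, hxr⟩ hx
    obtain ⟨M, σ, hσ⟩ := exists_rationalValue_eq_mul_pow s hV a
    have h0 : L.algebraPullback k f (SectionAlgebra.of σ * SectionAlgebra.of s) = 0 := by
      rw [SectionAlgebra.of_mul, algebraPullback_of]
      have : L.sectionsPullback k f _ (mulSection σ s) = 0 := by
        refine Subtype.ext (funext fun i => ?_)
        change f.app (L.U i) (σ.1 i * s.1 i) = 0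
        rw [← basicOpen_eq_bot_iff, ← Scheme.preimage_basicOpen, Scheme.basicOpen_mul,
          eq_bot_iff]
        rintro y ⟨hy1, hy2⟩
        have hyi : f y ∈ L.U i := X.basicOpen_le _ hy2
        have hyV : f y ∈ nonvanishing s := mem_nonvanishing.2 ⟨i, hy2⟩
        have he := evaluation_mul_eq a σ (powSection s M)
          (fun _ => by rw [rationalValue_powSection, hσ]) hyV i hyi
        have hya : f y ∈ X.basicOpen a := by
          rw [← Scheme.evaluation_ne_zero_iff_mem_basicOpen X _ hyV]
          rw [SetLike.mem_coe, ← Scheme.evaluation_ne_zero_iff_mem_basicOpen X _ hyi, ← he] at hy1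
          exact left_ne_zero_of_mul hy1
        exact haV hya ⟨y, rfl⟩
      rw [this]
      exact map_zero (DirectSum.lof k ℕ (fun n => (L.pullback f).sections k n) _)
    have h1 := hker _ h0
    rw [map_mul] at h1
    have h2 : α (X.evaluation _ x hx a) = 0 := by
      rw [hα, hv a M σ hσ, (mul_eq_zero.1 h1).resolve_right hs, zero_div]
    rw [← Scheme.evaluation_ne_zero_iff_mem_basicOpen X _ hx] at hxa
    exact hxa (α.eq_zero.1 h2)
  have hαk (a : k) : α (residueHom k x a) = ‖a‖ := by
    rw [← evaluation_structureHom k (nonvanishing s) x hx, hα,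
      hv _ 0 (castSection (mul_zero n).symm (a • oneSection)) (by
        rw [rationalValue_castSection, rationalValue_smul, rationalValue_oneSection, pow_zero,
          ← map_structureHom k (le_top : nonvanishing s ≤ ⊤), rationalOf_restrict]),
      SectionAlgebra.of_castSection, SectionAlgebra.of_smul, SectionAlgebra.of_oneSection,
      pow_zero, div_one, ← Algebra.algebraMap_eq_smul_one, hk]
  obtain ⟨i, hxs⟩ := mem_nonvanishing.1 hx
  have hi : x ∈ L.U i := X.basicOpen_le _ hxs
  obtain ⟨y, hy⟩ := exists_analytification_map_eq f ⟨x, α, hαk⟩ hxr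
  have hfy : f y.pt = x := congrArg Analytification.pt hy
  subst hfy
  rw [← Scheme.evaluation_ne_zero_iff_mem_basicOpen X _ hi, ← α.ne_zero_iff] at hxs
  have hspos : 0 < z (SectionAlgebra.of s) := (apply_nonneg z _).lt_of_ne' hs
  have htpos : 0 < α (X.evaluation (L.U i) _ hi (s.1 i)) := (α.nonneg _).lt_of_ne' hxs
  -- The constant is forced by the formula for `σ = s`, of degree `n`. For general `σ` of degree `m`
  -- one compares `σ ^ n` with `s ^ m`, both of degree `m * n`, and takes `n`-th roots.
  refine ⟨y, i, hi, (z (SectionAlgebra.of s) / α (X.evaluation (L.U i) _ hi (s.1 i))) ^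
    ((n : ℝ)⁻¹), Real.rpow_pos_of_pos (div_pos hspos htpos) _, fun m σ => ?_⟩
  have hα' : (y.map f).absEval hi (σ.1 i) = α (X.evaluation (L.U i) _ hi (σ.1 i)) := by
    -- Quantifying over the membership proof lets the equality of points be used although the
    -- expression depends on the point.
    have := congrArg (fun w : Analytification k X => ∃ h, w.absEval (U := L.U i) h (σ.1 i) =
      α (X.evaluation (L.U i) _ hi (σ.1 i))) hy
    exact (this.mpr ⟨hi, rfl⟩).choose_spec
  obtain ⟨a, ha⟩ := exists_rationalOf_nonvanishing_eq (mul_comm m n) σ s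
  have hrel : rationalOf _ hV a * rationalValue s ^ m = rationalValue σ ^ n := by
    rw [ha, div_mul_cancel₀ _ (pow_ne_zero _ hs0)]
  have h1 := hv a m (castSection (mul_comm m n) (powSection σ n)) (by
    rw [rationalValue_castSection, rationalValue_powSection, hrel])
  have h2 := congrArg α (evaluation_mul_eq a (castSection (mul_comm m n) (powSection σ n))
    (powSection s m) (fun _ => by
      rw [rationalValue_castSection, rationalValue_powSection, rationalValue_powSection, hrel])
    hx i hi)
  have h3 : X.evaluation (L.U i) _ hi ((powSection s m).1 i) =
    X.evaluation (L.U i) _ hi (s.1 i) ^ m := map_pow (X.evaluation (L.U i) _ hi).hom _ _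
  have h4 : X.evaluation (L.U i) _ hi ((castSection (mul_comm m n) (powSection σ n)).1 i) =
    X.evaluation (L.U i) _ hi (σ.1 i) ^ n := map_pow (X.evaluation (L.U i) _ hi).hom _ _
  rw [α.map_mul, hα, h1, SectionAlgebra.of_castSection, ← SectionAlgebra.of_pow, map_pow, h3, h4,
    map_pow, map_pow] at h2
  rw [hα']
  refine (pow_left_inj₀ (apply_nonneg z _) (by positivity) hn.ne').1 ?_
  rw [mul_pow, ← h2, ← pow_mul, mul_comm m n, pow_mul, Real.rpow_inv_natCast_pow
    (div_pos hspos htpos).le hn.ne', div_pow]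
  field_simp

end LineBundle

/-! ### Comparison with the Fubini–Study metrics -/

/-- A finite type algebra is spanned by the monomials in its generators, of which there are
countably many. -/
theorem exists_span_range_eq_top (k A : Type*) [CommRing k] [CommRing A] [Algebra k A]
    [Algebra.FiniteType k A] : ∃ e : ℕ → A, Submodule.span k (Set.range e) = ⊤ := by
  obtain ⟨n, q, hq⟩ := (Algebra.FiniteType.iff_quotient_mvPolynomial'' (R := k) (S := A)).1
    inferInstance
  obtain ⟨g, hg⟩ := exists_surjective_nat (Fin n →₀ ℕ)
  refine ⟨fun m => q (MvPolynomial.monomial (g m) 1), ?_⟩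
  have h : Set.range (fun m => q (MvPolynomial.monomial (g m) (1 : k))) =
      q.toLinearMap '' Set.range (MvPolynomial.basisMonomials (Fin n) k) := by
    rw [← Set.range_comp, ← hg.range_comp]
    simp only [Function.comp_def, MvPolynomial.coe_basisMonomials]
    rfl
  rw [h, Submodule.span_image, Module.Basis.span_eq, Submodule.map_top]
  exact LinearMap.range_eq_top.2 hq

namespace LineBundle

/-- Evaluation at `x` factors through the functions on one affine chart, a finite type algebra. The
resulting spanning sequence serves all degrees and supplies the countability hypothesis of
`norm_liftBaseChange_le`. -/
theorem exists_evalAt_mem_span {k : Type u} [NormedField k] {X : Scheme.{u}}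
    [X.Over (Spec (CommRingCat.of k))] [LocallyOfFiniteType (X ↘ Spec (CommRingCat.of k))]
    (L : LineBundle X) (i : L.ι) (x : Analytification k X) (hx : x.pt ∈ L.U i) :
    ∃ e : ℕ → x.CompletedResidueField, ∀ n (s : L.sections k n),
      L.evalAt n i x hx s ∈ Submodule.span k (Set.range e) := by
  obtain ⟨_, ⟨W, hW, rfl⟩, hxW, hWi⟩ :=
    X.isBasis_affineOpens.exists_subset_of_mem_open hx (L.U i).isOpen
  replace hWi : W ≤ L.U i := hWi
  have hfin : (structureHom k W).FiniteType :=
    ((X ↘ Spec (CommRingCat.of k)).finiteType_appLE (isAffineOpen_top _) hW le_top).comp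
      (RingHom.FiniteType.of_surjective _
        (Scheme.ΓSpecIso (CommRingCat.of k)).symm.commRingCatIsoToRingEquiv.surjective)
  have : Algebra.FiniteType k Γ(X, W) := hfin
  obtain ⟨e, he⟩ := exists_span_range_eq_top k Γ(X, W)
  let q : Γ(X, W) →ₗ[k] x.CompletedResidueField :=
    { toFun := fun a => x.toCompleted (X.evaluation W x.pt hxW a)
      map_add' := fun a b => by simp
      map_smul' := fun c a => by
        rw [Algebra.smul_def, map_mul, map_mul, RingHom.id_apply, Algebra.smul_def]
        congr 1
        exact congrArg x.toCompleted (evaluation_structureHom k W x.pt hxW c) }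
  refine ⟨q ∘ e, fun n s => ?_⟩
  rw [Set.range_comp, Submodule.span_image, he, Submodule.map_top]
  exact ⟨X.presheaf.map (homOfLE hWi).op (s.1 i), congrArg (fun a => x.toCompleted (X.residue _ a))
    (X.presheaf.germ_res_apply (homOfLE hWi) x.pt hxW (s.1 i))⟩

/-- A norm on the fibre of `L` at `x` that is dominated by the supremum norms of an asymptotic
Fubini–Study metric is dominated by that metric. -/
theorem Metric.le_frameNorm {k : Type u} [NontriviallyNormedField k] [IsUltrametricDist k]
    [CompleteSpace k] {X : Scheme.{u}} [X.Over (Spec (CommRingCat.of k))]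
    [LocallyOfFiniteType (X ↘ Spec (CommRingCat.of k))] {L : LineBundle X} {φ : Metric k L}
    (hφ : φ.IsAsymptoticFubiniStudy) (i : L.ι) (x : Analytification k X) (hx : x.pt ∈ L.U i)
    {c : ℝ} (hc : 0 < c) (h : ∀ n (s : L.sections k n),
      ENNReal.ofReal (x.absEval hx (s.1 i) * c ^ n) ≤ φ.supNorm s) :
    c ≤ φ.frameNorm i x hx := by
  obtain ⟨p, hp, hconv⟩ := hφ
  obtain ⟨e, he⟩ := L.exists_evalAt_mem_span i x hx
  let := x.normedAlgebraCompleted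
  have := x.isUltrametricDist_completed
  -- One `ε` is lost in comparing supremum norms with `pₙ`, another in comparing the Fubini–Study
  -- metric with `φ`.
  have key (ε : ℝ) (hε : 0 < ε) : c ≤ Real.exp (2 * ε) * φ.frameNorm i x hx := by
    obtain ⟨m, hm⟩ := Filter.eventually_atTop.1 (hconv ε hε)
    let n := m + 1
    have hn : n ≠ 0 := m.succ_ne_zero
    replace hm := hm n m.le_succ
    have hle (s : L.sections k n) :
        ‖L.evalAt n i x hx s‖ ≤ Real.exp (n * ε) / c ^ n * p n s := by
      rw [norm_evalAt, div_mul_eq_mul_div, le_div_iff₀ (pow_pos hc n)]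
      have h1 : φ.supNorm s ≤ ENNReal.ofReal (Real.exp (n * ε) * p n s) :=
        iSup_le fun y => ENNReal.ofReal_le_ofReal (φ.abs_le_exp_mul hn (hp n) hm s y)
      exact (ENNReal.ofReal_le_ofReal_iff
        (mul_nonneg (Real.exp_pos _).le (apply_nonneg (p n) s))).1 ((h n s).trans h1)
    have hC : 0 < Real.exp (n * ε) / c ^ n := div_pos (Real.exp_pos _) (pow_pos hc n)
    have hFS : c ^ n / Real.exp (n * ε) ≤ fubiniStudy (p n) i x hx := by
      refine le_csInf ?_ ?_
      -- An empty set of competitors would give the infimum `0`, against positivity of the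
      -- Fubini–Study metric in this degree.
      · by_contra hne
        have h0 := (hm i x hx).1
        rw [fubiniStudy, Set.not_nonempty_iff_eq_empty.1 hne, Real.sInf_empty] at h0
        exact lt_irrefl _ h0
      · rintro r ⟨w, hw, rfl⟩
        have h1 := norm_liftBaseChange_le (hp n) (L.evalAt n i x hx) e (he n) hC.le hle w
        have h2 : (1 : ℝ) ≤ Real.exp (n * ε) / c ^ n *
            scalarExtension (p n) x.CompletedResidueField w := by
          refine le_trans (le_of_eq ?_) h1
          exact (norm_one (α := x.CompletedResidueField)).symm.trans (congrArg norm hw.symm)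
        rw [div_mul_eq_mul_div, le_div_iff₀ (pow_pos hc n), one_mul] at h2
        rwa [div_le_iff₀' (Real.exp_pos _)]
    have h2 := (le_exp_mul_pow_of_abs_log_le (hm i x hx).1 (φ.frameNorm_pos i x hx) hn
      (hm i x hx).2).1
    have h3 := hFS.trans h2
    rw [div_le_iff₀' (Real.exp_pos _), ← mul_assoc, ← Real.exp_add] at h3
    refine (pow_le_pow_iff_left₀ hc.le
      (mul_nonneg (Real.exp_pos _).le (φ.frameNorm_pos i x hx).le) hn).1 (h3.trans_eq ?_)
    rw [mul_pow, ← Real.exp_nat_mul]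
    congr 2
    ring
  have hlim : Filter.Tendsto (fun ε : ℝ => Real.exp (2 * ε) * φ.frameNorm i x hx) (𝓝[>] 0)
      (𝓝 (Real.exp (2 * 0) * φ.frameNorm i x hx)) :=
    (Continuous.tendsto (by fun_prop) 0).mono_left nhdsWithin_le_nhds
  rw [mul_zero, Real.exp_zero, one_mul] at hlim
  exact ge_of_tendsto hlim (Filter.eventually_of_mem self_mem_nhdsWithin key)

end LineBundle

/-! ### The spectral seminorm of the quotient norm -/

namespace LineBundle

/-- The bound for `a⁻¹` is the reverse bound for `a`, by multiplicativity. -/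
theorem norm_algebraMap_eq_of_le {k A : Type*} [NormedField k] [CommRing A] [Algebra k A]
    (z : MulRingSeminorm A) (h : ∀ a : k, z (algebraMap k A a) ≤ ‖a‖) (a : k) :
    z (algebraMap k A a) = ‖a‖ := by
  rcases eq_or_ne a 0 with rfl | ha
  · rw [map_zero, map_zero, norm_zero]
  refine le_antisymm (h a) ?_
  have h1 : z (algebraMap k A a) * z (algebraMap k A a⁻¹) = 1 := by
    rw [← map_mul, ← map_mul, mul_inv_cancel₀ ha, map_one, map_one]
  have h2 := mul_le_mul_of_nonneg_left (h a⁻¹) (apply_nonneg z (algebraMap k A a))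
  rwa [h1, norm_inv, ← div_eq_mul_inv, one_le_div (norm_pos_iff.2 ha)] at h2

variable {k : Type u} [NontriviallyNormedField k] {X Y : Scheme.{u}}
  [X.Over (Spec (CommRingCat.of k))] [Y.Over (Spec (CommRingCat.of k))] (f : Y ⟶ X)
  [f.IsOver (Spec (CommRingCat.of k))] {L : LineBundle X}

/-- The multiplicative seminorm on `V_•(L)` induced by one on `V_•(L_{X|Y})`. -/
def pullbackSeminorm (z : MulRingSeminorm (L.RestrictedAlgebra k f)) :
    MulRingSeminorm (L.SectionAlgebra k) where
  toFun s := z ((L.algebraPullback k f).rangeRestrict s)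
  map_zero' := by rw [map_zero, map_zero]
  add_le' s t := by
    rw [map_add]
    exact map_add_le_add z _ _
  neg' s := by rw [map_neg, map_neg_eq_map]
  map_one' := by rw [map_one, map_one]
  map_mul' s t := by rw [map_mul, map_mul]

theorem pullbackSeminorm_apply (z : MulRingSeminorm (L.RestrictedAlgebra k f))
    (s : L.SectionAlgebra k) :
    pullbackSeminorm f z s = z ((L.algebraPullback k f).rangeRestrict s) := rfl

variable [IsUltrametricDist k] [CompleteSpace k] [IsIntegral X]
  [IsProper (X ↘ Spec (CommRingCat.of k))] [IsClosedImmersion f] [IsReduced Y] {φ : L.Metric k}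

/-- A bounded multiplicative seminorm on `V_•(L_{X|Y})` is dominated on homogeneous elements of
positive degree by the supremum norm over `Y`. -/
theorem ofReal_le_algNorm_pullback (hL : L.IsAmple k) (hφ : φ.IsAsymptoticFubiniStudy)
    (z : MulRingSeminorm (L.RestrictedAlgebra k f)) (hna : IsNonarchimedean z)
    (hz : ∀ t, ENNReal.ofReal (z t) ≤ φ.quotientAlgNorm f t)
    (hk : ∀ a : k, z (algebraMap k _ a) = ‖a‖) {d : ℕ} (hd : 0 < d) (s : L.sections k d) :
    ENNReal.ofReal (z ((L.algebraPullback k f).rangeRestrict (SectionAlgebra.of s))) ≤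
      (φ.pullback f).algNorm (L.algebraPullback k f (SectionAlgebra.of s)) := by
  have := hL.1
  by_cases hs : pullbackSeminorm f z (SectionAlgebra.of s) = 0
  · rw [← pullbackSeminorm_apply, hs, ENNReal.ofReal_zero]
    exact zero_le
  obtain ⟨n, hn, t, haff, hV, ht⟩ := exists_isAffineOpen_nonvanishing hL _ hd hs
  have hna' : IsNonarchimedean (pullbackSeminorm f z) := fun a b => by
    simp only [pullbackSeminorm_apply, map_add]
    exact hna _ _
  obtain ⟨y, i, hi, c, hc, h⟩ := exists_analytification_eq f (pullbackSeminorm f z) hna'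
    (fun a => by
      rw [pullbackSeminorm_apply, AlgHom.commutes]
      exact hk a)
    (fun a ha => by
      have h0 : (L.algebraPullback k f).rangeRestrict a = 0 := Subtype.ext ha
      rw [pullbackSeminorm_apply, h0, map_zero]) hn t ht hV haff
  have hle : c ≤ φ.frameNorm i (y.map f) hi := by
    -- The bound by the quotient norm makes `z` at most the supremum norm over `X` of every section.
    refine Metric.le_frameNorm hφ i (y.map f) hi hc fun m σ => ?_
    rw [← h m σ, ← φ.algNorm_of]
    exact (hz _).trans (φ.quotientAlgNorm_le f rfl)
  rw [← pullbackSeminorm_apply, h d s, algebraPullback_of, Metric.algNorm_of]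
  refine le_trans (ENNReal.ofReal_le_ofReal ?_)
    (le_iSup (fun y => ENNReal.ofReal ((φ.pullback f).abs (L.sectionsPullback k f d s) y)) y)
  rw [Metric.pullback_abs, φ.abs_eq s (y.map f) i hi]
  exact mul_le_mul_of_nonneg_left (pow_le_pow_left₀ hc.le hle d) ((y.map f).abs.nonneg _)

/-- The spectral seminorm of the quotient norm is dominated by the supremum norm over `Y`. -/
theorem ofReal_smoothingFun_le [Nonempty (Analytification k Y)] (hL : L.IsAmple k)
    (hφ : φ.IsAsymptoticFubiniStudy) (P : AlgebraNorm k (L.RestrictedAlgebra k f))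
    (hPna : IsNonarchimedean P) (hP1 : P 1 = 1)
    (hP : ∀ t, ENNReal.ofReal (P t) = φ.quotientAlgNorm f t) (t : L.RestrictedAlgebra k f) :
    ENNReal.ofReal (smoothingFun P.toRingSeminorm' t) ≤
      (φ.pullback f).algNorm (t : (L.pullback f).SectionAlgebra k) := by
  have hom {d : ℕ} (s : L.sections k d) :
      ENNReal.ofReal (smoothingFun P.toRingSeminorm'
        ((L.algebraPullback k f).rangeRestrict (SectionAlgebra.of s))) ≤
      (φ.pullback f).algNorm (L.algebraPullback k f (SectionAlgebra.of s)) := by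
    rcases Nat.eq_zero_or_pos d with rfl | hd
    -- A section of degree `0` has constant absolute value, so its supremum over `X^an` is already
    -- reached at any point of `Y^an`.
    · obtain ⟨r, hr⟩ := exists_forall_abs_eq s
      have h1 := smoothingFun_le_self P.toRingSeminorm'
        ((L.algebraPullback k f).rangeRestrict (SectionAlgebra.of s))
      refine (ENNReal.ofReal_le_ofReal h1).trans ((hP _).le.trans ?_)
      refine (φ.quotientAlgNorm_le f rfl).trans ?_
      rw [Metric.algNorm_of, algebraPullback_of, Metric.algNorm_of]
      refine iSup_le fun x => ?_
      obtain ⟨y⟩ := ‹Nonempty (Analytification k Y)›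
      refine le_trans (le_of_eq ?_) (le_iSup
        (fun y => ENNReal.ofReal ((φ.pullback f).abs (L.sectionsPullback k f 0 s) y)) y)
      simp only [Metric.pullback_abs, hr]
    · by_cases h0 : smoothingFun P.toRingSeminorm'
        ((L.algebraPullback k f).rangeRestrict (SectionAlgebra.of s)) = 0
      · rw [h0, ENNReal.ofReal_zero]
        exact zero_le
      obtain ⟨z, hna, hzP, hzt⟩ := exists_mulRingSeminorm_eq_smoothingFun P.toRingSeminorm'
        hP1.le hPna _ h0
      rw [← hzt]
      refine ofReal_le_algNorm_pullback f hL hφ z hna (fun t => ?_)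
        (norm_algebraMap_eq_of_le z fun a => ?_) hd s
      · exact (ENNReal.ofReal_le_ofReal (hzP t)).trans (hP t).le
      · refine (hzP _).trans (le_of_eq ?_)
        change P (algebraMap k _ a) = ‖a‖
        rw [Algebra.algebraMap_eq_smul_one, map_smul_eq_mul, hP1, mul_one]
  obtain ⟨t, s, rfl⟩ := t
  change ENNReal.ofReal (smoothingFun P.toRingSeminorm'
    ((L.algebraPullback k f).rangeRestrict s)) ≤ (φ.pullback f).algNorm (L.algebraPullback k f s)
  obtain ⟨S, hS⟩ := s.exists_eq_sum
  have hterm (n : ℕ) : ENNReal.ofReal (smoothingFun P.toRingSeminorm'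
      ((L.algebraPullback k f).rangeRestrict (SectionAlgebra.of (s.component n)))) ≤
      (φ.pullback f).algNorm (L.algebraPullback k f s) := by
    refine (hom (s.component n)).trans ?_
    rw [algebraPullback_of, Metric.algNorm_of, ← component_algebraPullback]
    exact (φ.pullback f).supNorm_component_le _ n
  -- The spectral seminorm is non-Archimedean, so bounds on the homogeneous components bound the
  -- sum.
  have hsum : ∀ T : Finset ℕ, ENNReal.ofReal (smoothingFun P.toRingSeminorm'
      ((L.algebraPullback k f).rangeRestrict (∑ n ∈ T, SectionAlgebra.of (s.component n)))) ≤
      (φ.pullback f).algNorm (L.algebraPullback k f s) := by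
    intro T
    classical
    induction T using Finset.induction_on with
    | empty =>
      have h0 := (smoothingFun_le_self P.toRingSeminorm' 0).trans_eq (map_zero _)
      rw [Finset.sum_empty, map_zero, ENNReal.ofReal_of_nonpos h0]
      exact zero_le
    | insert m T hm ih =>
      rw [Finset.sum_insert hm, map_add]
      refine (ENNReal.ofReal_le_ofReal
        (isNonarchimedean_smoothingFun P.toRingSeminorm' hP1.le hPna _ _)).trans ?_
      rw [ENNReal.ofReal_max]
      exact max_le (hterm m) ih
  have := hsum S
  rwa [← hS] at this

/-- The spectral seminorm of the quotient norm is the supremum norm over `Y`. -/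
theorem tendsto_pow_one_div [Nonempty (Analytification k Y)] (hL : L.IsAmple k)
    (hφ : φ.IsAsymptoticFubiniStudy) (P Q : AlgebraNorm k (L.RestrictedAlgebra k f))
    (hPna : IsNonarchimedean P) (hP1 : P 1 = 1)
    (hP : ∀ t, ENNReal.ofReal (P t) = φ.quotientAlgNorm f t)
    (hQ : ∀ t, ENNReal.ofReal (Q t) = (φ.pullback f).algNorm t) (t : L.RestrictedAlgebra k f) :
    Filter.Tendsto (fun n : ℕ => P (t ^ n) ^ (1 / (n : ℝ))) Filter.atTop (𝓝 (Q t)) := by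
  have h1 := tendsto_smoothingFun_of_map_one_le_one P.toRingSeminorm' hP1.le t
  have h2 : smoothingFun P.toRingSeminorm' t = Q t := by
    refine le_antisymm ?_ ?_
    · rw [← ENNReal.ofReal_le_ofReal_iff (apply_nonneg Q t), hQ]
      exact ofReal_smoothingFun_le f hL hφ P hPna hP1 hP t
    · refine ge_of_tendsto h1 (Filter.eventually_atTop.2 ⟨1, fun n hn => ?_⟩)
      have hn0 : n ≠ 0 := Nat.one_le_iff_ne_zero.1 hn
      -- The easy inequality: `Q` is power-multiplicative and at most `P`.
      have h3 : Q t ^ n ≤ P (t ^ n) := by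
        rw [← ENNReal.ofReal_le_ofReal_iff (apply_nonneg P _),
          ENNReal.ofReal_pow (apply_nonneg Q t), hP, hQ]
        exact ((φ.pullback f).pow_algNorm_le _ hn0).trans
          (φ.pullback_algNorm_le_quotientAlgNorm f (t ^ n))
      have h4 := Real.rpow_le_rpow (pow_nonneg (apply_nonneg Q t) n) h3
        (by positivity : (0 : ℝ) ≤ 1 / n)
      rw [one_div, Real.pow_rpow_inv_natCast (apply_nonneg Q t) hn0, ← one_div] at h4
      exact h4
  rw [← h2]
  exact h1

end LineBundle

end NormedSections

end

/-! ### The main theorem -/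

theorem mainTheorem3 {k : Type u} [NontriviallyNormedField k] [IsUltrametricDist k]
    [CompleteSpace k] {X Y : Scheme.{u}}
    [X.Over (Spec (CommRingCat.of k))] [Y.Over (Spec (CommRingCat.of k))]
    (hX : NormedSections.IsProjectiveOver k X) [IsIntegral X]
    (f : Y ⟶ X) [f.IsOver (Spec (CommRingCat.of k))] [IsClosedImmersion f]
    [IsReduced Y] [Nonempty Y]
    (M : X.Modules) (hM : NormedSections.IsInvertible M)
    (hample : (NormedSections.lineBundle M hM).IsAmple k)
    (φ : (NormedSections.lineBundle M hM).Metric k) (hφ : φ.IsAsymptoticFubiniStudy) :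
    ∃ P Q : AlgebraNorm k ((NormedSections.lineBundle M hM).RestrictedAlgebra k f),
      P 1 = 1 ∧ Q 1 = 1 ∧
      (∀ t, ENNReal.ofReal (P t) = φ.quotientAlgNorm f t) ∧
      (∀ t, ENNReal.ofReal (Q t) = (φ.pullback f).algNorm t) ∧
      (∀ t, Filter.Tendsto (fun n : ℕ => P (t ^ n) ^ (1 / (n : ℝ))) Filter.atTop (𝓝 (Q t))) ∧
      ∃ h : NormedSections.BerkovichSpectrum k (NormedSections.AlgebraCompletion P) ≃ₜ
          NormedSections.BerkovichSpectrum k (NormedSections.AlgebraCompletion Q),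
        ∀ z t, (h z).eval (NormedSections.toCompletion Q t) =
          z.eval (NormedSections.toCompletion P t) := by
  have := hX.isProper
  have : LocallyOfFiniteType (Y ↘ Spec (CommRingCat.of k)) := by
    rw [← comp_over f (Spec (CommRingCat.of k))]
    infer_instance
  have : Nonempty (NormedSections.Analytification k Y) := by
    obtain ⟨y, -⟩ := NormedSections.exists_analytification_mem (k := k) (⊤ : Y.Opens)
      (Set.univ_nonempty)
    exact ⟨y⟩
  -- Any lift to `X` bounds the quotient norm, and lifts have finite supremum norm.
  have hfin t : φ.quotientAlgNorm f t ≠ ⊤ := by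
    obtain ⟨t, s, rfl⟩ := t
    exact ne_top_of_le_ne_top (NormedSections.LineBundle.Metric.algNorm_ne_top hφ s)
      (φ.quotientAlgNorm_le f rfl)
  have hle := φ.pullback_algNorm_le_quotientAlgNorm f
  have hzero (t : (NormedSections.lineBundle M hM).RestrictedAlgebra k f)
      (ht : (φ.pullback f).algNorm t = 0) : t = 0 :=
    Subtype.ext ((φ.pullback f).eq_zero_of_algNorm_eq_zero ht)
  obtain ⟨P, hPna, hP⟩ := NormedSections.exists_algebraNorm (k := k) (φ.quotientAlgNorm f) hfin
    (φ.quotientAlgNorm_zero f) (φ.quotientAlgNorm_add_le f) (φ.quotientAlgNorm_mul_le f hfin)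
    (φ.quotientAlgNorm_smul f)
    (fun t ht => hzero t (le_antisymm ((hle t).trans_eq ht) zero_le))
  obtain ⟨Q, -, hQ⟩ := NormedSections.exists_algebraNorm (k := k)
    (fun t : (NormedSections.lineBundle M hM).RestrictedAlgebra k f => (φ.pullback f).algNorm t)
    (fun t => ne_top_of_le_ne_top (hfin t) (hle t)) (φ.pullback f).algNorm_zero
    (fun a b => (φ.pullback f).algNorm_add_le _ _) (fun a b => (φ.pullback f).algNorm_mul_le _ _)
    (fun c a => (φ.pullback f).algNorm_smul c _) hzero
  have hQP t : Q t ≤ P t := by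
    rw [← ENNReal.ofReal_le_ofReal_iff (apply_nonneg P t), hP, hQ]
    exact hle t
  have hQ1 : Q 1 = 1 := by
    rw [← ENNReal.toReal_ofReal (apply_nonneg Q 1), hQ]
    exact congrArg ENNReal.toReal (φ.pullback f).algNorm_one
  have hP1 : P 1 = 1 := by
    refine le_antisymm ?_ (hQ1.symm.le.trans (hQP 1))
    rw [← ENNReal.ofReal_le_ofReal_iff zero_le_one, hP, ENNReal.ofReal_one]
    exact (φ.quotientAlgNorm_le f (map_one _)).trans φ.algNorm_one_le
  have hlim := NormedSections.LineBundle.tendsto_pow_one_div f hample hφ P Q hPna hP1 hP hQ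
  exact ⟨P, Q, hP1, hQ1, hP, hQ, hlim,
    NormedSections.BerkovichSpectrum.exists_homeomorph hQP hlim⟩
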